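/- Notation. Let $m_1,m_2,n$ be given, $m=m_1+m_2$, $j=\mathrm{diag}(I_{m_1},-I_{m_2})$; $\|\cdot\|$ is the spectral norm. A potential is a sequence $\{C_k\}_{k\ge 0}$ of positive definite $m\times m$ matrices with $C_kjC_k=j$; $W_k(z)$ is defined by $W_0=I_m$, $W_{k+1}(z)=(I_m+\mathrm{i}zjC_k)W_k(z)$; an $m_1\times m_2$ matrix function $\varphi$ on $\mathbb{C}_-$ is a Weyl function of the Dirac system $y_{k+1}=(I_m+\mathrm{i}zjC_k)y_k$ if $$\sum_{k\ge 0}(1+|z|^2)^{-k}\,[\varphi(z)^*\ \ I_{m_2}]\,W_k(z)^*C_kW_k(z)\begin{bmatrix}\varphi(z)\\ I_{m_2}\end{bmatrix}<\infty\qquad(z\in\mathbb{C}_-).$$ Let $\mathcal{G}_n$ be the class of triples $\{\mathcal{A},\mathcal{B},\mathcal{C}\}$ (of sizes $n\times n$, $n\times m_2$, $m_1\times n$) such that $\psi(z)=\mathcal{C}(zI_n-\mathcal{A})^{-1}\mathcal{B}$ is a minimal realization of a function contractive on $\mathbb{C}_-$. For a triple and a matrix $X>0$ with $$X\mathcal{B}\mathcal{B}^*X-\mathrm{i}(\mathcal{A}^*X-X\mathcal{A})+\mathcal{C}^*\mathcal{C}=0\qquad(1)$$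 put $A=\mathcal{A}-\mathrm{i}\mathcal{B}\mathcal{B}^*X$, $S_0=X^{-1}$, $\Pi_0=[\mathrm{i}X^{-1}\mathcal{C}^*\ \ \mathcal{B}]$ and, if $\det A\neq 0$, $$\Pi_{k+1}=\Pi_k+\mathrm{i}A^{-1}\Pi_kj,\qquad S_{k+1}=S_k+A^{-1}S_k(A^*)^{-1}+A^{-1}\Pi_k\Pi_k^*(A^*)^{-1},$$ $$C_k=I_m+\Pi_k^*S_k^{-1}\Pi_k-\Pi_{k+1}^*S_{k+1}^{-1}\Pi_{k+1},$$ $$R_k=(I_n+\mathrm{i}A^{-1})^{-k}S_k(I_n-\mathrm{i}(A^*)^{-1})^{-k},\qquad Q_k=(I_n-\mathrm{i}A^{-1})^{-k}S_k(I_n+\mathrm{i}(A^*)^{-1})^{-k}.$$ The triple $\{A,S_0,\Pi_0\}$ is called admissible if $\det A\ne0$, $S_0>0$ and $AS_0-S_0A^*=\mathrm{i}\Pi_0j\Pi_0^*$. For Hermitian matrices, $M_k\to+\infty$ means that for every $c\in\mathbb{R}$, $M_k\ge cI_n$ for all large $k$. Theorem. Let $\{\mathcal{A},\mathcal{B},\mathcal{C}\}\in\mathcal{G}_n$.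 Then there is exactly one $X>0$ which satisfies (1) and $$\sigma(\mathcal{A}-\mathrm{i}\mathcal{B}\mathcal{B}^*X)\subset\mathbb{C}_+\cup\mathbb{R}.\qquad(2)$$ Let $X$ be this matrix and assume that $\det A\neq 0$. Then $\{A,S_0,\Pi_0\}$ is admissible, and the sequence $\{C_k\}$ is a potential, $\varphi(z)=\psi(-1/z)$ is a Weyl function of its Dirac system, and no other potential has the Weyl function $\varphi$. Assume moreover that either $R_k\to+\infty$, or $\mathrm{i}\notin\sigma(A)$ and $Q_k\to+\infty$. Then this recovery of $\{C_k\}$ is stable in the class $\mathcal{G}_n$: for each $\varepsilon>0$ there is $\delta>0$ such that for every $\{\widetilde{\mathcal{A}},\widetilde{\mathcal{B}},\widetilde{\mathcal{C}}\}\in\mathcal{G}_n$ with $\|\mathcal{A}-\widetilde{\mathcal{A}}\|+\|\mathcal{B}-\widetilde{\mathcal{B}}\|+\|\mathcal{C}-\widetilde{\mathcal{C}}\|<\delta$: (a) there is exactly one $\widetilde X>0$ that satisfies the analogues of (1), (2) for the perturbed triple; for it $\|X-\widetilde X\|<\varepsilon$, the triple $\{\widetilde A,\widetilde S_0,\widetilde\Pi_0\}$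 is admissible, and $\|C_k-\widetilde C_k\|<\varepsilon$ for all $k\ge 0$; (b) for each Hermitian solution $\widetilde X$ of the analogue of (1) with $\|X-\widetilde X\|<\delta$, the triple $\{\widetilde A,\widetilde S_0,\widetilde\Pi_0\}$ is admissible and $\|C_k-\widetilde C_k\|<\varepsilon$ for all $k\ge 0$. -/

import Mathlib

open Matrix Filter Topology
-- matrices carry the spectral (operator) norm
open scoped Matrix.Norms.L2Operator
-- `0 ≤ x` for complex `x` means that `x` is real and non-negative (used by `Matrix.PosDef`)
open scoped ComplexOrder

noncomputable section

namespace DiscreteDirac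

/-! ### Self-adjoint discrete Dirac systems and their Weyl functions -/

/-- The signature matrix `j = diag (I_{m₁}, -I_{m₂})`. -/
def sig (m₁ m₂ : ℕ) : Matrix (Fin m₁ ⊕ Fin m₂) (Fin m₁ ⊕ Fin m₂) ℂ :=
  Matrix.fromBlocks 1 0 0 (-1)

/-- `{C_k}` is the potential of a self-adjoint discrete Dirac system
`y_{k+1}(z) = (I + i z j C_k) y_k(z)`: every `C_k` is positive definite and `j`-unitary. -/
def IsDiracPotential {m₁ m₂ : ℕ} (C : ℕ → Matrix (Fin m₁ ⊕ Fin m₂) (Fin m₁ ⊕ Fin m₂) ℂ) : Prop :=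
  ∀ k, (C k).PosDef ∧ C k * sig m₁ m₂ * C k = sig m₁ m₂

/-- The fundamental solution `W_k(z)` of the system, normalized by `W_0(z) = I`. -/
def fundSol {m₁ m₂ : ℕ} (C : ℕ → Matrix (Fin m₁ ⊕ Fin m₂) (Fin m₁ ⊕ Fin m₂) ℂ) :
    ℕ → ℂ → Matrix (Fin m₁ ⊕ Fin m₂) (Fin m₁ ⊕ Fin m₂) ℂ
  | 0, _ => 1
  | k + 1, z => (1 + (Complex.I * z) • (sig m₁ m₂ * C k)) * fundSol C k z

/-- `φ` is a Weyl function (on the open lower half-plane) of the system with potential `{C_k}`: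
the series `∑ (1 + |z|²)^{-k} [φ(z)* I] W_k(z)* C_k W_k(z) [φ(z); I]` converges whenever
`Im z < 0`. -/
def IsWeylFunction {m₁ m₂ : ℕ} (C : ℕ → Matrix (Fin m₁ ⊕ Fin m₂) (Fin m₁ ⊕ Fin m₂) ℂ)
    (φ : ℂ → Matrix (Fin m₁) (Fin m₂) ℂ) : Prop :=
  ∀ z : ℂ, z.im < 0 →
    Summable fun k : ℕ =>
      (((1 + ‖z‖ ^ 2)⁻¹ ^ k : ℝ) : ℂ) •
        ((Matrix.fromRows (φ z) (1 : Matrix (Fin m₂) (Fin m₂) ℂ))ᴴ * (fundSol C k z)ᴴ * C k *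
          fundSol C k z * Matrix.fromRows (φ z) (1 : Matrix (Fin m₂) (Fin m₂) ℂ))

/-! ### Sequences determined by parameter matrices `A`, `S₀`, `Π₀` -/

/-- The triple `{A, S₀, Π₀}` is admissible. -/
structure IsAdmissible {m₁ m₂ n : ℕ} (A S₀ : Matrix (Fin n) (Fin n) ℂ)
    (P₀ : Matrix (Fin n) (Fin m₁ ⊕ Fin m₂) ℂ) : Prop where
  det_ne_zero : A.det ≠ 0
  posDef : S₀.PosDef
  identity : A * S₀ - S₀ * Aᴴ = Complex.I • (P₀ * sig m₁ m₂ * P₀ᴴ)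

/-- `Π_{k+1} = Π_k + i A⁻¹ Π_k j`. -/
def seqP {m₁ m₂ n : ℕ} (A : Matrix (Fin n) (Fin n) ℂ) (P₀ : Matrix (Fin n) (Fin m₁ ⊕ Fin m₂) ℂ) :
    ℕ → Matrix (Fin n) (Fin m₁ ⊕ Fin m₂) ℂ
  | 0 => P₀
  | k + 1 => seqP A P₀ k + Complex.I • (A⁻¹ * seqP A P₀ k * sig m₁ m₂)

/-- `S_{k+1} = S_k + A⁻¹ S_k (A*)⁻¹ + A⁻¹ Π_k Π_k* (A*)⁻¹`. -/
def seqS {m₁ m₂ n : ℕ} (A S₀ : Matrix (Fin n) (Fin n) ℂ)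
    (P₀ : Matrix (Fin n) (Fin m₁ ⊕ Fin m₂) ℂ) : ℕ → Matrix (Fin n) (Fin n) ℂ
  | 0 => S₀
  | k + 1 => seqS A S₀ P₀ k + A⁻¹ * seqS A S₀ P₀ k * (Aᴴ)⁻¹ +
      A⁻¹ * seqP A P₀ k * (seqP A P₀ k)ᴴ * (Aᴴ)⁻¹

/-- `C_k = I + Π_k* S_k⁻¹ Π_k - Π_{k+1}* S_{k+1}⁻¹ Π_{k+1}`: the potential determined by
`{A, S₀, Π₀}`. -/
def seqC {m₁ m₂ n : ℕ} (A S₀ : Matrix (Fin n) (Fin n) ℂ)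
    (P₀ : Matrix (Fin n) (Fin m₁ ⊕ Fin m₂) ℂ) (k : ℕ) :
    Matrix (Fin m₁ ⊕ Fin m₂) (Fin m₁ ⊕ Fin m₂) ℂ :=
  1 + (seqP A P₀ k)ᴴ * (seqS A S₀ P₀ k)⁻¹ * seqP A P₀ k -
    (seqP A P₀ (k + 1))ᴴ * (seqS A S₀ P₀ (k + 1))⁻¹ * seqP A P₀ (k + 1)

/-- `R_r = (I + i A⁻¹)^{-r} S_r (I - i (A*)⁻¹)^{-r}`. -/
def seqR {m₁ m₂ n : ℕ} (A S₀ : Matrix (Fin n) (Fin n) ℂ)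
    (P₀ : Matrix (Fin n) (Fin m₁ ⊕ Fin m₂) ℂ) (r : ℕ) : Matrix (Fin n) (Fin n) ℂ :=
  ((1 + Complex.I • A⁻¹) ^ r)⁻¹ * seqS A S₀ P₀ r * ((1 - Complex.I • (Aᴴ)⁻¹) ^ r)⁻¹

/-- `Q_r = (I - i A⁻¹)^{-r} S_r (I + i (A*)⁻¹)^{-r}`. -/
def seqQ {m₁ m₂ n : ℕ} (A S₀ : Matrix (Fin n) (Fin n) ℂ)
    (P₀ : Matrix (Fin n) (Fin m₁ ⊕ Fin m₂) ℂ) (r : ℕ) : Matrix (Fin n) (Fin n) ℂ :=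
  ((1 - Complex.I • A⁻¹) ^ r)⁻¹ * seqS A S₀ P₀ r * ((1 + Complex.I • (Aᴴ)⁻¹) ^ r)⁻¹

/-- `M_k → +∞` for a sequence of Hermitian matrices: for every real `c`, eventually `M_k ≥ c I`
(equivalently, all the eigenvalues of `M_k` tend to `+∞`). -/
def TendsToPosInfinity {n : ℕ} (M : ℕ → Matrix (Fin n) (Fin n) ℂ) : Prop :=
  ∀ c : ℝ, ∀ᶠ k in atTop, (M k - (c : ℂ) • (1 : Matrix (Fin n) (Fin n) ℂ)).PosSemidef

/-! ### Realizations and the recovery procedure -/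

/-- The matrices `{𝒜, ℬ, 𝒞}` of a realization `ψ(z) = 𝒞 (z I_n - 𝒜)⁻¹ ℬ` of a strictly proper
rational `m₁ × m₂` matrix function. -/
@[ext] structure Realization (m₁ m₂ n : ℕ) where
  a : Matrix (Fin n) (Fin n) ℂ
  b : Matrix (Fin n) (Fin m₂) ℂ
  c : Matrix (Fin m₁) (Fin n) ℂ

namespace Realization

/-- `ψ(z) = 𝒞 (z I_n - 𝒜)⁻¹ ℬ` (meaningful for `z` outside the spectrum of `𝒜`). -/
def transfer {m₁ m₂ n : ℕ} (T : Realization m₁ m₂ n) (z : ℂ) : Matrix (Fin m₁) (Fin m₂) ℂ :=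
  T.c * (z • (1 : Matrix (Fin n) (Fin n) ℂ) - T.a)⁻¹ * T.b

/-- Two realizations (possibly of different sizes) realize the same rational function. -/
def SameFunction {m₁ m₂ n n' : ℕ} (T : Realization m₁ m₂ n) (T' : Realization m₁ m₂ n') : Prop :=
  ∀ z : ℂ, z ∉ spectrum ℂ T.a → z ∉ spectrum ℂ T'.a → T.transfer z = T'.transfer z

/-- The realization is minimal: no realization of the same function has a smaller size. -/
def IsMinimal {m₁ m₂ n : ℕ} (T : Realization m₁ m₂ n) : Prop :=
  ∀ (n' : ℕ) (T' : Realization m₁ m₂ n'), T.SameFunction T' → n ≤ n'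

/-- `ψ(z)* ψ(z) ≤ I` at all points of the open lower half-plane which are not eigenvalues
of `𝒜`. (Then `ψ` has no poles there.) -/
def IsContractive {m₁ m₂ n : ℕ} (T : Realization m₁ m₂ n) : Prop :=
  ∀ z : ℂ, z.im < 0 → z ∉ spectrum ℂ T.a → (1 - (T.transfer z)ᴴ * T.transfer z).PosSemidef

/-- The class `𝒢_n` of triples which determine minimal realizations of `m₁ × m₂` matrix functions
contractive on the open lower half-plane. -/
def classG (m₁ m₂ n : ℕ) : Set (Realization m₁ m₂ n) :=
  {T | T.IsMinimal ∧ T.IsContractive}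

/-- `‖𝒜 - 𝒜'‖ + ‖ℬ - ℬ'‖ + ‖𝒞 - 𝒞'‖`. -/
def distance {m₁ m₂ n : ℕ} (T T' : Realization m₁ m₂ n) : ℝ :=
  ‖T.a - T'.a‖ + ‖T.b - T'.b‖ + ‖T.c - T'.c‖

/-- The Riccati equation `X ℬ ℬ* X - i (𝒜* X - X 𝒜) + 𝒞* 𝒞 = 0`. -/
def Riccati {m₁ m₂ n : ℕ} (T : Realization m₁ m₂ n) (X : Matrix (Fin n) (Fin n) ℂ) : Prop :=
  X * T.b * T.bᴴ * X - Complex.I • (T.aᴴ * X - X * T.a) + T.cᴴ * T.c = 0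

/-- `A = 𝒜 - i ℬ ℬ* X`. -/
def recA {m₁ m₂ n : ℕ} (T : Realization m₁ m₂ n) (X : Matrix (Fin n) (Fin n) ℂ) :
    Matrix (Fin n) (Fin n) ℂ :=
  T.a - Complex.I • (T.b * T.bᴴ * X)

/-- `Π₀ = [ϑ₁ ϑ₂]` with `ϑ₁ = i X⁻¹ 𝒞*` and `ϑ₂ = ℬ`. -/
def recP {m₁ m₂ n : ℕ} (T : Realization m₁ m₂ n) (X : Matrix (Fin n) (Fin n) ℂ) :
    Matrix (Fin n) (Fin m₁ ⊕ Fin m₂) ℂ :=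
  Matrix.fromCols (Complex.I • (X⁻¹ * T.cᴴ)) T.b

/-- `{A, S₀, Π₀}`, with `S₀ = X⁻¹`, is an admissible triple. -/
def RecAdmissible {m₁ m₂ n : ℕ} (T : Realization m₁ m₂ n) (X : Matrix (Fin n) (Fin n) ℂ) : Prop :=
  IsAdmissible (T.recA X) X⁻¹ (T.recP X)

/-- The potential `{C_k}` determined by `{A, S₀, Π₀}`: the output of the recovery procedure. -/
def recC {m₁ m₂ n : ℕ} (T : Realization m₁ m₂ n) (X : Matrix (Fin n) (Fin n) ℂ) :
    ℕ → Matrix (Fin m₁ ⊕ Fin m₂) (Fin m₁ ⊕ Fin m₂) ℂ :=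
  seqC (T.recA X) X⁻¹ (T.recP X)

/-- The sequence `{R_k}` in the recovery procedure. -/
def recR {m₁ m₂ n : ℕ} (T : Realization m₁ m₂ n) (X : Matrix (Fin n) (Fin n) ℂ) :
    ℕ → Matrix (Fin n) (Fin n) ℂ :=
  seqR (T.recA X) X⁻¹ (T.recP X)

/-- The sequence `{Q_k}` in the recovery procedure. -/
def recQ {m₁ m₂ n : ℕ} (T : Realization m₁ m₂ n) (X : Matrix (Fin n) (Fin n) ℂ) :
    ℕ → Matrix (Fin n) (Fin n) ℂ :=
  seqQ (T.recA X) X⁻¹ (T.recP X)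

/-- The choice of `X` in the procedure: `X > 0` solves the Riccati equation and the spectrum of
`𝒜 - i ℬ ℬ* X` lies in the closed upper half-plane. -/
structure IsSpectralSolution {m₁ m₂ n : ℕ} (T : Realization m₁ m₂ n)
    (X : Matrix (Fin n) (Fin n) ℂ) : Prop where
  posDef : X.PosDef
  riccati : T.Riccati X
  spectrum_subset : spectrum ℂ (T.recA X) ⊆ {z : ℂ | 0 ≤ z.im}

/-- Stability, at `T` and `X`, of the recovery of the potential in the class `𝒢_n`.
For each triple `T'` of the class close to `T`: the solution `X'` chosen for `T'` by the same
spectral condition exists, is close to `X`, and the recovered potential is close to that of `T`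
uniformly in `k`; and the potentials are also uniformly close for each Hermitian solution `X'`
of the perturbed Riccati equation which is close to `X`. -/
def StableRecovery {m₁ m₂ n : ℕ} (T : Realization m₁ m₂ n)
    (X : Matrix (Fin n) (Fin n) ℂ) : Prop :=
  ∀ ε : ℝ, 0 < ε → ∃ δ : ℝ, 0 < δ ∧
    ∀ T' : Realization m₁ m₂ n, T' ∈ classG m₁ m₂ n → T.distance T' < δ →
      (∃! X' : Matrix (Fin n) (Fin n) ℂ, T'.IsSpectralSolution X') ∧
      (∀ X' : Matrix (Fin n) (Fin n) ℂ, T'.IsSpectralSolution X' →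
        ‖X - X'‖ < ε ∧ T'.RecAdmissible X' ∧ ∀ k, ‖T.recC X k - T'.recC X' k‖ < ε) ∧
      (∀ X' : Matrix (Fin n) (Fin n) ℂ, X'.IsHermitian → T'.Riccati X' → ‖X - X'‖ < δ →
        T'.RecAdmissible X' ∧ ∀ k, ‖T.recC X k - T'.recC X' k‖ < ε)

end Realization

end DiscreteDirac

end

/-!
The difference of two solutions of the Riccati equation intertwines the closed loop matrices `A`
and `A*`; when both spectra lie in the closed upper half-plane, only real eigenvalues can
contribute, and controllability excludes these, so `X` is unique. Existence follows by continuation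
along `(𝒜, ℬ, τ𝒞)`, `0 ≤ τ ≤ 1`: while `τ < 1` the closed loop spectrum avoids the real axis, so
that the linearized equation is an invertible Lyapunov equation, and solutions remain bounded up
to `τ = 1`. The same compactness makes `X` depend continuously on the triple.

The recursion for `Π_k`, `S_k` is a Bäcklund–Darboux transformation: the transfer functions of the
`S`-nodes `{A, S_k, Π_k}` intertwine the system with the one with potential `I`, and the Weyl
series telescopes. A potential is determined by its Weyl function because `C_0 Φ = -j Φ` at `z = -i`
for the initial values `Φ` of the Weyl solution; dividing the solution by its zero at `-i` passes
to the potential shifted by one.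

The compressions of the positive matrices `Π_k* S_k⁻¹ Π_k` to each eigenspace of `j` decrease in
`k`; `R_k → +∞` forces those to the eigenspace of `1`, and `Q_k → +∞` those to the eigenspace of
`-1`, to tend to `0`. A single index `N` therefore controls `C_k - I` for all `k ≥ N`, also for
nearby triples, and the finitely many remaining `C_k` depend continuously on the triple.
-/

namespace DiscreteDirac

/-! ### Spectra, positivity and the Lyapunov operator -/

section Spectrum

variable {ι : Type*} [Fintype ι] [DecidableEq ι]

lemma mem_spectrum_iff_exists_mulVec {K : Type*} [Field K] {M : Matrix ι ι K} {μ : K} :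
    μ ∈ spectrum K M ↔ ∃ x : ι → K, x ≠ 0 ∧ M *ᵥ x = μ • x := by
  rw [← spectrum_toLin', ← Module.End.hasEigenvalue_iff_mem_spectrum]
  refine ⟨fun h => ?_, fun ⟨x, hx, h⟩ =>
    Module.End.hasEigenvalue_of_hasEigenvector ⟨Module.End.mem_eigenspace_iff.2 h, hx⟩⟩
  obtain ⟨x, hx⟩ := h.exists_hasEigenvector
  exact ⟨x, hx.2, hx.apply_eq_smul⟩

lemma mem_spectrum_iff_det_eq_zero {K : Type*} [Field K] {M : Matrix ι ι K} {μ : K} :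
    μ ∈ spectrum K M ↔ (μ • (1 : Matrix ι ι K) - M).det = 0 := by
  rw [spectrum.mem_iff, isUnit_iff_isUnit_det, isUnit_iff_ne_zero, not_not,
    Algebra.algebraMap_eq_smul_one]

lemma isUnit_det_of_notMem_spectrum {K : Type*} [Field K] {M : Matrix ι ι K} {μ : K}
    (h : μ ∉ spectrum K M) : IsUnit (μ • (1 : Matrix ι ι K) - M).det :=
  isUnit_iff_ne_zero.2 (mt mem_spectrum_iff_det_eq_zero.2 h)

lemma mem_spectrum_conjTranspose {M : Matrix ι ι ℂ} {μ : ℂ} :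
    μ ∈ spectrum ℂ Mᴴ ↔ star μ ∈ spectrum ℂ M := by
  rw [← star_eq_conjTranspose, spectrum.map_star, Set.mem_star]

lemma tendsto_pow_of_spectralRadius_lt_one {A : Type*} [NormedRing A] [NormedAlgebra ℂ A]
    [CompleteSpace A] {a : A} (ha : spectralRadius ℂ a < 1) :
    Tendsto (fun k : ℕ => a ^ k) atTop (𝓝 0) := by
  obtain ⟨r, har, hr⟩ := ENNReal.lt_iff_exists_nnreal_btwn.1 ha
  have hroot := (spectrum.pow_nnnorm_pow_one_div_tendsto_nhds_spectralRadius a).eventually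
    (gt_mem_nhds har)
  refine squeeze_zero_norm' ?_ (tendsto_pow_atTop_nhds_zero_of_lt_one r.2 (by exact_mod_cast hr))
  filter_upwards [hroot, eventually_gt_atTop 0] with k hk hk₀
  rw [one_div, ENNReal.rpow_inv_lt_iff (by exact_mod_cast hk₀), ENNReal.rpow_natCast] at hk
  exact_mod_cast hk.le

lemma tendsto_pow_of_forall_norm_lt_one {M : Matrix ι ι ℂ}
    (hM : ∀ μ ∈ spectrum ℂ M, ‖μ‖ < 1) : Tendsto (fun k : ℕ => M ^ k) atTop (𝓝 0) := by
  refine tendsto_pow_of_spectralRadius_lt_one ?_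
  rcases (spectrum ℂ M).eq_empty_or_nonempty with h | h
  · simp [spectralRadius, h]
  · exact spectrum.spectralRadius_lt_of_forall_lt_of_nonempty h hM

lemma isOpen_setOf_spectrum_subset {U : Set ℂ} (hU : IsOpen U) :
    IsOpen {M : Matrix ι ι ℂ | spectrum ℂ M ⊆ U} :=
  isOpen_iff_eventually.2 fun M hM => upperHemicontinuous_iff_forall_isOpen.1
    (upperHemicontinuous_spectrum ℂ (Matrix ι ι ℂ)) M U hU hM

lemma pow_card_le_norm_det {M : Matrix ι ι ℂ} {r : ℝ} (hr : 0 ≤ r)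
    (hM : ∀ μ ∈ spectrum ℂ M, r ≤ ‖μ‖) : r ^ Fintype.card ι ≤ ‖M.det‖ := by
  have hcard : M.charpoly.roots.card = Fintype.card ι := by
    rw [← (IsAlgClosed.splits M.charpoly).natDegree_eq_card_roots, charpoly_natDegree_eq_dim]
  have hroots : ∀ μ ∈ M.charpoly.roots, r ≤ ‖μ‖ := fun μ hμ =>
    hM μ (mem_spectrum_iff_isRoot_charpoly.2 (Polynomial.isRoot_of_mem_roots hμ))
  rw [det_eq_prod_roots_charpoly, ← hcard]
  generalize M.charpoly.roots = s at hroots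
  induction s using Multiset.induction_on with
  | empty => simp
  | cons μ s ih =>
    simp only [Multiset.forall_mem_cons] at hroots
    simp only [Multiset.card_cons, Multiset.prod_cons, norm_mul, pow_succ']
    exact mul_le_mul hroots.1 (ih hroots.2) (by positivity) (norm_nonneg _)

lemma isClosed_setOf_spectrum_subset {F : Set ℂ} (hF : IsClosed F) :
    IsClosed {M : Matrix ι ι ℂ | spectrum ℂ M ⊆ F} := by
  refine isClosed_of_closure_subset fun M hM z hz => by_contra fun hzF => ?_
  -- Around `z ∉ F` the modulus of `det (z - N)` is bounded below, uniformly over all `N` with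
  -- spectrum in `F`, so no limit of such matrices has the eigenvalue `z`.
  obtain ⟨r, hr, hball⟩ := Metric.isOpen_iff.1 hF.isOpen_compl z hzF
  have hclosed : IsClosed {N : Matrix ι ι ℂ |
      r ^ Fintype.card ι ≤ ‖(z • (1 : Matrix ι ι ℂ) - N).det‖} :=
    isClosed_le (by fun_prop) (by fun_prop)
  have hdet : r ^ Fintype.card ι ≤ ‖(z • (1 : Matrix ι ι ℂ) - M).det‖ := by
    refine closure_minimal (fun N (hN : spectrum ℂ N ⊆ F) => ?_) hclosed hM
    refine pow_card_le_norm_det hr.le fun μ hμ => not_lt.1 fun hlt => ?_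
    have hμN : z - μ ∈ spectrum ℂ N := by
      rw [← Algebra.algebraMap_eq_smul_one, ← spectrum.singleton_sub_eq, Set.singleton_sub] at hμ
      obtain ⟨w, hw, rfl⟩ := hμ
      simpa using hw
    exact hball (by simpa using hlt : z - μ ∈ Metric.ball z r) (hN hμN)
  rw [mem_spectrum_iff_det_eq_zero.1 hz, norm_zero] at hdet
  exact absurd hdet (not_le.2 (pow_pos hr _))

end Spectrum

section Positivity

variable {ι : Type*}

lemma eq_zero_of_posSemidef_neg {H : Matrix ι ι ℂ} (h : H.PosSemidef) (hneg : (-H).PosSemidef) :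
    H = 0 := by
  open scoped MatrixOrder in
  exact le_antisymm (by rwa [Matrix.le_iff, zero_sub]) h.nonneg

lemma isClosed_setOf_posSemidef [Finite ι] : IsClosed {M : Matrix ι ι ℂ | M.PosSemidef} := by
  have := Fintype.ofFinite ι
  have hsetOf : {M : Matrix ι ι ℂ | M.PosSemidef} =
      {M | Mᴴ = M} ∩ ⋂ x : ι → ℂ, {M | 0 ≤ star x ⬝ᵥ (M *ᵥ x)} := by
    ext M
    simp [posSemidef_iff_dotProduct_mulVec, IsHermitian]
  rw [hsetOf]
  exact (isClosed_eq (by fun_prop) (by fun_prop)).inter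
    (isClosed_iInter fun x => isClosed_le (by fun_prop) (by fun_prop))

variable [Fintype ι] [DecidableEq ι]

lemma posSemidef_of_sub_conj {H K : Matrix ι ι ℂ} (hH : (H - Kᴴ * H * K).PosSemidef)
    (hK : Tendsto (fun k : ℕ => K ^ k) atTop (𝓝 0)) : H.PosSemidef := by
  have hiter : ∀ k : ℕ, (H - (K ^ k)ᴴ * H * K ^ k).PosSemidef := by
    intro k
    induction k with
    | zero => simpa using PosSemidef.zero
    | succ k ih =>
      convert hH.add (ih.conjTranspose_mul_mul_same K) using 1
      rw [pow_succ, conjTranspose_mul]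
      noncomm_ring
  have hlim : Tendsto (fun k : ℕ => H - (K ^ k)ᴴ * H * K ^ k) atTop
      (𝓝 (H - (0 : Matrix ι ι ℂ)ᴴ * H * 0)) :=
    ((by fun_prop : Continuous fun L : Matrix ι ι ℂ => H - Lᴴ * H * L).tendsto 0).comp hK
  simpa using isClosed_setOf_posSemidef.mem_of_tendsto hlim (Eventually.of_forall hiter)

/-- The Lyapunov operator `H ↦ i (M* H - H M)`. It maps Hermitian matrices to Hermitian matrices,
and `T.Riccati X` says that `lyapunov T.a X = X ℬ ℬ* X + 𝒞* 𝒞`. -/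
noncomputable def lyapunov (M : Matrix ι ι ℂ) : Matrix ι ι ℂ →ₗ[ℂ] Matrix ι ι ℂ :=
  Complex.I • (LinearMap.mulLeft ℂ Mᴴ - LinearMap.mulRight ℂ M)

lemma lyapunov_apply (M H : Matrix ι ι ℂ) : lyapunov M H = Complex.I • (Mᴴ * H - H * M) := rfl

lemma lyapunov_conjTranspose (M H : Matrix ι ι ℂ) : lyapunov M Hᴴ = (lyapunov M H)ᴴ := by
  simp only [lyapunov_apply, conjTranspose_smul, conjTranspose_sub, conjTranspose_mul,
    conjTranspose_conjTranspose, RCLike.star_def, Complex.conj_I]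
  module

/-- The Cayley transform `2 (1 - i M)⁻¹ - 1 = (1 + i M) (1 - i M)⁻¹`, which takes the open upper
half-plane to the open unit disc. -/
noncomputable def cayley (M : Matrix ι ι ℂ) : Matrix ι ι ℂ := (2 : ℂ) • (1 - Complex.I • M)⁻¹ - 1

lemma isUnit_det_one_sub_I_smul {M : Matrix ι ι ℂ} (hM : -Complex.I ∉ spectrum ℂ M) :
    IsUnit (1 - Complex.I • M).det := by
  have hfactor : 1 - Complex.I • M = Complex.I • (-Complex.I • (1 : Matrix ι ι ℂ) - M) := by
    simp [smul_sub, smul_smul]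
  rw [hfactor, det_smul]
  exact (isUnit_iff_ne_zero.2 (pow_ne_zero _ Complex.I_ne_zero)).mul
    (isUnit_det_of_notMem_spectrum hM)

lemma sub_conj_cayley {M : Matrix ι ι ℂ} (hM : -Complex.I ∉ spectrum ℂ M) (H : Matrix ι ι ℂ) :
    H - (cayley M)ᴴ * H * cayley M =
      ((1 - Complex.I • M)⁻¹)ᴴ * ((2 : ℂ) • lyapunov M H) * (1 - Complex.I • M)⁻¹ := by
  have hinv := mul_nonsing_inv _ (isUnit_det_one_sub_I_smul hM)
  have hinv' := congrArg conjTranspose hinv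
  rw [conjTranspose_mul, conjTranspose_one] at hinv'
  rw [cayley]
  set N := (1 - Complex.I • M)⁻¹
  have hlyap : (2 : ℂ) • lyapunov M H = (2 : ℂ) • ((1 - Complex.I • M)ᴴ * H) +
      (2 : ℂ) • (H * (1 - Complex.I • M)) - (4 : ℂ) • H := by
    simp only [lyapunov_apply, conjTranspose_sub, conjTranspose_one, conjTranspose_smul,
      RCLike.star_def, Complex.conj_I, sub_mul, mul_sub, one_mul, mul_one, smul_mul,
      Matrix.mul_smul]
    module
  calc H - ((2 : ℂ) • N - 1)ᴴ * H * ((2 : ℂ) • N - 1)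
      = (2 : ℂ) • (1 * H * N) + (2 : ℂ) • (Nᴴ * H * 1) - (4 : ℂ) • (Nᴴ * H * N) := by
        simp only [conjTranspose_sub, conjTranspose_smul, conjTranspose_one, sub_mul, mul_sub,
          smul_mul, Matrix.mul_smul, one_mul, mul_one, star_ofNat]
        module
    _ = Nᴴ * ((2 : ℂ) • lyapunov M H) * N := by
        rw [← hinv, hlyap]
        nth_rewrite 1 [hinv, ← hinv']
        simp only [sub_mul, mul_sub, add_mul, mul_add, smul_mul, Matrix.mul_smul, Matrix.mul_assoc]

lemma norm_lt_one_of_mem_spectrum_cayley {M : Matrix ι ι ℂ} (hM : ∀ μ ∈ spectrum ℂ M, 0 < μ.im)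
    {μ : ℂ} (hμ : μ ∈ spectrum ℂ (cayley M)) : ‖μ‖ < 1 := by
  have hunit := isUnit_det_one_sub_I_smul fun h => absurd (hM _ h) (by simp)
  obtain ⟨x, hx, hKx⟩ := mem_spectrum_iff_exists_mulVec.1 hμ
  have hNx : (2 : ℂ) • (1 - Complex.I • M)⁻¹ *ᵥ x = (1 + μ) • x := by
    rw [cayley, sub_mulVec, smul_mulVec, one_mulVec] at hKx
    linear_combination (norm := module) hKx
  have hx2 : (2 : ℂ) • x = (1 + μ) • (x - Complex.I • M *ᵥ x) := by
    have := congrArg ((1 - Complex.I • M) *ᵥ ·) hNx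
    simpa only [mulVec_smul, mulVec_mulVec, mul_nonsing_inv _ hunit, one_mulVec, sub_mulVec,
      smul_mulVec] using this
  have hne : 1 + μ ≠ 0 := fun h => hx <| by simpa [h] using hx2
  have hMx : M *ᵥ x = (Complex.I * (2 / (1 + μ) - 1)) • x := by
    have hdiv := congrArg ((Complex.I / (1 + μ)) • ·) hx2
    simp only [smul_smul, smul_sub, ← mul_assoc, div_mul_cancel₀ _ hne, Complex.I_mul_I, neg_smul,
      one_smul, sub_neg_eq_add] at hdiv
    linear_combination (norm := module) -hdiv
  have him := hM _ (mem_spectrum_iff_exists_mulVec.2 ⟨x, hx, hMx⟩)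
  have hsq : 0 < Complex.normSq (1 + μ) := Complex.normSq_pos.2 hne
  have hre : Complex.normSq (1 + μ) < 2 * (1 + μ).re := by
    simp only [Complex.I_mul_im, Complex.sub_re, Complex.div_re, Complex.one_re] at him
    norm_num at him
    field_simp at him
    simpa using him
  rw [← sq_lt_one_iff₀ (norm_nonneg _), ← Complex.normSq_eq_norm_sq]
  simp only [Complex.normSq_apply, Complex.add_re, Complex.one_re, Complex.add_im, Complex.one_im]
    at hre ⊢
  linarith

lemma posSemidef_of_posSemidef_lyapunov {M H : Matrix ι ι ℂ} (hM : ∀ μ ∈ spectrum ℂ M, 0 < μ.im)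
    (hH : (lyapunov M H).PosSemidef) : H.PosSemidef := by
  refine posSemidef_of_sub_conj (K := cayley M) ?_
    (tendsto_pow_of_forall_norm_lt_one fun μ => norm_lt_one_of_mem_spectrum_cayley hM)
  rw [sub_conj_cayley fun h => absurd (hM _ h) (by simp)]
  exact (hH.smul zero_le_two).conjTranspose_mul_mul_same _

lemma lyapunov_injective {M : Matrix ι ι ℂ} (hM : ∀ μ ∈ spectrum ℂ M, 0 < μ.im) :
    Function.Injective (lyapunov M) := by
  refine (injective_iff_map_eq_zero _).2 fun H hH => eq_zero_of_posSemidef_neg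
    (posSemidef_of_posSemidef_lyapunov hM ?_) (posSemidef_of_posSemidef_lyapunov hM ?_)
  · rw [hH]; exact .zero
  · rw [map_neg, hH, neg_zero]; exact .zero

lemma mulVec_mulVec_eq_zero_of_posSemidef_lyapunov {M X : Matrix ι ι ℂ} (hX : X.IsHermitian)
    (hL : (lyapunov M X).PosSemidef) {x : ι → ℂ} (hx : X *ᵥ x = 0) :
    lyapunov M X *ᵥ x = 0 ∧ X *ᵥ (M *ᵥ x) = 0 := by
  have hLx : lyapunov M X *ᵥ x = -(Complex.I • X *ᵥ (M *ᵥ x)) := by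
    simp [lyapunov_apply, smul_mulVec, sub_mulVec, ← mulVec_mulVec, hx]
  have hstar : star x ᵥ* X = 0 := by rw [← hX.eq, ← star_mulVec, hx, star_zero]
  have hzero : lyapunov M X *ᵥ x = 0 := by
    rw [← hL.dotProduct_mulVec_zero_iff, hLx, dotProduct_neg, dotProduct_smul, dotProduct_mulVec,
      hstar, zero_dotProduct, smul_zero, neg_zero]
  refine ⟨hzero, ?_⟩
  rw [hzero, eq_comm, neg_eq_zero, smul_eq_zero] at hLx
  exact hLx.resolve_left Complex.I_ne_zero

lemma continuousAt_inv_of_isUnit_det {M : Matrix ι ι ℂ} (hM : IsUnit M.det) :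
    ContinuousAt (fun N : Matrix ι ι ℂ => N⁻¹) M := by
  simp only [nonsing_inv_eq_ringInverse]
  exact NormedRing.inverse_continuousAt ((isUnit_iff_isUnit_det M).2 hM).unit

lemma differentiableAt_inv_of_isUnit_det {M : Matrix ι ι ℂ} (hM : IsUnit M.det) :
    DifferentiableAt ℂ (fun N : Matrix ι ι ℂ => N⁻¹) M := by
  simp only [nonsing_inv_eq_ringInverse]
  exact differentiableAt_inverse ((isUnit_iff_isUnit_det M).2 hM)

end Positivity

lemma differentiable_mul_mul {ι κ μ ν : Type*} [Finite ι] [Fintype κ] [Fintype μ] [Finite ν]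
    (A : Matrix ι κ ℂ) (B : Matrix μ ν ℂ) : Differentiable ℂ fun X : Matrix κ μ ℂ => A * X * B :=
  (LinearMap.toContinuousLinearMap
    (mulRightLinearMap ι ℂ B ∘ₗ mulLeftLinearMap μ ℂ A)).differentiable

lemma semiconjBy_aeval {R A : Type*} [CommSemiring R] [Semiring A] [Algebra R A] {d a b : A}
    (h : SemiconjBy d a b) (p : Polynomial R) :
    SemiconjBy d (Polynomial.aeval a p) (Polynomial.aeval b p) := by
  induction p using Polynomial.induction_on' with
  | add p q hp hq => simpa only [map_add] using hp.add_right hq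
  | monomial k r =>
    simp only [Polynomial.aeval_monomial]
    exact SemiconjBy.mul_right (Algebra.commutes r d).symm (h.pow_right k)

section Intertwining

variable {K : Type*} [Field K] [IsAlgClosed K]

lemma exists_mem_eigenvector {V : Type*} [AddCommGroup V] [Module K V] [FiniteDimensional K V]
    {f : Module.End K V} {p : Submodule K V} (hp : p ∈ f.invtSubmodule) (hne : p ≠ ⊥) :
    ∃ μ : K, ∃ x ∈ p, x ≠ 0 ∧ f x = μ • x := by
  have : Nontrivial p := Submodule.nontrivial_iff_ne_bot.2 hne
  obtain ⟨μ, hμ⟩ := Module.End.exists_eigenvalue (f.restrict hp)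
  obtain ⟨x, hx⟩ := hμ.exists_hasEigenvector
  exact ⟨μ, x, x.2, by simpa using hx.2, congrArg Subtype.val hx.apply_eq_smul⟩

lemma exists_common_eigenvalue_of_semiconjBy {ι : Type*} [Fintype ι] [DecidableEq ι]
    {D M N : Matrix ι ι K} (h : SemiconjBy D M N) (hD : D ≠ 0) :
    ∃ μ ∈ spectrum K M, ∃ x ∈ LinearMap.range D.mulVecLin, x ≠ 0 ∧ N *ᵥ x = μ • x := by
  have hinvt : LinearMap.range D.mulVecLin ∈ Module.End.invtSubmodule N.mulVecLin := by
    rw [Module.End.mem_invtSubmodule_iff_forall_mem_of_mem]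
    rintro _ ⟨w, rfl⟩
    exact ⟨M *ᵥ w, by simp only [mulVecLin_apply, mulVec_mulVec, h.eq]⟩
  obtain ⟨μ, _, ⟨w, rfl⟩, hw, hμ⟩ := exists_mem_eigenvector hinvt
    (by rwa [Ne, LinearMap.range_eq_bot, ← toLin'_apply', LinearEquiv.map_eq_zero_iff])
  refine ⟨μ, ?_, _, ⟨w, rfl⟩, hw, hμ⟩
  have haeval : (Polynomial.aeval N M.charpoly) *ᵥ (D *ᵥ w) = 0 := by
    rw [mulVec_mulVec, ← (semiconjBy_aeval h M.charpoly).eq, aeval_self_charpoly, mul_zero,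
      zero_mulVec]
  have heigen : Module.End.HasEigenvector (toLinAlgEquiv' N) μ (D *ᵥ w) :=
    ⟨Module.End.mem_eigenspace_iff.2 hμ, hw⟩
  have hroot := Module.End.aeval_apply_of_hasEigenvector (p := M.charpoly) heigen
  rw [Polynomial.aeval_algHom_apply, toLinAlgEquiv'_apply, haeval, eq_comm, smul_eq_zero] at hroot
  exact mem_spectrum_iff_isRoot_charpoly.2 (hroot.resolve_right hw)

end Intertwining

/-! ### Minimal contractive realizations -/

section Controllability

variable {ι κ : Type*} [Fintype ι] [Fintype κ]

/-- Controllability of the pair `(A, B)`: only the whole space is `A`-invariant and contains the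
columns of `B`. Observability of `(C, A)` is expressed as controllability of `(A*, C*)`. -/
def IsControllable (A : Matrix ι ι ℂ) (B : Matrix ι κ ℂ) : Prop :=
  ∀ V ∈ Module.End.invtSubmodule A.mulVecLin, LinearMap.range B.mulVecLin ≤ V → V = ⊤

lemma IsControllable.eq_zero_of_conjTranspose_mulVec {A : Matrix ι ι ℂ} {B : Matrix ι κ ℂ}
    (h : IsControllable A B) {μ : ℂ} {x : ι → ℂ} (hA : Aᴴ *ᵥ x = μ • x) (hB : Bᴴ *ᵥ x = 0) :
    x = 0 := by
  have hperp : LinearMap.ker (dotProductBilin ℂ ℂ (star x)) = ⊤ := by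
    refine h _ ?_ ?_
    · rw [Module.End.mem_invtSubmodule_iff_forall_mem_of_mem]
      intro y (hy : star x ⬝ᵥ y = 0)
      change star x ⬝ᵥ A *ᵥ y = 0
      rw [dotProduct_mulVec, ← conjTranspose_conjTranspose A, ← star_mulVec, hA, star_smul,
        smul_dotProduct, hy, smul_zero]
    · rintro _ ⟨u, rfl⟩
      change star x ⬝ᵥ B *ᵥ u = 0
      rw [dotProduct_mulVec, ← conjTranspose_conjTranspose B, ← star_mulVec, hB, star_zero,
        zero_dotProduct]
  have hx : x ∈ LinearMap.ker (dotProductBilin ℂ ℂ (star x)) := hperp ▸ Submodule.mem_top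
  exact dotProduct_star_self_eq_zero.1 hx

variable [DecidableEq ι]

lemma eventually_notMem_spectrum (A : Matrix ι ι ℂ) (w : ℂ) :
    ∀ᶠ z in 𝓝[≠] w, z ∉ spectrum ℂ A :=
  nhdsNE_le_cofinite w (finite_spectrum A).compl_mem_cofinite

lemma resolvent_mul {A : Matrix ι ι ℂ} {z : ℂ} (hz : z ∉ spectrum ℂ A) :
    (z • (1 : Matrix ι ι ℂ) - A)⁻¹ * A = z • (z • (1 : Matrix ι ι ℂ) - A)⁻¹ - 1 := by
  have hinv := nonsing_inv_mul _ (isUnit_det_of_notMem_spectrum hz)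
  rw [Matrix.mul_sub, Matrix.mul_smul, Matrix.mul_one] at hinv
  exact (sub_eq_iff_eq_add.1 hinv).symm ▸ (add_sub_cancel_left _ _).symm

lemma isBigO_mulVec {α ρ : Type*} [Fintype ρ] [DecidableEq κ] {l : Filter α}
    {F : α → Matrix ρ κ ℂ} (hF : F =O[l] fun _ => (1 : ℝ)) (u : κ → ℂ) :
    (fun z => F z *ᵥ u) =O[l] fun _ => (1 : ℝ) :=
  ((LinearMap.toContinuousLinearMap ((mulVecBilin ℂ ℂ).flip u)).isBigO_comp F l).trans hF

lemma IsControllable.isBigO_mulVec {ρ : Type*} [Fintype ρ] [DecidableEq κ]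
    {A : Matrix ι ι ℂ} {B : Matrix ι κ ℂ} (h : IsControllable A B) {C : Matrix ρ ι ℂ} {μ : ℂ}
    {l : Filter ℂ} (hl : l ≤ 𝓝[≠] μ)
    (hO : (fun z : ℂ => C * (z • (1 : Matrix ι ι ℂ) - A)⁻¹ * B) =O[l] fun _ => (1 : ℝ))
    (x : ι → ℂ) :
    (fun z : ℂ => (C * (z • (1 : Matrix ι ι ℂ) - A)⁻¹) *ᵥ x) =O[l] fun _ => (1 : ℝ) := by
  let G : ℂ → Matrix ρ ι ℂ := fun z => C * (z • (1 : Matrix ι ι ℂ) - A)⁻¹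
  let V : Submodule ℂ (ι → ℂ) :=
    { carrier := {x | (fun z => G z *ᵥ x) =O[l] fun _ => (1 : ℝ)}
      add_mem' := fun hx hy => by simpa [mulVec_add] using Asymptotics.IsBigO.add hx hy
      zero_mem' := by
        simpa using Asymptotics.isBigO_zero (E' := ρ → ℂ) (fun _ : ℂ => (1 : ℝ)) l
      smul_mem' := fun r x hx => by
        simpa [mulVec_smul] using Asymptotics.IsBigO.const_smul_left hx r }
  have hid : (fun z : ℂ => z) =O[l] fun _ => (1 : ℝ) :=
    (tendsto_id.mono_left (hl.trans nhdsWithin_le_nhds)).isBigO_one ℝ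
  have hV : V = ⊤ := by
    refine h V ?_ ?_
    · rw [Module.End.mem_invtSubmodule_iff_forall_mem_of_mem]
      intro x (hx : (fun z => G z *ᵥ x) =O[l] fun _ => (1 : ℝ))
      have hzG : (fun z => z • G z *ᵥ x - C *ᵥ x) =O[l] fun _ => (1 : ℝ) := by
        have hsmul : (fun z => z • G z *ᵥ x) =O[l] fun _ => (1 : ℝ) := by simpa using hid.smul hx
        exact hsmul.sub (Asymptotics.isBigO_const_const _ one_ne_zero l)
      refine hzG.congr' ?_ EventuallyEq.rfl
      filter_upwards [hl (eventually_notMem_spectrum A μ)] with z hz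
      simp only [G, mulVecLin_apply, mulVec_mulVec, Matrix.mul_assoc, resolvent_mul hz]
      simp only [Matrix.mul_sub, Matrix.mul_smul, Matrix.mul_one, sub_mulVec, smul_mulVec]
    · rintro _ ⟨u, rfl⟩
      change (fun z => G z *ᵥ (B *ᵥ u)) =O[l] fun _ => (1 : ℝ)
      simpa only [mulVec_mulVec] using DiscreteDirac.isBigO_mulVec hO u
  exact (hV ▸ Submodule.mem_top : x ∈ V)

lemma IsControllable.notMem_spectrum_of_isBigO {ρ : Type*} [Fintype ρ] [DecidableEq κ]
    {A : Matrix ι ι ℂ} {B : Matrix ι κ ℂ} {C : Matrix ρ ι ℂ} (hB : IsControllable A B)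
    (hC : IsControllable Aᴴ Cᴴ) {μ : ℂ} {l : Filter ℂ} [l.NeBot] (hl : l ≤ 𝓝[≠] μ)
    (hO : (fun z : ℂ => C * (z • (1 : Matrix ι ι ℂ) - A)⁻¹ * B) =O[l] fun _ => (1 : ℝ)) :
    μ ∉ spectrum ℂ A := by
  intro hμ
  obtain ⟨x, hx, hAx⟩ := mem_spectrum_iff_exists_mulVec.1 hμ
  refine hx (hC.eq_zero_of_conjTranspose_mulVec (by rwa [conjTranspose_conjTranspose]) ?_)
  rw [conjTranspose_conjTranspose]
  -- `C (z - A)⁻¹ x = (z - μ)⁻¹ C x` stays bounded as well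
  have hCx : (fun _ : ℂ => C *ᵥ x) =O[l] fun z : ℂ => z - μ := by
    have hsmul := (Asymptotics.isBigO_refl (fun z : ℂ => z - μ) l).norm_right.smul
      (hB.isBigO_mulVec hl hO x)
    simp only [smul_eq_mul, mul_one] at hsmul
    refine hsmul.of_norm_right.congr' ?_ EventuallyEq.rfl
    filter_upwards [hl (eventually_notMem_spectrum A μ)] with z hz
    have hx' : (z - μ) • x = (z • (1 : Matrix ι ι ℂ) - A) *ᵥ x := by
      rw [sub_mulVec, smul_mulVec, one_mulVec, hAx, sub_smul]
    rw [← mulVec_smul, hx', mulVec_mulVec, Matrix.mul_assoc,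
      nonsing_inv_mul _ (isUnit_det_of_notMem_spectrum hz), Matrix.mul_one]
  have hlim : Tendsto (fun z : ℂ => z - μ) l (𝓝 0) := by
    rw [← sub_self μ]
    exact (tendsto_id.sub_const μ).mono_left (hl.trans nhdsWithin_le_nhds)
  exact tendsto_nhds_unique tendsto_const_nhds (hCx.trans_tendsto hlim)

end Controllability

lemma norm_le_one_of_posSemidef_one_sub {ι κ : Type*} [Fintype ι] [Fintype κ] [DecidableEq κ]
    {M : Matrix ι κ ℂ} (h : (1 - Mᴴ * M).PosSemidef) : ‖M‖ ≤ 1 := by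
  have hsq : ‖Mᴴ * M‖ ≤ 1 := by
    open scoped MatrixOrder in
    rw [CStarAlgebra.norm_le_one_iff_of_nonneg _ (posSemidef_conjTranspose_mul_self M).nonneg]
    exact h
  rw [l2_opNorm_conjTranspose_mul_self] at hsq
  nlinarith [norm_nonneg M]

namespace Realization

variable {m₁ m₂ n : ℕ}

lemma sameFunction_of_intertwining {n' : ℕ} {T : Realization m₁ m₂ n} {T' : Realization m₁ m₂ n'}
    {E : Matrix (Fin n) (Fin n') ℂ} (ha : T.a * E = E * T'.a) (hb : T.b = E * T'.b)
    (hc : T'.c = T.c * E) : T.SameFunction T' := by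
  intro z hz hz'
  have hdet := isUnit_det_of_notMem_spectrum hz
  have hdet' := isUnit_det_of_notMem_spectrum hz'
  have hresolvent : (z • (1 : Matrix (Fin n) (Fin n) ℂ) - T.a)⁻¹ * E =
      E * (z • (1 : Matrix (Fin n') (Fin n') ℂ) - T'.a)⁻¹ := by
    have hE : (z • (1 : Matrix (Fin n) (Fin n) ℂ) - T.a) * E =
        E * (z • (1 : Matrix (Fin n') (Fin n') ℂ) - T'.a) := by
      rw [Matrix.sub_mul, Matrix.mul_sub, ha]; simp
    rw [← nonsing_inv_mul_cancel_left _ (E * _) hdet, ← Matrix.mul_assoc _ E, hE,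
      mul_nonsing_inv_cancel_right _ _ hdet']
  simp only [transfer, hc, hb, ← Matrix.mul_assoc]
  rw [Matrix.mul_assoc T.c _ E, hresolvent, ← Matrix.mul_assoc]

/-- The realization `{𝒜*, 𝒞*, ℬ*}` of `z ↦ ψ(z̄)*`. -/
def dual (T : Realization m₁ m₂ n) : Realization m₂ m₁ n := ⟨T.aᴴ, T.cᴴ, T.bᴴ⟩

lemma transfer_dual (T : Realization m₁ m₂ n) (z : ℂ) :
    T.dual.transfer z = (T.transfer (star z))ᴴ := by
  simp [transfer, dual, conjTranspose_nonsing_inv, Matrix.mul_assoc, conjTranspose_smul]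

lemma IsMinimal.dual {T : Realization m₁ m₂ n} (hT : T.IsMinimal) : T.dual.IsMinimal := by
  intro n' T' h
  refine hT n' T'.dual fun z hz hz' => ?_
  have hstar := h (star z) (fun hmem => hz ?_) (fun hmem => hz' (mem_spectrum_conjTranspose.2 hmem))
  · rw [transfer_dual, star_star] at hstar
    rw [transfer_dual, ← hstar, conjTranspose_conjTranspose]
  · simpa using mem_spectrum_conjTranspose.1 hmem

lemma IsMinimal.isControllable {T : Realization m₁ m₂ n} (hT : T.IsMinimal) :
    IsControllable T.a T.b := by
  intro V ha hb
  let e := Module.finBasis ℂ V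
  let E := LinearMap.toMatrix e (Pi.basisFun ℂ (Fin n)) V.subtype
  let a' := LinearMap.toMatrix e e (T.a.mulVecLin.restrict ha)
  let b' := LinearMap.toMatrix (Pi.basisFun ℂ (Fin m₂)) e
    (T.b.mulVecLin.codRestrict V fun u => hb ⟨u, rfl⟩)
  have ha_toMatrix : T.a =
      LinearMap.toMatrix (Pi.basisFun ℂ (Fin n)) (Pi.basisFun ℂ (Fin n)) T.a.mulVecLin :=
    (LinearMap.toMatrix'_toLin' T.a).symm
  have hb_toMatrix : T.b =
      LinearMap.toMatrix (Pi.basisFun ℂ (Fin m₂)) (Pi.basisFun ℂ (Fin n)) T.b.mulVecLin :=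
    (LinearMap.toMatrix'_toLin' T.b).symm
  have hle : n ≤ Module.finrank ℂ V := by
    refine hT _ ⟨a', b', T.c * E⟩ (sameFunction_of_intertwining (E := E) ?_ ?_ rfl)
    · rw [ha_toMatrix, ← LinearMap.toMatrix_comp, ← LinearMap.toMatrix_comp]
      rfl
    · rw [hb_toMatrix, ← LinearMap.toMatrix_comp]
      rfl
  refine Submodule.eq_top_of_finrank_eq (le_antisymm V.finrank_le ?_)
  rwa [Module.finrank_fin_fun]

lemma IsMinimal.isControllable_dual {T : Realization m₁ m₂ n} (hT : T.IsMinimal) :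
    IsControllable T.aᴴ T.cᴴ :=
  hT.dual.isControllable

lemma IsMinimal.eq_zero_of_mulVec {T : Realization m₁ m₂ n} (hT : T.IsMinimal) {μ : ℂ}
    {x : Fin n → ℂ} (ha : T.a *ᵥ x = μ • x) (hc : T.c *ᵥ x = 0) : x = 0 :=
  hT.isControllable_dual.eq_zero_of_conjTranspose_mulVec (by rwa [conjTranspose_conjTranspose])
    (by rwa [conjTranspose_conjTranspose])

lemma differentiableAt_transfer (T : Realization m₁ m₂ n) {w : ℂ} (hw : w ∉ spectrum ℂ T.a) :
    DifferentiableAt ℂ T.transfer w :=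
  (differentiable_mul_mul T.c T.b).differentiableAt.comp w <|
    DifferentiableAt.comp (f := fun z : ℂ => z • (1 : Matrix (Fin n) (Fin n) ℂ) - T.a) w
      (differentiableAt_inv_of_isUnit_det (isUnit_det_of_notMem_spectrum hw)) (by fun_prop)

lemma nhdsWithin_im_lt_neBot (w : ℂ) : (𝓝[{z : ℂ | z.im < w.im}] w).NeBot :=
  mem_closure_iff_nhdsWithin_neBot.1 <| by
    rw [Complex.closure_setOfPred_im_lt]
    exact le_refl w.im

lemma im_pos_of_mem_spectrum {T : Realization m₁ m₂ n} (hT : T ∈ classG m₁ m₂ n) {μ : ℂ}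
    (hμ : μ ∈ spectrum ℂ T.a) : 0 < μ.im := by
  by_contra! hle
  have := nhdsWithin_im_lt_neBot μ
  have hl : 𝓝[{z : ℂ | z.im < μ.im}] μ ≤ 𝓝[≠] μ :=
    nhdsWithin_mono _ fun z (hz : z.im < μ.im) => ne_of_apply_ne Complex.im hz.ne
  refine hT.1.isControllable.notMem_spectrum_of_isBigO hT.1.isControllable_dual hl ?_ hμ
  refine Asymptotics.IsBigO.of_bound 1 ?_
  filter_upwards [self_mem_nhdsWithin, hl (eventually_notMem_spectrum T.a μ)] with z hz hzs
  simpa [transfer] using norm_le_one_of_posSemidef_one_sub (hT.2 z (hz.trans_le hle) hzs)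

lemma notMem_spectrum_of_im_nonpos {T : Realization m₁ m₂ n} (hT : T ∈ classG m₁ m₂ n) {w : ℂ}
    (hw : w.im ≤ 0) : w ∉ spectrum ℂ T.a :=
  fun h => not_lt.2 hw (im_pos_of_mem_spectrum hT h)

lemma posSemidef_one_sub_transfer {T : Realization m₁ m₂ n} (hT : T ∈ classG m₁ m₂ n) {w : ℂ}
    (hw : w.im ≤ 0) : (1 - (T.transfer w)ᴴ * T.transfer w).PosSemidef := by
  have := nhdsWithin_im_lt_neBot w
  have hlim : Tendsto (fun z => 1 - (T.transfer z)ᴴ * T.transfer z) (𝓝[{z | z.im < w.im}] w)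
      (𝓝 (1 - (T.transfer w)ᴴ * T.transfer w)) :=
    ((by fun_prop : Continuous fun M : Matrix (Fin m₁) (Fin m₂) ℂ => 1 - Mᴴ * M).tendsto _).comp
      ((T.differentiableAt_transfer (notMem_spectrum_of_im_nonpos hT hw)).continuousAt.mono_left
        nhdsWithin_le_nhds)
  refine isClosed_setOf_posSemidef.mem_of_tendsto hlim ?_
  filter_upwards [self_mem_nhdsWithin] with z hz
  have hz' : z.im < 0 := hz.trans_le hw
  exact hT.2 z hz' (notMem_spectrum_of_im_nonpos hT hz'.le)

end Realization

/-! ### The Riccati equation -/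

section Lyapunov

variable {ι : Type*} [Fintype ι]

lemma star_dotProduct_lyapunov_mulVec [DecidableEq ι] {M H : Matrix ι ι ℂ} (hH : H.IsHermitian)
    (x : ι → ℂ) :
    star x ⬝ᵥ lyapunov M H *ᵥ x = -2 * ((star x ⬝ᵥ Mᴴ *ᵥ H *ᵥ x).im : ℂ) := by
  have hstar : star x ⬝ᵥ H *ᵥ M *ᵥ x = star (star x ⬝ᵥ Mᴴ *ᵥ H *ᵥ x) := by
    rw [star_dotProduct, star_mulVec, star_mulVec, hH.eq, ← dotProduct_mulVec,
      ← dotProduct_mulVec]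
  have hsub := Complex.sub_conj (star x ⬝ᵥ Mᴴ *ᵥ H *ᵥ x)
  rw [lyapunov_apply, smul_mulVec, sub_mulVec, dotProduct_smul, dotProduct_sub, ← mulVec_mulVec,
    ← mulVec_mulVec, hstar, RCLike.star_def, hsub, smul_eq_mul]
  push_cast
  linear_combination 2 * ((star x ⬝ᵥ Mᴴ *ᵥ H *ᵥ x).im : ℂ) * Complex.I_sq

lemma star_dotProduct_conjTranspose_mul_mulVec {κ : Type*} [Fintype κ] (M : Matrix κ ι ℂ)
    (x : ι → ℂ) : star x ⬝ᵥ (Mᴴ * M) *ᵥ x = star (M *ᵥ x) ⬝ᵥ M *ᵥ x := by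
  rw [← mulVec_mulVec, dotProduct_mulVec, star_mulVec]

end Lyapunov

namespace Realization

variable {m₁ m₂ n : ℕ} {T : Realization m₁ m₂ n} {X Y : Matrix (Fin n) (Fin n) ℂ}

lemma riccati_iff : T.Riccati X ↔ lyapunov T.a X = X * (T.b * T.bᴴ) * X + T.cᴴ * T.c := by
  rw [Riccati, sub_add_eq_add_sub, sub_eq_zero, eq_comm, lyapunov_apply, Matrix.mul_assoc X]

lemma lyapunov_recA (T : Realization m₁ m₂ n) (X H : Matrix (Fin n) (Fin n) ℂ) :
    lyapunov (T.recA X) H =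
      lyapunov T.a H - (Xᴴ * (T.b * T.bᴴ) * H + H * (T.b * T.bᴴ) * X) := by
  simp only [lyapunov_apply, recA, conjTranspose_sub, conjTranspose_smul, conjTranspose_mul,
    conjTranspose_conjTranspose, RCLike.star_def, Complex.conj_I, Matrix.sub_mul, Matrix.mul_sub,
    Matrix.smul_mul, Matrix.mul_smul, smul_sub, smul_smul, mul_neg, Complex.I_mul_I,
    Matrix.mul_assoc]
  module

lemma lyapunov_recA_self (hX : X.IsHermitian) (h : T.Riccati X) :
    lyapunov (T.recA X) X = T.cᴴ * T.c - X * (T.b * T.bᴴ) * X := by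
  rw [lyapunov_recA, riccati_iff.1 h, hX.eq]
  abel

lemma lyapunov_recA_sub (hX : X.IsHermitian) (hRX : T.Riccati X) (hRY : T.Riccati Y) :
    lyapunov (T.recA X) (Y - X) = (Y - X) * (T.b * T.bᴴ) * (Y - X) := by
  rw [lyapunov_recA, map_sub, riccati_iff.1 hRX, riccati_iff.1 hRY, hX.eq]
  noncomm_ring

lemma semiconjBy_recA (hX : X.IsHermitian) (hRX : T.Riccati X) (hRY : T.Riccati Y) :
    SemiconjBy (Y - X) (T.recA Y) (T.recA X)ᴴ := by
  have hloop : T.recA Y = T.recA X - Complex.I • (T.b * T.bᴴ * (Y - X)) := by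
    simp only [recA, Matrix.mul_sub, smul_sub]
    abel
  have hsub := congrArg (Complex.I • ·) (lyapunov_recA_sub hX hRX hRY)
  simp only [lyapunov_apply, smul_smul, Complex.I_mul_I, Matrix.mul_assoc] at hsub
  rw [SemiconjBy, hloop, Matrix.mul_sub, Matrix.mul_smul, Matrix.mul_assoc T.b, ← hsub]
  module

lemma star_dotProduct_mul_mul_mulVec {D : Matrix (Fin n) (Fin n) ℂ} (hD : D.IsHermitian)
    (x : Fin n → ℂ) :
    star x ⬝ᵥ (D * (T.b * T.bᴴ) * D) *ᵥ x =
      star (T.bᴴ *ᵥ (D *ᵥ x)) ⬝ᵥ T.bᴴ *ᵥ (D *ᵥ x) := by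
  have hsq : D * (T.b * T.bᴴ) * D = (T.bᴴ * D)ᴴ * (T.bᴴ * D) := by
    simp only [conjTranspose_mul, conjTranspose_conjTranspose, hD.eq, Matrix.mul_assoc]
  rw [hsq, star_dotProduct_conjTranspose_mul_mulVec, mulVec_mulVec]

/-- `X` is a Hermitian solution of the Riccati equation whose closed loop matrix `A` has its
spectrum in `H`. -/
structure IsHermitianSolution (T : Realization m₁ m₂ n) (H : Set ℂ)
    (X : Matrix (Fin n) (Fin n) ℂ) : Prop where
  isHermitian : X.IsHermitian
  riccati : T.Riccati X
  spectrum_subset : spectrum ℂ (T.recA X) ⊆ H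

lemma IsSpectralSolution.isHermitianSolution (h : T.IsSpectralSolution X) :
    T.IsHermitianSolution {z | 0 ≤ z.im} X :=
  ⟨h.posDef.1, h.riccati, h.spectrum_subset⟩

lemma IsHermitianSolution.eq (hT : IsControllable T.a T.b)
    (hX : T.IsHermitianSolution {z | 0 ≤ z.im} X) (hY : T.IsHermitianSolution {z | 0 ≤ z.im} Y) :
    X = Y := by
  by_contra hne
  have hD : (Y - X).IsHermitian := hY.isHermitian.sub hX.isHermitian
  -- a common eigenvalue of `recA Y` and `(recA X)*` is real
  obtain ⟨μ, hμ, _, ⟨w, rfl⟩, hv, hev⟩ := exists_common_eigenvalue_of_semiconjBy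
    (semiconjBy_recA hX.isHermitian hX.riccati hY.riccati) (sub_ne_zero.2 (Ne.symm hne))
  rw [mulVecLin_apply] at hv hev
  have hμ_im : μ.im = 0 := by
    have hstar : star μ ∈ spectrum ℂ (T.recA X) :=
      mem_spectrum_conjTranspose.1 (mem_spectrum_iff_exists_mulVec.2 ⟨_, hv, hev⟩)
    have hle : 0 ≤ (star μ).im := hX.spectrum_subset hstar
    rw [RCLike.star_def, Complex.conj_im] at hle
    exact le_antisymm (neg_nonneg.1 hle) (hY.spectrum_subset hμ)
  have hb : T.bᴴ *ᵥ (Y - X) *ᵥ w = 0 := by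
    rw [← dotProduct_star_self_eq_zero, ← star_dotProduct_mul_mul_mulVec hD,
      ← lyapunov_recA_sub hX.isHermitian hX.riccati hY.riccati,
      star_dotProduct_lyapunov_mulVec hD, hev, dotProduct_smul, smul_eq_mul, Complex.mul_im, hμ_im,
      show (star w ⬝ᵥ (Y - X) *ᵥ w).im = 0 from hD.im_star_dotProduct_mulVec_self w]
    simp
  refine hv (hT.eq_zero_of_conjTranspose_mulVec (μ := μ) ?_ hb)
  have hloop : (T.recA X)ᴴ = T.aᴴ + Complex.I • (X * T.b * T.bᴴ) := by
    simp [recA, conjTranspose_smul, hX.isHermitian.eq, Matrix.mul_assoc]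
  rw [← hev, hloop, add_mulVec, smul_mulVec, ← mulVec_mulVec _ (X * T.b), hb, mulVec_zero,
    smul_zero, add_zero]

lemma posSemidef_lyapunov_of_riccati (hX : X.IsHermitian) (h : T.Riccati X) :
    (lyapunov T.a X).PosSemidef := by
  have hsq : X * (T.b * T.bᴴ) * X = (T.bᴴ * X)ᴴ * (T.bᴴ * X) := by
    simp only [conjTranspose_mul, conjTranspose_conjTranspose, hX.eq, Matrix.mul_assoc]
  rw [riccati_iff.1 h, hsq]
  exact (posSemidef_conjTranspose_mul_self _).add (posSemidef_conjTranspose_mul_self _)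

lemma posDef_of_riccati (hT : T ∈ classG m₁ m₂ n) (hX : X.IsHermitian) (h : T.Riccati X) :
    X.PosDef := by
  have hlyap := posSemidef_lyapunov_of_riccati hX h
  have hpos := posSemidef_of_posSemidef_lyapunov (fun _ => im_pos_of_mem_spectrum hT) hlyap
  suffices hker : LinearMap.ker X.mulVecLin = ⊥ by
    rw [hpos.posDef_iff_isUnit, ← mulVec_injective_iff_isUnit]
    exact LinearMap.ker_eq_bot.1 hker
  -- the kernel of `X` is an unobservable subspace
  by_contra hker
  have hinvt : LinearMap.ker X.mulVecLin ∈ Module.End.invtSubmodule T.a.mulVecLin :=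
    fun x hx => (mulVec_mulVec_eq_zero_of_posSemidef_lyapunov hX hlyap hx).2
  obtain ⟨μ, x, hx, hx0, hax⟩ := exists_mem_eigenvector hinvt hker
  have hXx : X *ᵥ x = 0 := hx
  refine hx0 (hT.1.eq_zero_of_mulVec hax ?_)
  have hLx := (mulVec_mulVec_eq_zero_of_posSemidef_lyapunov hX hlyap hXx).1
  rw [riccati_iff.1 h, add_mulVec, ← mulVec_mulVec, hXx, mulVec_zero, zero_add] at hLx
  rw [← dotProduct_star_self_eq_zero,
    ← star_dotProduct_conjTranspose_mul_mulVec, hLx, dotProduct_zero]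

lemma notMem_spectrum_recA (hX : X.IsHermitian) (h : T.Riccati X) {ω : ℂ} (hω : ω.im = 0)
    (ha : ω ∉ spectrum ℂ T.a) (hψ : (1 - (T.transfer ω)ᴴ * T.transfer ω).PosDef) :
    ω ∉ spectrum ℂ (T.recA X) := by
  intro hmem
  obtain ⟨x, hx, hev⟩ := mem_spectrum_iff_exists_mulVec.1 hmem
  let u := T.bᴴ *ᵥ (X *ᵥ x)
  have hax : (ω • (1 : Matrix (Fin n) (Fin n) ℂ) - T.a) *ᵥ x = -Complex.I • (T.b *ᵥ u) := by
    rw [sub_mulVec, smul_mulVec, one_mulVec, ← hev, recA, sub_mulVec, smul_mulVec,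
      ← mulVec_mulVec, ← mulVec_mulVec]
    module
  have hcx : T.c *ᵥ x = -Complex.I • (T.transfer ω *ᵥ u) := by
    rw [transfer, ← mulVec_mulVec, ← mulVec_smul, ← hax, mulVec_mulVec, Matrix.mul_assoc,
      nonsing_inv_mul _ (isUnit_det_of_notMem_spectrum ha), Matrix.mul_one]
  -- the quadratic form of `lyapunov (recA X) X` vanishes at an eigenvector with a real eigenvalue
  have hform : star (T.c *ᵥ x) ⬝ᵥ T.c *ᵥ x - star u ⬝ᵥ u = 0 := by
    rw [← star_dotProduct_conjTranspose_mul_mulVec, ← star_dotProduct_mul_mul_mulVec hX,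
      ← dotProduct_sub, ← sub_mulVec, ← lyapunov_recA_self hX h,
      star_dotProduct_lyapunov_mulVec hX, dotProduct_mulVec, ← star_mulVec, hev, star_smul,
      smul_dotProduct, smul_eq_mul, Complex.mul_im, RCLike.star_def, Complex.conj_im, hω,
      show (star x ⬝ᵥ X *ᵥ x).im = 0 from hX.im_star_dotProduct_mulVec_self x]
    simp
  have hu : u = 0 := by
    by_contra hu
    refine (hψ.dotProduct_mulVec_pos hu).ne' ?_
    rw [sub_mulVec, dotProduct_sub, one_mulVec, star_dotProduct_conjTranspose_mul_mulVec]
    rw [hcx, star_smul, smul_dotProduct, dotProduct_smul, smul_smul] at hform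
    simp only [star_neg, RCLike.star_def, Complex.conj_I, neg_neg, mul_neg, Complex.I_mul_I,
      one_smul] at hform
    rw [← neg_sub, hform, neg_zero]
  rw [hu, mulVec_zero, smul_zero, sub_mulVec, smul_mulVec, one_mulVec, sub_eq_zero] at hax
  exact ha (mem_spectrum_iff_exists_mulVec.2 ⟨x, hx, hax.symm⟩)

/-- `distance` as a metric, which topologizes the set of realizations. -/
noncomputable instance : PseudoMetricSpace (Realization m₁ m₂ n) where
  dist := distance
  dist_self T := by simp [distance]
  dist_comm T U := by simp only [distance, norm_sub_rev]
  dist_triangle T U V := by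
    have ha := norm_sub_le_norm_sub_add_norm_sub T.a U.a V.a
    have hb := norm_sub_le_norm_sub_add_norm_sub T.b U.b V.b
    have hc := norm_sub_le_norm_sub_add_norm_sub T.c U.c V.c
    simp only [distance]
    linarith

lemma dist_eq (T U : Realization m₁ m₂ n) :
    dist T U = ‖T.a - U.a‖ + ‖T.b - U.b‖ + ‖T.c - U.c‖ := rfl

@[fun_prop]
lemma continuous_a : Continuous fun T : Realization m₁ m₂ n => T.a :=
  (LipschitzWith.mk_one fun T U => by
    rw [dist_eq, dist_eq_norm]
    linarith [norm_nonneg (T.b - U.b), norm_nonneg (T.c - U.c)]).continuous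

@[fun_prop]
lemma continuous_b : Continuous fun T : Realization m₁ m₂ n => T.b :=
  (LipschitzWith.mk_one fun T U => by
    rw [dist_eq, dist_eq_norm]
    linarith [norm_nonneg (T.a - U.a), norm_nonneg (T.c - U.c)]).continuous

@[fun_prop]
lemma continuous_c : Continuous fun T : Realization m₁ m₂ n => T.c :=
  (LipschitzWith.mk_one fun T U => by
    rw [dist_eq, dist_eq_norm]
    linarith [norm_nonneg (T.a - U.a), norm_nonneg (T.b - U.b)]).continuous

lemma continuous_recA :
    Continuous fun p : Realization m₁ m₂ n × Matrix (Fin n) (Fin n) ℂ => p.1.recA p.2 := by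
  unfold recA
  fun_prop

lemma isClosed_setOf_isHermitianSolution {H : Set ℂ} (hH : IsClosed H) :
    IsClosed {p : Realization m₁ m₂ n × Matrix (Fin n) (Fin n) ℂ |
      p.1.IsHermitianSolution H p.2} := by
  have hherm : IsClosed {p : Realization m₁ m₂ n × Matrix (Fin n) (Fin n) ℂ | p.2ᴴ = p.2} :=
    isClosed_eq (by fun_prop) (by fun_prop)
  have hriccati : IsClosed {p : Realization m₁ m₂ n × Matrix (Fin n) (Fin n) ℂ |
      p.1.Riccati p.2} := by
    unfold Riccati
    exact isClosed_eq (by fun_prop) continuous_const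
  have hspec := (isClosed_setOf_spectrum_subset hH).preimage
    (continuous_recA (m₁ := m₁) (m₂ := m₂) (n := n))
  convert hherm.inter (hriccati.inter hspec) using 1
  ext p
  exact ⟨fun h => ⟨h.1, h.2, h.3⟩, fun h => ⟨h.1, h.2.1, h.2.2⟩⟩

/-- The Riccati equation rescaled by `Y = s X`; at `s = 0` it describes the limits of
`‖X‖⁻¹ X` along unbounded sequences of solutions. -/
def RescaledRiccati (T : Realization m₁ m₂ n) (s : ℝ) (Y : Matrix (Fin n) (Fin n) ℂ) : Prop :=
  Yᴴ = Y ∧ (lyapunov T.a Y).PosSemidef ∧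
    Y * (T.b * T.bᴴ) * Y = s • lyapunov T.a Y - s ^ 2 • (T.cᴴ * T.c)

lemma isClosed_setOf_rescaledRiccati :
    IsClosed {p : (Realization m₁ m₂ n × ℝ) × Matrix (Fin n) (Fin n) ℂ |
      p.1.1.RescaledRiccati p.1.2 p.2} := by
  have hlyap : Continuous fun p : (Realization m₁ m₂ n × ℝ) × Matrix (Fin n) (Fin n) ℂ =>
      lyapunov p.1.1.a p.2 := by
    simp only [lyapunov_apply]
    fun_prop
  have hs : Continuous fun p : (Realization m₁ m₂ n × ℝ) × Matrix (Fin n) (Fin n) ℂ => p.1.2 := by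
    fun_prop
  have hrhs : Continuous fun p : (Realization m₁ m₂ n × ℝ) × Matrix (Fin n) (Fin n) ℂ =>
      p.1.2 • lyapunov p.1.1.a p.2 - p.1.2 ^ 2 • (p.1.1.cᴴ * p.1.1.c) :=
    (hs.smul hlyap).sub (by fun_prop)
  have hlhs : Continuous fun p : (Realization m₁ m₂ n × ℝ) × Matrix (Fin n) (Fin n) ℂ =>
      p.2 * (p.1.1.b * p.1.1.bᴴ) * p.2 := by fun_prop
  have hherm : IsClosed {p : (Realization m₁ m₂ n × ℝ) × Matrix (Fin n) (Fin n) ℂ |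
      p.2ᴴ = p.2} := isClosed_eq (by fun_prop) (by fun_prop)
  exact hherm.and ((isClosed_setOf_posSemidef.preimage hlyap).and (isClosed_eq hlhs hrhs))

lemma RescaledRiccati.eq_zero (hT : IsControllable T.a T.b) (h : T.RescaledRiccati 0 Y) :
    Y = 0 := by
  obtain ⟨hY, hlyap, hquad⟩ := h
  simp only [zero_smul, ne_eq, OfNat.ofNat_ne_zero, not_false_eq_true, zero_pow, sub_zero] at hquad
  have hYb : Y * T.b = 0 := by
    rw [← self_mul_conjTranspose_eq_zero, conjTranspose_mul, hY, ← hquad]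
    simp only [Matrix.mul_assoc]
  have hker : LinearMap.ker Y.mulVecLin = ⊤ := by
    refine hT _ (fun x hx => (mulVec_mulVec_eq_zero_of_posSemidef_lyapunov hY hlyap hx).2) ?_
    rintro _ ⟨u, rfl⟩
    change Y *ᵥ (T.b *ᵥ u) = 0
    rw [mulVec_mulVec, hYb, zero_mulVec]
  exact Matrix.ext_of_mulVec_single fun i => by
    rw [zero_mulVec]
    exact LinearMap.congr_fun (LinearMap.ker_eq_top.1 hker) _

lemma rescaledRiccati_smul (hX : X.IsHermitian) (h : T.Riccati X) {s : ℝ} (hs : 0 ≤ s) :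
    T.RescaledRiccati s (s • X) := by
  refine ⟨?_, ?_, ?_⟩
  · rw [conjTranspose_smul, hX.eq, star_trivial]
  · rw [LinearMap.map_smul_of_tower]
    exact (posSemidef_lyapunov_of_riccati hX h).smul hs
  · rw [LinearMap.map_smul_of_tower, riccati_iff.1 h]
    simp only [Matrix.smul_mul, Matrix.mul_smul]
    module

lemma exists_eventually_norm_le (hT : IsControllable T.a T.b) :
    ∃ R : ℝ, ∀ᶠ U in 𝓝 T, ∀ X, X.IsHermitian → U.Riccati X → ‖X‖ ≤ R := by
  have hsphere : ∀ᶠ p : Realization m₁ m₂ n × ℝ in 𝓝 (T, 0),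
      ∀ Y ∈ Metric.sphere (0 : Matrix (Fin n) (Fin n) ℂ) 1, ¬ p.1.RescaledRiccati p.2 Y := by
    refine (isCompact_sphere _ _).eventually_forall_of_forall_eventually fun Y hY => ?_
    refine isClosed_setOf_rescaledRiccati.isOpen_compl.eventually_mem fun h => ?_
    have hY_zero : Y = 0 := RescaledRiccati.eq_zero hT h
    simp [hY_zero] at hY
  rw [nhds_prod_eq, eventually_prod_iff] at hsphere
  obtain ⟨P, hP, Q, hQ, hPQ⟩ := hsphere
  obtain ⟨r, hr, hball⟩ := Metric.eventually_nhds_iff.1 hQ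
  refine ⟨r⁻¹, hP.mono fun U hU X hX h => ?_⟩
  by_contra! hlt
  have hXpos : 0 < ‖X‖ := (inv_pos.2 hr).trans hlt
  refine hPQ hU (hball (y := ‖X‖⁻¹) ?_) (‖X‖⁻¹ • X) ?_
    (rescaledRiccati_smul hX h (inv_nonneg.2 hXpos.le))
  · rw [dist_zero_right, norm_inv, norm_norm]
    exact inv_lt_of_inv_lt₀ hr hlt
  · rw [mem_sphere_zero_iff_norm, norm_smul, norm_inv, norm_norm, inv_mul_cancel₀ hXpos.ne']

lemma eventually_forall_not_isHermitianSolution (hT : IsControllable T.a T.b) {H : Set ℂ}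
    (hH : IsClosed H) {F : Set (Matrix (Fin n) (Fin n) ℂ)} (hF : IsClosed F)
    (h : ∀ X ∈ F, ¬ T.IsHermitianSolution H X) :
    ∀ᶠ U in 𝓝 T, ∀ X ∈ F, ¬ U.IsHermitianSolution H X := by
  obtain ⟨R, hR⟩ := exists_eventually_norm_le hT
  have hcompact : ∀ᶠ U in 𝓝 T, ∀ X ∈ F ∩ Metric.closedBall 0 R, ¬ U.IsHermitianSolution H X := by
    have := FiniteDimensional.proper ℂ (Matrix (Fin n) (Fin n) ℂ)
    exact ((isCompact_closedBall _ _).inter_left hF).eventually_forall_of_forall_eventually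
      fun X hX => (isClosed_setOf_isHermitianSolution hH).isOpen_compl.eventually_mem (h X hX.1)
  filter_upwards [hR, hcompact] with U hbound hnot X hX hsol
  exact hnot X ⟨hX, by simpa using hbound X hsol.isHermitian hsol.riccati⟩ hsol

lemma isClosed_setOf_exists_isHermitianSolution {α : Type*} [TopologicalSpace α]
    {f : α → Realization m₁ m₂ n} (hf : Continuous f)
    (hcontr : ∀ t, IsControllable (f t).a (f t).b) {H : Set ℂ} (hH : IsClosed H) :
    IsClosed {t | ∃ X, (f t).IsHermitianSolution H X} := by
  refine ⟨isOpen_iff_eventually.2 fun t ht => ?_⟩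
  have hnone := eventually_forall_not_isHermitianSolution (hcontr t) hH isClosed_univ
    fun X _ hX => ht ⟨X, hX⟩
  filter_upwards [hf.continuousAt.eventually hnone] with s hs
  exact fun ⟨X, hX⟩ => hs X trivial hX

lemma IsSpectralSolution.eventually_norm_sub_lt (hT : IsControllable T.a T.b)
    (hX : T.IsSpectralSolution X) {ε : ℝ} (hε : 0 < ε) :
    ∀ᶠ U in 𝓝 T, ∀ Y, U.IsSpectralSolution Y → ‖X - Y‖ < ε := by
  have hhalf : IsClosed {z : ℂ | 0 ≤ z.im} := isClosed_le continuous_const Complex.continuous_im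
  have hfar : IsClosed {Y | ε ≤ ‖X - Y‖} := isClosed_le continuous_const (by fun_prop)
  have hnone := eventually_forall_not_isHermitianSolution hT hhalf hfar fun Y hY h => by
    have hXY := hX.isHermitianSolution.eq hT h
    simp only [Set.mem_ofPred_eq, hXY, sub_self, norm_zero] at hY
    exact hY.not_gt hε
  filter_upwards [hnone] with U hU Y hY
  exact not_le.1 fun hle => hU Y hle hY.isHermitianSolution

/-- The left-hand side `X ℬ ℬ* X - i (𝒜* X - X 𝒜)` of the Riccati equation without its constant
term. -/
noncomputable def riccatiMap (T : Realization m₁ m₂ n) (X : Matrix (Fin n) (Fin n) ℂ) :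
    Matrix (Fin n) (Fin n) ℂ :=
  X * (T.b * T.bᴴ) * X - lyapunov T.a X

lemma riccati_iff_riccatiMap_eq : T.Riccati X ↔ T.riccatiMap X = -(T.cᴴ * T.c) := by
  rw [riccati_iff, riccatiMap, ← sub_eq_iff_eq_add', ← neg_inj, neg_sub]

lemma map_nhds_riccatiMap (hX : X.IsHermitian) (hspec : ∀ μ ∈ spectrum ℂ (T.recA X), 0 < μ.im) :
    map T.riccatiMap (𝓝 X) = 𝓝 (T.riccatiMap X) := by
  let L (M : Matrix (Fin n) (Fin n) ℂ) : Matrix (Fin n) (Fin n) ℂ →L[ℂ] Matrix (Fin n) (Fin n) ℂ :=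
    LinearMap.toContinuousLinearMap (lyapunov M)
  have hderiv : HasStrictFDerivAt T.riccatiMap (-L (T.recA X)) X := by
    have hid := hasStrictFDerivAt_id (𝕜 := ℂ) X
    refine (((hid.mul_const' (T.b * T.bᴴ)).mul' hid).sub
      (L T.a).hasStrictFDerivAt).congr_fderiv ?_
    ext1 H
    change X * (T.b * T.bᴴ) * H + H * (T.b * T.bᴴ) * X - lyapunov T.a H = -lyapunov (T.recA X) H
    rw [lyapunov_recA, hX.eq, neg_sub]
  refine hderiv.map_nhds_eq_of_surj (LinearMap.range_eq_top.2 ?_)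
  exact neg_surjective.comp (LinearMap.injective_iff_surjective.1 (lyapunov_injective hspec))

lemma isHermitian_of_riccatiMap (hspec : ∀ μ ∈ spectrum ℂ (T.recA X), 0 < μ.im)
    (h : (T.riccatiMap X).IsHermitian) : X.IsHermitian := by
  have hlyap : lyapunov (T.recA X) (Xᴴ - X) = T.riccatiMap X - (T.riccatiMap X)ᴴ := by
    rw [lyapunov_recA, map_sub, lyapunov_conjTranspose]
    simp only [riccatiMap, conjTranspose_sub, conjTranspose_mul, conjTranspose_conjTranspose]
    noncomm_ring
  rw [h.eq, sub_self] at hlyap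
  exact sub_eq_zero.1 ((map_eq_zero_iff _ (lyapunov_injective hspec)).1 hlyap)

lemma IsHermitianSolution.eventually_exists
    (hX : T.IsHermitianSolution {z | 0 < z.im} X) :
    ∀ᶠ c in 𝓝 T.c, ∃ Y, ({ T with c := c } : Realization m₁ m₂ n).IsHermitianSolution
      {z | 0 < z.im} Y := by
  have hopen : IsOpen {Y | spectrum ℂ (T.recA Y) ⊆ {z : ℂ | 0 < z.im}} :=
    (isOpen_setOf_spectrum_subset (isOpen_lt continuous_const Complex.continuous_im)).preimage
      (continuous_recA.comp (Continuous.prodMk_right T))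
  have himage := image_mem_map (m := T.riccatiMap) (hopen.mem_nhds hX.spectrum_subset)
  rw [map_nhds_riccatiMap hX.isHermitian hX.spectrum_subset,
    riccati_iff_riccatiMap_eq.1 hX.riccati] at himage
  have hcont : Continuous fun c : Matrix (Fin m₁) (Fin n) ℂ => -(cᴴ * c) := by fun_prop
  filter_upwards [hcont.continuousAt.eventually himage] with c ⟨Y, hspec, hY⟩
  refine ⟨Y, isHermitian_of_riccatiMap hspec ?_, riccati_iff_riccatiMap_eq.2 hY, hspec⟩
  rw [hY]
  exact (isHermitian_conjTranspose_mul_self c).neg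

lemma IsHermitianSolution.im_pos (hT : T ∈ classG m₁ m₂ n) {τ : ℝ} (hτ : τ ∈ Set.Ico (0 : ℝ) 1)
    (hX : ({ T with c := τ • T.c } : Realization m₁ m₂ n).IsHermitianSolution {z | 0 ≤ z.im} X) :
    ({ T with c := τ • T.c } : Realization m₁ m₂ n).IsHermitianSolution {z | 0 < z.im} X := by
  refine ⟨hX.isHermitian, hX.riccati, fun ω hω =>
    Set.mem_ofPred.2 ((Set.mem_ofPred.1 (hX.spectrum_subset hω)).lt_of_ne' fun hω0 => ?_)⟩
  have ha : ω ∉ spectrum ℂ T.a := notMem_spectrum_of_im_nonpos hT hω0.le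
  refine notMem_spectrum_recA hX.isHermitian hX.riccati hω0 ha ?_ hω
  have hψ := posSemidef_one_sub_transfer hT hω0.le
  have hdecomp : 1 - (({ T with c := τ • T.c } : Realization m₁ m₂ n).transfer ω)ᴴ *
      ({ T with c := τ • T.c } : Realization m₁ m₂ n).transfer ω =
      (1 - τ ^ 2) • (1 : Matrix (Fin m₂) (Fin m₂) ℂ) +
        τ ^ 2 • (1 - (T.transfer ω)ᴴ * T.transfer ω) := by
    simp only [transfer, Matrix.smul_mul, conjTranspose_smul, star_trivial, Matrix.mul_smul]
    module
  rw [hdecomp]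
  exact (PosDef.one.smul (by nlinarith [hτ.1, hτ.2])).add_posSemidef (hψ.smul (sq_nonneg τ))

-- Continuation of `X = 0` along `(𝒜, ℬ, τ𝒞)`, `0 ≤ τ ≤ 1`: for `τ < 1` the function `τψ` is
-- strictly contractive on the real axis, so the solution is nondegenerate.
lemma exists_isHermitianSolution (hT : T ∈ classG m₁ m₂ n) :
    ∃ X, T.IsHermitianSolution {z | 0 ≤ z.im} X := by
  let f (τ : ℝ) : Realization m₁ m₂ n := { T with c := τ • T.c }
  have hf : Continuous f := by
    refine (LipschitzWith.of_dist_le_mul (K := ‖T.c‖₊) fun σ τ => le_of_eq ?_).continuous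
    simp [f, dist_eq, ← sub_smul, norm_smul, Real.dist_eq, mul_comm]
  have hclosed : IsClosed {τ | ∃ X, (f τ).IsHermitianSolution {z | 0 ≤ z.im} X} :=
    isClosed_setOf_exists_isHermitianSolution hf (fun _ => hT.1.isControllable)
      (isClosed_le continuous_const Complex.continuous_im)
  have hzero : (f 0).IsHermitianSolution {z | 0 ≤ z.im} 0 := by
    refine ⟨isHermitian_zero, by simp [f, Riccati], fun μ hμ => ?_⟩
    rw [recA, Matrix.mul_zero, smul_zero, sub_zero] at hμ
    exact (im_pos_of_mem_spectrum hT hμ).le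
  have hone : (1 : ℝ) ∈ {τ | ∃ X, (f τ).IsHermitianSolution {z | 0 ≤ z.im} X} := by
    refine (hclosed.inter isClosed_Icc).Icc_subset_of_forall_exists_gt ⟨0, hzero⟩ ?_
      (Set.right_mem_Icc.2 zero_le_one)
    rintro τ ⟨⟨X, hX⟩, hτ⟩ y hy
    have hhalf : {z : ℂ | 0 < z.im} ⊆ {z | 0 ≤ z.im} := Set.ofPred_subset_ofPred.2 fun _ => le_of_lt
    have hcont : Tendsto (fun σ : ℝ => σ • T.c) (𝓝[>] τ) (𝓝 (τ • T.c)) :=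
      ((continuous_id.smul continuous_const).tendsto τ).mono_left nhdsWithin_le_nhds
    obtain ⟨σ, ⟨Y, hY⟩, hσ⟩ :=
      ((hcont.eventually (hX.im_pos hT hτ).eventually_exists).and (Ioc_mem_nhdsGT hy)).exists
    exact ⟨σ, ⟨Y, hY.isHermitian, hY.riccati, hY.spectrum_subset.trans hhalf⟩, hσ⟩
  obtain ⟨X, hX⟩ := hone
  exact ⟨X, by simpa only [f, one_smul] using hX⟩

lemma existsUnique_isSpectralSolution (hT : T ∈ classG m₁ m₂ n) : ∃! X, T.IsSpectralSolution X := by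
  obtain ⟨X, hX⟩ := exists_isHermitianSolution hT
  exact ⟨X, ⟨posDef_of_riccati hT hX.isHermitian hX.riccati, hX.riccati, hX.spectrum_subset⟩,
    fun Y hY => hY.isHermitianSolution.eq hT.1.isControllable hX⟩

end Realization

/-! ### The discrete Bäcklund–Darboux transformation -/

section Step

variable {ι κ : Type*} [Fintype ι] [DecidableEq ι] {A S : Matrix ι ι ℂ} {P : Matrix ι κ ℂ}

/-- The matrix `Π* S⁻¹` through which the potential and the transfer function of an `S`-node are
expressed. -/
noncomputable def gain (S : Matrix ι ι ℂ) (P : Matrix ι κ ℂ) : Matrix κ ι ℂ :=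
  Pᴴ * S⁻¹

lemma isUnit_det_of_posDef (hS : S.PosDef) : IsUnit S.det :=
  (isUnit_iff_isUnit_det _).1 hS.isUnit

lemma conjTranspose_gain (hS : S.IsHermitian) : (gain S P)ᴴ = S⁻¹ * P := by
  rw [gain, conjTranspose_mul, conjTranspose_conjTranspose, hS.inv.eq]

variable [Fintype κ]

/-- The recursion step `S ↦ S + A⁻¹ S (A*)⁻¹ + A⁻¹ Π Π* (A*)⁻¹`. -/
noncomputable def stepS (A S : Matrix ι ι ℂ) (P : Matrix ι κ ℂ) : Matrix ι ι ℂ :=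
  S + A⁻¹ * S * (Aᴴ)⁻¹ + A⁻¹ * P * Pᴴ * (Aᴴ)⁻¹

lemma stepS_eq (A S : Matrix ι ι ℂ) (P : Matrix ι κ ℂ) :
    stepS A S P = S + A⁻¹ * S * (A⁻¹)ᴴ + A⁻¹ * P * (A⁻¹ * P)ᴴ := by
  simp only [stepS, conjTranspose_mul, conjTranspose_nonsing_inv, Matrix.mul_assoc]

lemma posDef_stepS (hS : S.PosDef) : (stepS A S P).PosDef := by
  rw [stepS_eq]
  exact (hS.add_posSemidef (hS.posSemidef.mul_mul_conjTranspose_same _)).add_posSemidef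
    (posSemidef_self_mul_conjTranspose _)

/-- The recursion step `Π ↦ Π + i A⁻¹ Π J`. -/
noncomputable def stepP (J : Matrix κ κ ℂ) (A : Matrix ι ι ℂ) (P : Matrix ι κ ℂ) : Matrix ι κ ℂ :=
  P + Complex.I • (A⁻¹ * P * J)

variable {J : Matrix κ κ ℂ}

lemma mul_stepP (hA : IsUnit A.det) : A * stepP J A P = A * P + Complex.I • (P * J) := by
  rw [stepP, Matrix.mul_add, Matrix.mul_smul, Matrix.mul_assoc A⁻¹, ← Matrix.mul_assoc A,
    mul_nonsing_inv _ hA, Matrix.one_mul]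

variable [DecidableEq κ]

lemma stepP_mul (hJ : J * J = 1) : stepP J A P * J = P * J + Complex.I • (A⁻¹ * P) := by
  rw [stepP, Matrix.add_mul, Matrix.smul_mul, Matrix.mul_assoc _ J, hJ, Matrix.mul_one]

/-- An `S`-node in the sense of L. Sakhnovich: matrices tied by `A S - S A* = i Π J Π*`, here
with `A` invertible and `S > 0`. For `J = j` this is an admissible triple. -/
structure IsSNode (J : Matrix κ κ ℂ) (A S : Matrix ι ι ℂ) (P : Matrix ι κ ℂ) : Prop where
  mul_self : J * J = 1
  conjTranspose_eq : Jᴴ = J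
  isUnit_det : IsUnit A.det
  posDef : S.PosDef
  identity : A * S - S * Aᴴ = Complex.I • (P * J * Pᴴ)

/-- The potential `I + Π* S⁻¹ Π - Π₊* S₊⁻¹ Π₊` produced by the step from `S, Π` to `S₊, Π₊`. -/
noncomputable def stepC (J : Matrix κ κ ℂ) (A S : Matrix ι ι ℂ) (P : Matrix ι κ ℂ) :
    Matrix κ κ ℂ :=
  1 + gain S P * P - gain (stepS A S P) (stepP J A P) * stepP J A P

/-- The transfer function `w(l) = I - i J Π* S⁻¹ (A - l)⁻¹ Π` of an `S`-node, which serves as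
Darboux matrix. -/
noncomputable def darboux (J : Matrix κ κ ℂ) (A S : Matrix ι ι ℂ) (P : Matrix ι κ ℂ) (l : ℂ) :
    Matrix κ κ ℂ :=
  1 - Complex.I • (J * (gain S P * ((A - l • 1)⁻¹ * P)))

namespace IsSNode

variable (h : IsSNode J A S P)

include h

lemma inv_mul_sub :
    S * (A⁻¹)ᴴ - A⁻¹ * S = Complex.I • (A⁻¹ * P * J * (A⁻¹ * P)ᴴ) := by
  have hA' : Aᴴ * (A⁻¹)ᴴ = 1 := by
    rw [← conjTranspose_mul, nonsing_inv_mul _ h.isUnit_det, conjTranspose_one]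
  calc S * (A⁻¹)ᴴ - A⁻¹ * S
      = A⁻¹ * A * S * (A⁻¹)ᴴ - A⁻¹ * S * (Aᴴ * (A⁻¹)ᴴ) := by
        rw [hA', nonsing_inv_mul _ h.isUnit_det, Matrix.one_mul, Matrix.mul_one]
    _ = A⁻¹ * (A * S - S * Aᴴ) * (A⁻¹)ᴴ := by
        simp only [Matrix.mul_sub, Matrix.sub_mul, Matrix.mul_assoc]
    _ = Complex.I • (A⁻¹ * P * J * (A⁻¹ * P)ᴴ) := by
        simp only [h.identity, conjTranspose_mul, Matrix.mul_smul, Matrix.smul_mul,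
          Matrix.mul_assoc]

lemma inv_identity : S⁻¹ * A - Aᴴ * S⁻¹ = Complex.I • ((gain S P)ᴴ * J * gain S P) := by
  have hS := isUnit_det_of_posDef h.posDef
  calc S⁻¹ * A - Aᴴ * S⁻¹
      = S⁻¹ * A * (S * S⁻¹) - S⁻¹ * S * (Aᴴ * S⁻¹) := by
        rw [mul_nonsing_inv _ hS, nonsing_inv_mul _ hS, Matrix.one_mul, Matrix.mul_one]
    _ = S⁻¹ * (A * S - S * Aᴴ) * S⁻¹ := by
        simp only [Matrix.mul_sub, Matrix.sub_mul, Matrix.mul_assoc]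
    _ = Complex.I • ((gain S P)ᴴ * J * gain S P) := by
        rw [h.identity, conjTranspose_gain h.posDef.1, gain]
        simp only [Matrix.mul_smul, Matrix.smul_mul, Matrix.mul_assoc]

lemma conjTranspose_stepP_mul :
    (stepP J A P)ᴴ * Aᴴ = Pᴴ * Aᴴ - Complex.I • (J * Pᴴ) := by
  rw [← conjTranspose_mul, mul_stepP h.isUnit_det, conjTranspose_add, conjTranspose_smul,
    conjTranspose_mul, conjTranspose_mul, h.conjTranspose_eq, RCLike.star_def, Complex.conj_I,
    neg_smul, ← sub_eq_add_neg]

lemma step : IsSNode J A (stepS A S P) (stepP J A P) where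
  mul_self := h.mul_self
  conjTranspose_eq := h.conjTranspose_eq
  isUnit_det := h.isUnit_det
  posDef := posDef_stepS h.posDef
  identity := by
    have hA : A * A⁻¹ = 1 := mul_nonsing_inv _ h.isUnit_det
    have hA' : (A⁻¹)ᴴ * Aᴴ = 1 := by rw [← conjTranspose_mul, hA, conjTranspose_one]
    have hAmul (M : Matrix ι ι ℂ) : A * (A⁻¹ * M) = M := by
      rw [← Matrix.mul_assoc, hA, Matrix.one_mul]
    have hJmul (M : Matrix κ ι ℂ) : J * (J * M) = M := by
      rw [← Matrix.mul_assoc, h.mul_self, Matrix.one_mul]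
    have hid := h.identity
    have hinv := h.inv_mul_sub
    rw [stepS_eq, stepP]
    simp only [conjTranspose_add, conjTranspose_mul, conjTranspose_smul, h.conjTranspose_eq,
      RCLike.star_def, Complex.conj_I, Matrix.mul_add, Matrix.add_mul, Matrix.mul_assoc, hAmul,
      hJmul, hA', Matrix.mul_one, Matrix.smul_mul, Matrix.mul_smul, smul_add, smul_smul]
      at hid hinv ⊢
    linear_combination (norm := skip) hid + hinv
    match_scalars <;> ring_nf <;> simp only [Complex.I_sq, Complex.I_pow_three] <;> ring

lemma stepS_mul_conjTranspose :
    stepS A S P * Aᴴ = (A + A⁻¹) * S - Complex.I • (stepP J A P * J * Pᴴ) := by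
  have hA : (A⁻¹)ᴴ * Aᴴ = 1 := by
    rw [← conjTranspose_mul, mul_nonsing_inv _ h.isUnit_det, conjTranspose_one]
  have hid := h.identity
  rw [stepP_mul h.mul_self, stepS_eq]
  simp only [Matrix.add_mul, Matrix.mul_assoc, hA, Matrix.mul_one, Matrix.smul_mul,
    conjTranspose_mul, smul_add, smul_smul, Complex.I_mul_I] at hid ⊢
  linear_combination (norm := module) -hid

lemma inv_stepS_mul :
    (stepS A S P)⁻¹ * (A + A⁻¹) = Aᴴ * S⁻¹ +
      Complex.I • ((gain (stepS A S P) (stepP J A P))ᴴ * J * gain S P) := by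
  have hS := isUnit_det_of_posDef h.posDef
  have hS' := isUnit_det_of_posDef h.step.posDef
  have hmul := congrArg (fun M => (stepS A S P)⁻¹ * M * S⁻¹) h.stepS_mul_conjTranspose
  simp only [← Matrix.mul_assoc, nonsing_inv_mul _ hS', Matrix.one_mul, Matrix.mul_sub,
    Matrix.sub_mul, Matrix.mul_smul, Matrix.smul_mul] at hmul
  rw [Matrix.mul_assoc _ S, mul_nonsing_inv _ hS, Matrix.mul_one] at hmul
  rw [hmul, conjTranspose_gain h.step.posDef.1, gain]
  simp only [← Matrix.mul_assoc, sub_add_cancel]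

lemma add_mul_inv_stepS :
    (Aᴴ + (A⁻¹)ᴴ) * (stepS A S P)⁻¹ = S⁻¹ * A -
      Complex.I • ((gain S P)ᴴ * J * gain (stepS A S P) (stepP J A P)) := by
  have hadj := congrArg conjTranspose h.inv_stepS_mul
  simpa only [conjTranspose_mul, conjTranspose_add, conjTranspose_smul, RCLike.star_def,
    Complex.conj_I, conjTranspose_conjTranspose, h.conjTranspose_eq, h.posDef.1.inv.eq,
    h.step.posDef.1.inv.eq, neg_smul, ← sub_eq_add_neg, ← Matrix.mul_assoc] using hadj

lemma gain_step_mul_add :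
    gain (stepS A S P) (stepP J A P) * (A + A⁻¹) =
      gain S P * A - Complex.I • (stepC J A S P * J * gain S P) := by
  have hid := congrArg (Pᴴ * ·) h.inv_identity
  have hstep := congrArg ((stepP J A P)ᴴ * ·) h.inv_stepS_mul
  simp only [conjTranspose_gain h.posDef.1, conjTranspose_gain h.step.posDef.1, Matrix.mul_sub,
    Matrix.mul_add, Matrix.mul_smul, ← Matrix.mul_assoc] at hid hstep
  rw [h.conjTranspose_stepP_mul] at hstep
  simp only [stepC, gain, Matrix.mul_add, Matrix.add_mul, Matrix.sub_mul, Matrix.smul_mul,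
    Matrix.one_mul, ← Matrix.mul_assoc] at hid hstep ⊢
  linear_combination (norm := module) hstep - hid

lemma gain_sub_mul :
    (gain S P - gain (stepS A S P) (stepP J A P)) * A =
      Complex.I • (stepC J A S P * J * gain (stepS A S P) (stepP J A P)) := by
  have hid := congrArg ((stepP J A P)ᴴ * ·) h.step.inv_identity
  have hstep := congrArg (Pᴴ * ·) h.add_mul_inv_stepS
  have hJ : J * (stepP J A P)ᴴ = J * Pᴴ - Complex.I • (Pᴴ * (A⁻¹)ᴴ) := by
    have hadj := congrArg conjTranspose (stepP_mul (A := A) (P := P) h.mul_self)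
    simpa only [conjTranspose_mul, conjTranspose_add, conjTranspose_smul, RCLike.star_def,
      Complex.conj_I, h.conjTranspose_eq, neg_smul, ← sub_eq_add_neg] using hadj
  have hJinv := congrArg (fun M => Complex.I • (M * (stepS A S P)⁻¹)) hJ
  simp only [conjTranspose_gain h.posDef.1, conjTranspose_gain h.step.posDef.1, Matrix.mul_sub,
    Matrix.mul_add, Matrix.mul_smul, ← Matrix.mul_assoc] at hid hstep
  rw [h.conjTranspose_stepP_mul] at hid
  simp only [stepC, gain, Matrix.add_mul, Matrix.sub_mul, Matrix.smul_mul, Matrix.one_mul,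
    ← Matrix.mul_assoc, smul_sub, smul_add, smul_smul, Complex.I_mul_I]
    at hid hstep hJinv ⊢
  linear_combination (norm := module) -hid - hstep - hJinv

lemma stepC_mul_mul_stepC : stepC J A S P * J * stepC J A S P = J := by
  set C := stepC J A S P with hC
  set U := gain S P
  set U' := gain (stepS A S P) (stepP J A P)
  have hCU : C * J * U * P = Complex.I • (U' * (A + A⁻¹) * P - U * A * P) := by
    rw [h.gain_step_mul_add, Matrix.sub_mul, sub_sub_cancel_left, Matrix.smul_mul, smul_neg,
      smul_smul, Complex.I_mul_I, neg_smul, one_smul, neg_neg]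
  have hCU' : C * J * U' * stepP J A P =
      -Complex.I • ((U - U') * (A * P + Complex.I • (P * J))) := by
    rw [← mul_stepP h.isUnit_det, ← Matrix.mul_assoc (U - U'), h.gain_sub_mul, Matrix.smul_mul,
      smul_smul, neg_mul, Complex.I_mul_I, neg_neg, one_smul]
  calc C * J * C = C * J + C * J * U * P - C * J * U' * stepP J A P := by
        rw [hC, stepC, Matrix.mul_sub, Matrix.mul_add, Matrix.mul_one, ← Matrix.mul_assoc,
          ← Matrix.mul_assoc]
    _ = J + U * (P * J) - U' * (stepP J A P * J) + C * J * U * P - C * J * U' * stepP J A P := by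
        nth_rewrite 1 [hC]
        rw [stepC, Matrix.sub_mul, Matrix.add_mul, Matrix.one_mul, Matrix.mul_assoc,
          Matrix.mul_assoc]
    _ = J := by
        rw [hCU, hCU', stepP_mul h.mul_self]
        simp only [Matrix.mul_add, Matrix.add_mul, Matrix.sub_mul, Matrix.mul_smul,
          Matrix.mul_assoc, smul_add, smul_sub, smul_smul, neg_mul, Complex.I_mul_I]
        module

lemma posSemidef_stepC : (stepC J A S P).PosSemidef := by
  have hS := isUnit_det_of_posDef h.posDef
  have := h.step.posDef.isUnit.invertible
  refine (PosDef.fromBlocks₁₁ (stepP J A P) (1 + gain S P * P) h.step.posDef).1 ?_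
  have hsum : fromBlocks (stepS A S P) (stepP J A P) (stepP J A P)ᴴ (1 + gain S P * P) =
      fromRows S Pᴴ * S⁻¹ * (fromRows S Pᴴ)ᴴ +
        fromRows A⁻¹ (0 : Matrix κ ι ℂ) * S * (fromRows A⁻¹ 0)ᴴ +
        fromRows (A⁻¹ * P) (-Complex.I • J) * (fromRows (A⁻¹ * P) (-Complex.I • J))ᴴ := by
    rw [stepS_eq, stepP, gain, fromRows_mul S Pᴴ S⁻¹, fromRows_mul A⁻¹ 0 S]
    simp only [conjTranspose_fromRows_eq_fromCols_conjTranspose, fromRows_mul_fromCols,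
      fromBlocks_add, conjTranspose_conjTranspose, mul_nonsing_inv _ hS, Matrix.one_mul,
      h.posDef.1.eq, conjTranspose_zero, Matrix.zero_mul, Matrix.mul_zero, add_zero,
      conjTranspose_smul, h.conjTranspose_eq, Matrix.smul_mul, Matrix.mul_smul, Matrix.mul_assoc,
      nonsing_inv_mul _ hS, Matrix.mul_one, h.mul_self, conjTranspose_add, conjTranspose_mul,
      RCLike.star_def, Complex.conj_I, map_neg, neg_neg, smul_smul, mul_neg, Complex.I_mul_I,
      one_smul, add_comm (1 : Matrix κ κ ℂ)]
  rw [hsum]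
  exact ((h.posDef.inv.posSemidef.mul_mul_conjTranspose_same _).add
    (h.posDef.posSemidef.mul_mul_conjTranspose_same _)).add (posSemidef_self_mul_conjTranspose _)

lemma posSemidef_stepS_sub {s : ℝ} (hs : s ^ 2 = 1) :
    (stepS A S P - (1 + (Complex.I * s) • A⁻¹) * S * (1 + (Complex.I * s) • A⁻¹)ᴴ).PosSemidef := by
  have hs' : (s : ℂ) ^ 2 = 1 := by exact_mod_cast hs
  have hinv := congrArg ((Complex.I * s) • ·) h.inv_mul_sub
  have hhalf := (((posSemidef_self_mul_conjTranspose (1 - (s : ℂ) • J)).mul_mul_conjTranspose_same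
    (A⁻¹ * P)).smul (Complex.zero_le_real.2 (by norm_num : (0 : ℝ) ≤ 1 / 2)))
  convert hhalf using 1
  rw [stepS_eq]
  simp only [conjTranspose_sub, conjTranspose_add, conjTranspose_one, conjTranspose_smul, star_mul',
    RCLike.star_def, Complex.conj_I, Complex.conj_ofReal, h.conjTranspose_eq, Matrix.add_mul,
    Matrix.mul_add, Matrix.one_mul, Matrix.mul_one, Matrix.smul_mul, Matrix.mul_smul,
    Matrix.sub_mul, Matrix.mul_sub, h.mul_self, conjTranspose_mul, Matrix.mul_assoc] at hinv ⊢
  linear_combination (norm := skip) hinv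
  match_scalars <;> ring_nf <;> simp only [Complex.I_sq, hs'] <;> ring

end IsSNode

section Resolvent

variable {l z : ℂ}

lemma isUnit_det_sub_of_notMem_spectrum (hl : l ∉ spectrum ℂ A) : IsUnit (A - l • 1).det := by
  have hdet := isUnit_det_of_notMem_spectrum hl
  rw [← neg_sub, det_neg] at hdet
  exact isUnit_of_mul_isUnit_right hdet

lemma mul_resolvent (hl : l ∉ spectrum ℂ A) : A * (A - l • 1)⁻¹ = 1 + l • (A - l • 1)⁻¹ := by
  have hinv := mul_nonsing_inv _ (isUnit_det_sub_of_notMem_spectrum hl)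
  rwa [Matrix.sub_mul, Matrix.smul_mul, Matrix.one_mul, sub_eq_iff_eq_add] at hinv

lemma inv_mul_resolvent (hA : IsUnit A.det) (hl : l ∉ spectrum ℂ A) (hz : z * l = -1) :
    A⁻¹ * (A - l • 1)⁻¹ = z • (A⁻¹ - (A - l • 1)⁻¹) := by
  have hunit : IsUnit A ↔ IsUnit (A - l • 1) :=
    iff_of_true ((isUnit_iff_isUnit_det _).2 hA)
      ((isUnit_iff_isUnit_det _).2 (isUnit_det_sub_of_notMem_spectrum hl))
  rw [Matrix.inv_sub_inv hunit, sub_sub_cancel_left, Matrix.mul_neg, Matrix.neg_mul,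
    Matrix.mul_smul, Matrix.smul_mul, Matrix.mul_one, smul_neg, smul_smul, hz, neg_one_smul,
    neg_neg]

lemma resolvent_mul_inv (hA : IsUnit A.det) (hl : l ∉ spectrum ℂ A) (hz : z * l = -1) :
    (A - l • 1)⁻¹ * A⁻¹ = z • (A⁻¹ - (A - l • 1)⁻¹) := by
  have hcomm : (A - l • 1) * A = A * (A - l • 1) := by
    rw [Matrix.sub_mul, Matrix.mul_sub, Matrix.smul_mul, Matrix.mul_smul, Matrix.one_mul,
      Matrix.mul_one]
  rw [← inv_mul_resolvent hA hl hz, ← Matrix.mul_inv_rev, ← Matrix.mul_inv_rev, hcomm]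

lemma resolvent_mul_stepP (hA : IsUnit A.det) (hJ : J * J = 1) (hl : l ∉ spectrum ℂ A)
    (hz : z * l = -1) :
    (A - l • 1)⁻¹ * stepP J A P * (1 + (Complex.I * z) • J) =
      z • stepP J A P - z • ((A + A⁻¹) * ((A - l • 1)⁻¹ * P)) := by
  have hmulJ : (A - l • 1)⁻¹ * (stepP J A P * J) =
      (A - l • 1)⁻¹ * (P * J) + Complex.I • ((A - l • 1)⁻¹ * A⁻¹ * P) := by
    rw [stepP_mul hJ, Matrix.mul_add, Matrix.mul_smul, Matrix.mul_assoc _ A⁻¹]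
  have hmul : (A - l • 1)⁻¹ * stepP J A P =
      (A - l • 1)⁻¹ * P + Complex.I • ((A - l • 1)⁻¹ * A⁻¹ * (P * J)) := by
    rw [stepP, Matrix.mul_add, Matrix.mul_smul, Matrix.mul_assoc A⁻¹, Matrix.mul_assoc _ A⁻¹]
  rw [Matrix.mul_add, Matrix.mul_one, Matrix.mul_smul, Matrix.mul_assoc, hmulJ, hmul,
    ← Matrix.mul_assoc (A + A⁻¹), Matrix.add_mul A, mul_resolvent hl, inv_mul_resolvent hA hl hz,
    resolvent_mul_inv hA hl hz, stepP, Matrix.mul_assoc A⁻¹]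
  simp only [Matrix.add_mul, Matrix.sub_mul, Matrix.smul_mul, Matrix.one_mul, smul_add, smul_sub,
    smul_smul, hz]
  match_scalars <;> ring_nf <;> simp only [Complex.I_sq] <;> ring

end Resolvent

namespace IsSNode

variable {l z : ℂ} (h : IsSNode J A S P)

include h

lemma darboux_step (hl : l ∉ spectrum ℂ A) (hz : z * l = -1) :
    darboux J A (stepS A S P) (stepP J A P) l * (1 + (Complex.I * z) • J) =
      (1 + (Complex.I * z) • (J * stepC J A S P)) * darboux J A S P l := by
  set C := stepC J A S P with hC
  set U := gain S P with hU
  set U' := gain (stepS A S P) (stepP J A P) with hU'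
  set Q := (A - l • 1)⁻¹ * P with hQ
  have hAQ : A * Q = P + l • Q := by
    rw [hQ, ← Matrix.mul_assoc, mul_resolvent hl, Matrix.add_mul, Matrix.one_mul, Matrix.smul_mul]
  have hstep : U' * ((A + A⁻¹) * Q) = U * P + l • (U * Q) - Complex.I • (C * (J * (U * Q))) := by
    rw [← Matrix.mul_assoc, h.gain_step_mul_add, Matrix.sub_mul, Matrix.mul_assoc, hAQ,
      Matrix.mul_add, Matrix.mul_smul, Matrix.smul_mul, Matrix.mul_assoc, Matrix.mul_assoc]
  have hJC : J * C = J + J * (U * P) - J * (U' * stepP J A P) := by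
    rw [hC, stepC, Matrix.mul_sub, Matrix.mul_add, Matrix.mul_one]
  calc darboux J A (stepS A S P) (stepP J A P) l * (1 + (Complex.I * z) • J)
      = (1 + (Complex.I * z) • J) - Complex.I • (J * (U' *
          ((A - l • 1)⁻¹ * stepP J A P * (1 + (Complex.I * z) • J)))) := by
        rw [darboux, Matrix.sub_mul, Matrix.one_mul, Matrix.smul_mul]
        simp only [hU', Matrix.mul_assoc]
    _ = (1 + (Complex.I * z) • J) - (Complex.I * z) • (J * (U' * stepP J A P)) +
          (Complex.I * z) • (J * (U' * ((A + A⁻¹) * Q))) := by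
        rw [resolvent_mul_stepP h.isUnit_det h.mul_self hl hz]
        simp only [Matrix.mul_sub, Matrix.mul_smul]
        module
    _ = 1 + (Complex.I * z) • (J * C) - Complex.I • (J * (U * Q)) +
          z • (J * (C * (J * (U * Q)))) := by
        rw [hstep, hJC]
        simp only [Matrix.mul_sub, Matrix.mul_add, Matrix.mul_smul]
        linear_combination (norm := skip) (Complex.I * hz) • (J * (U * Q))
        match_scalars <;> ring_nf
        rw [Complex.I_sq]
        ring
    _ = (1 + (Complex.I * z) • (J * C)) * darboux J A S P l := by
        simp only [darboux, Matrix.mul_sub, Matrix.add_mul, Matrix.one_mul, Matrix.mul_one,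
          Matrix.smul_mul, Matrix.mul_smul, Matrix.mul_assoc, hU, hQ]
        match_scalars <;> ring_nf
        rw [Complex.I_sq]
        ring

lemma darboux_conj (hl : l ∉ spectrum ℂ A) :
    (darboux J A S P l)ᴴ * J * darboux J A S P l =
      J + ((2 * l.im : ℝ) : ℂ) • (((A - l • 1)⁻¹ * P)ᴴ * S⁻¹ * ((A - l • 1)⁻¹ * P)) := by
  set Q := (A - l • 1)⁻¹ * P with hQ
  have hAQ : A * Q = P + l • Q := by
    rw [hQ, ← Matrix.mul_assoc, mul_resolvent hl, Matrix.add_mul, Matrix.one_mul, Matrix.smul_mul]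
  have hQA : Qᴴ * Aᴴ = Pᴴ + star l • Qᴴ := by
    rw [← conjTranspose_mul, hAQ, conjTranspose_add, conjTranspose_smul]
  have hl' : ((2 * l.im : ℝ) : ℂ) = Complex.I * star l - Complex.I * l := by
    apply Complex.ext <;> simp [two_mul]
  have hid := congrArg (fun M => Complex.I • (Qᴴ * M * Q)) h.inv_identity
  have hQAmul (M : Matrix ι κ ℂ) : Qᴴ * (Aᴴ * M) = Pᴴ * M + star l • (Qᴴ * M) := by
    rw [← Matrix.mul_assoc, hQA, Matrix.add_mul, Matrix.smul_mul]
  have hJmul (M : Matrix κ κ ℂ) : J * (J * M) = M := by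
    rw [← Matrix.mul_assoc, h.mul_self, Matrix.one_mul]
  rw [hl', darboux, ← hQ]
  simp only [gain, conjTranspose_sub, conjTranspose_one, conjTranspose_smul, conjTranspose_mul,
    conjTranspose_conjTranspose, h.conjTranspose_eq, h.posDef.1.inv.eq, RCLike.star_def,
    Complex.conj_I, Matrix.mul_assoc, Matrix.mul_sub, Matrix.sub_mul, Matrix.mul_add,
    Matrix.one_mul, Matrix.mul_one, Matrix.smul_mul, Matrix.mul_smul, h.mul_self, hJmul, hAQ,
    hQAmul, smul_sub, smul_add, smul_smul, Complex.I_mul_I] at hid ⊢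
  linear_combination (norm := skip) hid
  match_scalars <;> ring_nf
  rw [Complex.I_sq]
  ring

end IsSNode

end Step

section Signature

variable {κ : Type*} [Fintype κ] [DecidableEq κ] {J C : Matrix κ κ ℂ}

lemma conj_one_add_smul (hJ : J * J = 1) (hJH : Jᴴ = J) (hC : Cᴴ = C) (z : ℂ) :
    (1 + (Complex.I * z) • (J * C))ᴴ * J * (1 + (Complex.I * z) • (J * C)) =
      J + ((-2 * z.im : ℝ) : ℂ) • C + ((‖z‖ ^ 2 : ℝ) : ℂ) • (C * J * C) := by
  have hnorm : ((‖z‖ ^ 2 : ℝ) : ℂ) = star z * z := by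
    rw [RCLike.star_def, ← Complex.normSq_eq_conj_mul_self, Complex.normSq_eq_norm_sq]
  have him : ((-2 * z.im : ℝ) : ℂ) = Complex.I * z - Complex.I * star z := by
    apply Complex.ext <;> simp
    ring
  have hJmul (M : Matrix κ κ ℂ) : J * (J * M) = M := by
    rw [← Matrix.mul_assoc, hJ, Matrix.one_mul]
  rw [hnorm, him]
  simp only [conjTranspose_add, conjTranspose_one, conjTranspose_smul, conjTranspose_mul, hJH, hC,
    star_mul', RCLike.star_def, Complex.conj_I, Matrix.add_mul, Matrix.mul_add, Matrix.one_mul,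
    Matrix.mul_one, Matrix.smul_mul, Matrix.mul_smul, Matrix.mul_assoc, hJ, hJmul]
  match_scalars <;> ring_nf
  rw [Complex.I_sq]
  ring

lemma posDef_of_mul_mul_eq (hJ : J * J = 1) (hC : C.PosSemidef) (h : C * J * C = J) :
    C.PosDef := by
  rw [hC.posDef_iff_isUnit]
  refine IsUnit.of_mul_eq_one (J * C * J) ?_
  rw [← Matrix.mul_assoc, ← Matrix.mul_assoc, h, hJ]

variable {m₁ m₂ n : ℕ}

lemma sig_mul_sig : sig m₁ m₂ * sig m₁ m₂ = 1 := by
  simp [sig, fromBlocks_multiply, ← fromBlocks_one]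

lemma conjTranspose_sig : (sig m₁ m₂)ᴴ = sig m₁ m₂ := by
  simp [sig, fromBlocks_conjTranspose]

end Signature

namespace IsAdmissible

variable {m₁ m₂ n : ℕ} {A S₀ : Matrix (Fin n) (Fin n) ℂ}
  {P₀ : Matrix (Fin n) (Fin m₁ ⊕ Fin m₂) ℂ} (h : IsAdmissible A S₀ P₀)

include h

lemma isSNode (k : ℕ) : IsSNode (sig m₁ m₂) A (seqS A S₀ P₀ k) (seqP A P₀ k) := by
  induction k with
  | zero => exact ⟨sig_mul_sig, conjTranspose_sig, h.det_ne_zero.isUnit, h.posDef, h.identity⟩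
  | succ k ih => exact ih.step

lemma isDiracPotential : IsDiracPotential (seqC A S₀ P₀) := fun k =>
  ⟨posDef_of_mul_mul_eq sig_mul_sig (h.isSNode k).posSemidef_stepC
    (h.isSNode k).stepC_mul_mul_stepC, (h.isSNode k).stepC_mul_mul_stepC⟩

lemma fundSol_mul_darboux {l z : ℂ} (hl : l ∉ spectrum ℂ A) (hz : z * l = -1) (k : ℕ) :
    fundSol (seqC A S₀ P₀) k z * darboux (sig m₁ m₂) A S₀ P₀ l =
      darboux (sig m₁ m₂) A (seqS A S₀ P₀ k) (seqP A P₀ k) l *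
        (1 + (Complex.I * z) • sig m₁ m₂) ^ k := by
  induction k with
  | zero => simp [fundSol, seqS, seqP]
  | succ k ih =>
    rw [fundSol, Matrix.mul_assoc, ih, ← Matrix.mul_assoc, pow_succ', ← Matrix.mul_assoc]
    exact congrArg (· * _) ((h.isSNode k).darboux_step hl hz).symm

end IsAdmissible

namespace Realization

variable {m₁ m₂ n : ℕ} {T : Realization m₁ m₂ n} {X : Matrix (Fin n) (Fin n) ℂ}

lemma recP_mul_sig_mul (hX : X.IsHermitian) :
    T.recP X * sig m₁ m₂ * (T.recP X)ᴴ = X⁻¹ * (T.cᴴ * T.c) * X⁻¹ - T.b * T.bᴴ := by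
  simp only [recP, sig, conjTranspose_fromCols_eq_fromRows_conjTranspose, fromCols_mul_fromBlocks,
    Matrix.mul_one, Matrix.mul_zero, zero_add, add_zero, fromCols_mul_fromRows, conjTranspose_smul,
    conjTranspose_mul, conjTranspose_conjTranspose, hX.inv.eq, Matrix.smul_mul, Matrix.mul_smul,
    smul_smul, RCLike.star_def, Complex.conj_I, Matrix.mul_neg, Matrix.neg_mul, Matrix.mul_assoc]
  rw [neg_mul, Complex.I_mul_I, neg_neg, one_smul, ← sub_eq_add_neg]

lemma recAdmissible (hX : X.PosDef) (hR : T.Riccati X) (hdet : (T.recA X).det ≠ 0) :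
    T.RecAdmissible X := by
  refine ⟨hdet, hX.inv, ?_⟩
  have hXX := mul_nonsing_inv _ (isUnit_det_of_posDef hX)
  have hXX' := nonsing_inv_mul _ (isUnit_det_of_posDef hX)
  have hlyap := lyapunov_recA_self hX.1 hR
  rw [lyapunov_apply] at hlyap
  calc T.recA X * X⁻¹ - X⁻¹ * (T.recA X)ᴴ
      = Complex.I • (X⁻¹ * (Complex.I • ((T.recA X)ᴴ * X - X * T.recA X)) * X⁻¹) := by
        have hl : X⁻¹ * X * (T.recA X * X⁻¹) = T.recA X * X⁻¹ := by rw [hXX', Matrix.one_mul]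
        have hr : X⁻¹ * (T.recA X)ᴴ * (X * X⁻¹) = X⁻¹ * (T.recA X)ᴴ := by
          rw [hXX, Matrix.mul_one]
        simp only [Matrix.mul_smul, Matrix.smul_mul, smul_smul, Complex.I_mul_I, Matrix.mul_sub,
          Matrix.sub_mul, Matrix.mul_assoc] at hl hr ⊢
        rw [hl, hr, neg_one_smul, neg_sub]
    _ = Complex.I • (X⁻¹ * (T.cᴴ * T.c) * X⁻¹ - X⁻¹ * X * (T.b * T.bᴴ) * (X * X⁻¹)) := by
        rw [hlyap]
        simp only [Matrix.mul_sub, Matrix.sub_mul, Matrix.mul_assoc]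
    _ = Complex.I • (T.recP X * sig m₁ m₂ * (T.recP X)ᴴ) := by
        rw [hXX, hXX', Matrix.one_mul, Matrix.mul_one, recP_mul_sig_mul hX.1]

end Realization

/-! ### Weyl functions -/

section Summable

variable {ι : Type*}

lemma norm_apply_le_of_posSemidef {M : Matrix ι ι ℂ} (hM : M.PosSemidef) (i j : ι) :
    ‖M i j‖ ≤ (M i i).re + (M j j).re := by
  have hdet := (hM.submatrix ![i, j]).det_nonneg
  have hii := Complex.nonneg_iff.1 (hM.diag_nonneg (i := i))
  have hjj := Complex.nonneg_iff.1 (hM.diag_nonneg (i := j))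
  have hi : M i i = ((M i i).re : ℂ) := Complex.ext rfl hii.2.symm
  have hj : M j j = ((M j j).re : ℂ) := Complex.ext rfl hjj.2.symm
  rw [det_fin_two] at hdet
  simp only [submatrix_apply, cons_val_zero, cons_val_one] at hdet
  rw [← hM.1.apply j i, RCLike.star_def, mul_comm (M i j), ← Complex.normSq_eq_conj_mul_self, hi,
    hj, Complex.normSq_eq_norm_sq] at hdet
  have hsq : 0 ≤ (M i i).re * (M j j).re - ‖M i j‖ ^ 2 := by exact_mod_cast hdet
  exact le_of_sq_le_sq (by nlinarith [hii.1, hjj.1]) (add_nonneg hii.1 hjj.1)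

lemma summable_of_posSemidef {M : ℕ → Matrix ι ι ℂ}
    (hM : ∀ k, (M k).PosSemidef) {B : Matrix ι ι ℂ}
    (hB : ∀ r, (B - ∑ k ∈ Finset.range r, M k).PosSemidef) : Summable M := by
  have hdiag (i : ι) : Summable fun k => (M k i i).re := by
    refine summable_of_sum_range_le (c := (B i i).re) (fun k => ?_) (fun r => ?_)
    · exact (Complex.nonneg_iff.1 (hM k).diag_nonneg).1
    · have hle := (Complex.nonneg_iff.1 ((hB r).diag_nonneg (i := i))).1
      rw [Matrix.sub_apply, Matrix.sum_apply, Complex.sub_re, Complex.re_sum] at hle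
      linarith
  exact Pi.summable.2 fun i => Pi.summable.2 fun j =>
    .of_norm_bounded ((hdiag i).add (hdiag j)) fun k => norm_apply_le_of_posSemidef (hM k) i j

end Summable

section WeightedForm

variable {m₁ m₂ : ℕ} {ν : Type*} {C : ℕ → Matrix (Fin m₁ ⊕ Fin m₂) (Fin m₁ ⊕ Fin m₂) ℂ}
  {z : ℂ} {Φ : Matrix (Fin m₁ ⊕ Fin m₂) ν ℂ}

/-- The Hermitian form of `M` on the solution `W_k(z) Φ` of the Dirac system, with the weight
`(1 + |z|²)⁻ᵏ` of the Weyl series. -/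
noncomputable def weightedForm (C : ℕ → Matrix (Fin m₁ ⊕ Fin m₂) (Fin m₁ ⊕ Fin m₂) ℂ) (z : ℂ)
    (Φ : Matrix (Fin m₁ ⊕ Fin m₂) ν ℂ) (k : ℕ) (M : Matrix (Fin m₁ ⊕ Fin m₂) (Fin m₁ ⊕ Fin m₂) ℂ) :
    Matrix ν ν ℂ :=
  (((1 + ‖z‖ ^ 2)⁻¹ ^ k : ℝ) : ℂ) • ((fundSol C k z * Φ)ᴴ * M * (fundSol C k z * Φ))

/-- Convergence of the Weyl series of the solution with initial value `Φ`. -/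
def WeylSummable [Fintype ν] [DecidableEq ν]
    (C : ℕ → Matrix (Fin m₁ ⊕ Fin m₂) (Fin m₁ ⊕ Fin m₂) ℂ) (z : ℂ)
    (Φ : Matrix (Fin m₁ ⊕ Fin m₂) ν ℂ) : Prop :=
  Summable fun k => weightedForm C z Φ k (C k)

lemma isWeylFunction_iff {φ : ℂ → Matrix (Fin m₁) (Fin m₂) ℂ} :
    IsWeylFunction C φ ↔ ∀ z : ℂ, z.im < 0 → WeylSummable C z (fromRows (φ z) 1) := by
  simp only [IsWeylFunction, WeylSummable, weightedForm, conjTranspose_mul, Matrix.mul_assoc]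

lemma posSemidef_weightedForm [Finite ν] {M : Matrix (Fin m₁ ⊕ Fin m₂) (Fin m₁ ⊕ Fin m₂) ℂ}
    (hM : M.PosSemidef) (k : ℕ) : (weightedForm C z Φ k M).PosSemidef :=
  (hM.conjTranspose_mul_mul_same _).smul (Complex.zero_le_real.2 (by positivity))

lemma weightedForm_zero (M : Matrix (Fin m₁ ⊕ Fin m₂) (Fin m₁ ⊕ Fin m₂) ℂ) :
    weightedForm C z Φ 0 M = Φᴴ * M * Φ := by
  simp [weightedForm, fundSol]

lemma weightedForm_sub (k : ℕ) (M N : Matrix (Fin m₁ ⊕ Fin m₂) (Fin m₁ ⊕ Fin m₂) ℂ) :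
    weightedForm C z Φ k (M - N) = weightedForm C z Φ k M - weightedForm C z Φ k N := by
  simp only [weightedForm, Matrix.mul_sub, Matrix.sub_mul, smul_sub]

lemma IsDiracPotential.weightedForm_succ_sig (hC : IsDiracPotential C) (k : ℕ) :
    weightedForm C z Φ (k + 1) (sig m₁ m₂) = weightedForm C z Φ k (sig m₁ m₂) +
      ((-2 * z.im * (1 + ‖z‖ ^ 2)⁻¹ : ℝ) : ℂ) • weightedForm C z Φ k (C k) := by
  have hq : (1 + ‖z‖ ^ 2 : ℝ) ≠ 0 := by positivity
  have hconj := conj_one_add_smul sig_mul_sig conjTranspose_sig (hC k).1.1.eq z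
  rw [(hC k).2] at hconj
  set Y := fundSol C k z * Φ with hY
  calc weightedForm C z Φ (k + 1) (sig m₁ m₂)
      = (((1 + ‖z‖ ^ 2)⁻¹ ^ (k + 1) : ℝ) : ℂ) • (Yᴴ *
          ((1 + (Complex.I * z) • (sig m₁ m₂ * C k))ᴴ * sig m₁ m₂ *
            (1 + (Complex.I * z) • (sig m₁ m₂ * C k))) * Y) := by
        simp only [weightedForm, fundSol, hY, conjTranspose_mul, Matrix.mul_assoc]
    _ = (((1 + ‖z‖ ^ 2)⁻¹ ^ (k + 1) * (1 + ‖z‖ ^ 2) : ℝ) : ℂ) • (Yᴴ * sig m₁ m₂ * Y) +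
          (((1 + ‖z‖ ^ 2)⁻¹ ^ (k + 1) * (-2 * z.im) : ℝ) : ℂ) • (Yᴴ * C k * Y) := by
        rw [hconj]
        simp only [Matrix.mul_add, Matrix.add_mul, Matrix.mul_smul, Matrix.smul_mul]
        push_cast
        module
    _ = _ := by
        rw [pow_succ, mul_assoc, inv_mul_cancel₀ hq, mul_one, mul_assoc,
          mul_comm _ (-2 * z.im), mul_comm ((1 + ‖z‖ ^ 2)⁻¹ ^ k), Complex.ofReal_mul _ (_ ^ k),
          mul_smul]
        rfl

lemma IsDiracPotential.smul_sum_weightedForm (hC : IsDiracPotential C) (r : ℕ) :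
    ((-2 * z.im * (1 + ‖z‖ ^ 2)⁻¹ : ℝ) : ℂ) • ∑ k ∈ Finset.range r, weightedForm C z Φ k (C k) =
      weightedForm C z Φ r (sig m₁ m₂) - weightedForm C z Φ 0 (sig m₁ m₂) := by
  rw [Finset.smul_sum, ← Finset.sum_range_sub fun k => weightedForm C z Φ k (sig m₁ m₂)]
  exact Finset.sum_congr rfl fun k _ => by rw [hC.weightedForm_succ_sig, add_sub_cancel_left]

lemma IsDiracPotential.weylSummable [Fintype ν] [DecidableEq ν] (hC : IsDiracPotential C)
    (hz : z.im < 0) (hneg : ∀ r, (-weightedForm C z Φ r (sig m₁ m₂)).PosSemidef) :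
    WeylSummable C z Φ := by
  set c : ℝ := -2 * z.im * (1 + ‖z‖ ^ 2)⁻¹ with hc
  have hc0 : 0 < c := mul_pos (by linarith) (by positivity)
  have hc1 : ((c⁻¹ : ℝ) : ℂ) * (c : ℂ) = 1 := by
    rw [← Complex.ofReal_mul, inv_mul_cancel₀ hc0.ne', Complex.ofReal_one]
  refine summable_of_posSemidef (B := ((c⁻¹ : ℝ) : ℂ) • -weightedForm C z Φ 0 (sig m₁ m₂))
    (fun k => posSemidef_weightedForm (hC k).1.posSemidef k) fun r => ?_
  have hsum := congrArg (((c⁻¹ : ℝ) : ℂ) • ·) (hC.smul_sum_weightedForm (z := z) (Φ := Φ) r)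
  simp only [← hc, smul_smul, hc1, one_smul] at hsum
  rw [hsum, ← smul_sub, neg_sub_left, sub_add_cancel]
  exact (hneg r).smul (Complex.zero_le_real.2 (inv_nonneg.2 hc0.le))

end WeightedForm

section Existence

variable {m₁ m₂ n : ℕ}

lemma im_neg_one_div_neg {z : ℂ} (hz : z.im < 0) : (-1 / z).im < 0 := by
  have hz0 : z ≠ 0 := by rintro rfl; simp at hz
  rw [neg_div, one_div, Complex.neg_im, Complex.inv_im, neg_div, neg_neg]
  exact div_neg_of_neg_of_pos hz (Complex.normSq_pos.2 hz0)

/-- The first `m₁` columns of the identity matrix, which span the eigenspace of `j` for `1`. -/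
noncomputable def posColumns (m₁ m₂ : ℕ) : Matrix (Fin m₁ ⊕ Fin m₂) (Fin m₁) ℂ :=
  fromRows 1 0

/-- The last `m₂` columns of the identity matrix, which span the eigenspace of `j` for `-1`. -/
noncomputable def negColumns (m₁ m₂ : ℕ) : Matrix (Fin m₁ ⊕ Fin m₂) (Fin m₂) ℂ :=
  fromRows 0 1

lemma sig_mul_negColumns : sig m₁ m₂ * negColumns m₁ m₂ = (-1 : ℂ) • negColumns m₁ m₂ := by
  ext (i | i) j <;> simp [sig, negColumns, fromBlocks_mul_fromRows]

lemma conjTranspose_negColumns_mul_self : (negColumns m₁ m₂)ᴴ * negColumns m₁ m₂ = 1 := by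
  simp [negColumns, conjTranspose_fromRows_eq_fromCols_conjTranspose, fromCols_mul_fromRows]

lemma conj_sig_negColumns_mul {ν : Type*} (E : Matrix (Fin m₂) ν ℂ) :
    -((negColumns m₁ m₂ * E)ᴴ * sig m₁ m₂ * (negColumns m₁ m₂ * E)) = Eᴴ * E := by
  rw [Matrix.mul_assoc, ← Matrix.mul_assoc (sig m₁ m₂), sig_mul_negColumns, conjTranspose_mul,
    Matrix.smul_mul, Matrix.mul_smul, Matrix.mul_assoc Eᴴ, ← Matrix.mul_assoc _ _ E,
    conjTranspose_negColumns_mul_self, Matrix.one_mul, neg_one_smul, neg_neg]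

section Eigencolumns

variable {κ ν : Type*} [Fintype κ] [DecidableEq κ] {J : Matrix κ κ ℂ}

lemma one_add_smul_pow_mul {s : ℂ} {E : Matrix κ ν ℂ} (hE : J * E = s • E) (c : ℂ) (k : ℕ) :
    (1 + c • J) ^ k * E = (1 + c * s) ^ k • E := by
  induction k with
  | zero => simp
  | succ k ih =>
    rw [pow_succ, Matrix.mul_assoc, Matrix.add_mul, Matrix.one_mul, Matrix.smul_mul, hE,
      smul_smul, Matrix.mul_add, Matrix.mul_smul, ih]
    module

lemma IsSNode.posSemidef_neg_conj_darboux {ι : Type*} [Fintype ι] [DecidableEq ι] [Finite ν]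
    {A S : Matrix ι ι ℂ} {P : Matrix ι κ ℂ} (h : IsSNode J A S P) {l : ℂ}
    (hl : l ∉ spectrum ℂ A) (hl0 : l.im ≤ 0) {Φ : Matrix κ ν ℂ}
    (hΦ : (-(Φᴴ * J * Φ)).PosSemidef) :
    (-((darboux J A S P l * Φ)ᴴ * J * (darboux J A S P l * Φ))).PosSemidef := by
  set Q := (A - l • 1)⁻¹ * P with hQ
  have hconj : -((darboux J A S P l * Φ)ᴴ * J * (darboux J A S P l * Φ)) =
      -(Φᴴ * J * Φ) + ((-(2 * l.im) : ℝ) : ℂ) • (Φᴴ * (Qᴴ * S⁻¹ * Q) * Φ) := by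
    calc -((darboux J A S P l * Φ)ᴴ * J * (darboux J A S P l * Φ))
        = -(Φᴴ * ((darboux J A S P l)ᴴ * J * darboux J A S P l) * Φ) := by
          simp only [conjTranspose_mul, Matrix.mul_assoc]
      _ = _ := by
          rw [h.darboux_conj hl, ← hQ, Matrix.mul_add, Matrix.add_mul, Matrix.mul_smul,
            Matrix.smul_mul, neg_add, ← neg_smul, ← Complex.ofReal_neg]
  rw [hconj]
  exact hΦ.add (((h.posDef.inv.posSemidef.conjTranspose_mul_mul_same _).conjTranspose_mul_mul_same
    _).smul (Complex.zero_le_real.2 (by linarith)))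

end Eigencolumns

namespace Realization

variable {T : Realization m₁ m₂ n} {X : Matrix (Fin n) (Fin n) ℂ}

lemma resolvent_recA_mul {l : ℂ} (hl : l ∉ spectrum ℂ T.a) (hl' : l ∉ spectrum ℂ (T.recA X)) :
    (T.recA X - l • 1)⁻¹ *
      (T.b * (1 + Complex.I • (T.bᴴ * X * ((l • 1 - T.a)⁻¹ * T.b)))) =
        -((l • 1 - T.a)⁻¹ * T.b) := by
  set R := (l • 1 - T.a)⁻¹ * T.b with hR
  have hb : (l • 1 - T.a) * R = T.b := by
    rw [hR, ← Matrix.mul_assoc, mul_nonsing_inv _ (isUnit_det_of_notMem_spectrum hl),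
      Matrix.one_mul]
  have hmul : T.b * (1 + Complex.I • (T.bᴴ * X * R)) = (T.recA X - l • 1) * -R := by
    rw [recA, Matrix.mul_add, Matrix.mul_one]
    simp only [Matrix.sub_mul, Matrix.smul_mul, Matrix.one_mul, Matrix.mul_smul,
      Matrix.mul_neg, Matrix.mul_assoc] at hb ⊢
    linear_combination (norm := module) -hb
  rw [hmul, ← Matrix.mul_assoc, nonsing_inv_mul _ (isUnit_det_sub_of_notMem_spectrum hl'),
    Matrix.one_mul]

lemma conjTranspose_recP_mul (hX : X.PosDef) :
    (T.recP X)ᴴ * X = fromRows (-Complex.I • T.c) (T.bᴴ * X) := by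
  rw [recP, conjTranspose_fromCols_eq_fromRows_conjTranspose, fromRows_mul, conjTranspose_smul,
    conjTranspose_mul, conjTranspose_conjTranspose, hX.inv.1.eq, Matrix.smul_mul,
    Matrix.mul_assoc, nonsing_inv_mul _ (isUnit_det_of_posDef hX), Matrix.mul_one,
    RCLike.star_def, Complex.conj_I]

lemma recP_mul_negColumns : T.recP X * negColumns m₁ m₂ = T.b := by
  simp [recP, negColumns, fromCols_mul_fromRows]

lemma darboux_mul_negColumns (hX : X.PosDef) {l : ℂ} (hl : l ∉ spectrum ℂ T.a)
    (hl' : l ∉ spectrum ℂ (T.recA X)) :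
    darboux (sig m₁ m₂) (T.recA X) X⁻¹ (T.recP X) l *
        (negColumns m₁ m₂ * (1 + Complex.I • (T.bᴴ * X * ((l • 1 - T.a)⁻¹ * T.b)))) =
      fromRows (T.transfer l) 1 := by
  set R := (l • 1 - T.a)⁻¹ * T.b with hR
  set D := 1 + Complex.I • (T.bᴴ * X * R) with hD
  have hres : (T.recA X - l • 1)⁻¹ * (T.recP X * (negColumns m₁ m₂ * D)) = -R := by
    rw [← Matrix.mul_assoc (T.recP X), recP_mul_negColumns, resolvent_recA_mul hl hl']
  calc darboux (sig m₁ m₂) (T.recA X) X⁻¹ (T.recP X) l * (negColumns m₁ m₂ * D)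
      = negColumns m₁ m₂ * D - Complex.I • (sig m₁ m₂ * ((T.recP X)ᴴ * X *
          ((T.recA X - l • 1)⁻¹ * (T.recP X * (negColumns m₁ m₂ * D))))) := by
        rw [darboux, gain, nonsing_inv_nonsing_inv _ (isUnit_det_of_posDef hX)]
        simp only [Matrix.sub_mul, Matrix.one_mul, Matrix.smul_mul, Matrix.mul_assoc]
    _ = negColumns m₁ m₂ * D +
          Complex.I • fromRows (-Complex.I • (T.c * R)) (-(T.bᴴ * X * R)) := by
        rw [hres, conjTranspose_recP_mul hX, fromRows_mul, Matrix.mul_neg, Matrix.mul_neg, sig,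
          fromBlocks_mul_fromRows]
        ext (i | i) j <;> simp [sub_eq_add_neg]
    _ = fromRows (T.transfer l) 1 := by
        rw [transfer, Matrix.mul_assoc T.c, ← hR, hD, negColumns, fromRows_mul]
        ext (i | i) j <;> simp [← mul_assoc]

theorem isWeylFunction_recC (hT : T ∈ classG m₁ m₂ n) (hX : T.IsSpectralSolution X)
    (hadm : T.RecAdmissible X) : IsWeylFunction (T.recC X) (fun z => T.transfer (-1 / z)) := by
  refine isWeylFunction_iff.2 fun z hz => ?_
  have hl0 := im_neg_one_div_neg hz
  set l := -1 / z with hl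
  have hzl : z * l = -1 := mul_div_cancel₀ (-1) (by rintro rfl; simp at hz)
  have hla : l ∉ spectrum ℂ T.a := notMem_spectrum_of_im_nonpos hT hl0.le
  have hlA : l ∉ spectrum ℂ (T.recA X) := fun hmem =>
    absurd (hX.spectrum_subset hmem : 0 ≤ l.im) hl0.not_ge
  have hpot : IsDiracPotential (T.recC X) := hadm.isDiracPotential
  refine hpot.weylSummable hz fun r => ?_
  set D := 1 + Complex.I • (T.bᴴ * X * ((l • 1 - T.a)⁻¹ * T.b))
  have hsol : fundSol (T.recC X) r z * fromRows (T.transfer l) (1 : Matrix (Fin m₂) (Fin m₂) ℂ) =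
      darboux (sig m₁ m₂) (T.recA X) (seqS (T.recA X) X⁻¹ (T.recP X) r)
        (seqP (T.recA X) (T.recP X) r) l *
        (negColumns m₁ m₂ * ((1 + Complex.I * z * -1) ^ r • D)) := by
    rw [← darboux_mul_negColumns hX.posDef hla hlA, ← Matrix.mul_assoc, recC,
      hadm.fundSol_mul_darboux hlA hzl, Matrix.mul_assoc,
      ← Matrix.mul_assoc (_ ^ r) (negColumns _ _),
      one_add_smul_pow_mul sig_mul_negColumns, Matrix.smul_mul, Matrix.mul_smul,
      Matrix.mul_smul, Matrix.mul_smul]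
  rw [weightedForm, hsol, ← smul_neg]
  refine ((hadm.isSNode r).posSemidef_neg_conj_darboux hlA hl0.le ?_).smul
    (Complex.zero_le_real.2 (by positivity))
  rw [conj_sig_negColumns_mul]
  exact posSemidef_conjTranspose_mul_self _

end Realization

end Existence

/-! ### Uniqueness of the potential -/

section Signature

variable {κ : Type*} [Fintype κ] {C J : Matrix κ κ ℂ}

lemma mul_eq_zero_of_conj_eq_zero {ν : Type*} (hC : C.PosSemidef) {M : Matrix κ ν ℂ}
    (h : Mᴴ * C * M = 0) : C * M = 0 := by
  obtain ⟨B, rfl⟩ : ∃ B : Matrix κ κ ℂ, C = Bᴴ * B := by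
    classical
    open scoped MatrixOrder in
    exact CStarAlgebra.nonneg_iff_eq_star_mul_self.mp hC.nonneg
  have hBM : (B * M)ᴴ * (B * M) = 0 := by
    rw [← h, conjTranspose_mul]
    simp only [Matrix.mul_assoc]
  rw [Matrix.mul_assoc, conjTranspose_mul_self_eq_zero.1 hBM, Matrix.mul_zero]

variable [DecidableEq κ]

lemma posSemidef_add_of_mul_mul_eq (hJ : J * J = 1) (hJH : Jᴴ = J) (hC : C.PosSemidef)
    (h : C * J * C = J) : (C + J).PosSemidef := by
  -- `C + J = (C + J) (J C J) (C + J) / 2`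
  have hJCJ := hC.conjTranspose_mul_mul_same J
  rw [hJH] at hJCJ
  have hhalf := (hJCJ.conjTranspose_mul_mul_same (C + J)).smul
    (Complex.zero_le_real.2 (by norm_num : (0 : ℝ) ≤ 1 / 2))
  have hJmul (M : Matrix κ κ ℂ) : J * (J * M) = M := by
    rw [← Matrix.mul_assoc, hJ, Matrix.one_mul]
  have hCJC : C * (J * C) = J := by rw [← Matrix.mul_assoc, h]
  have hCJCmul (M : Matrix κ κ ℂ) : C * (J * (C * M)) = J * M := by
    rw [← Matrix.mul_assoc, ← Matrix.mul_assoc, h]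
  convert hhalf using 1
  rw [conjTranspose_add, hJH, hC.1.eq]
  simp only [Matrix.mul_add, Matrix.add_mul, Matrix.mul_assoc, hJmul, hCJC, hCJCmul, hJ,
    Matrix.mul_one, Matrix.one_mul]
  push_cast
  module

lemma posSemidef_sub_of_mul_mul_eq (hJ : J * J = 1) (hJH : Jᴴ = J) (hC : C.PosSemidef)
    (h : C * J * C = J) : (C - J).PosSemidef := by
  rw [sub_eq_add_neg]
  exact posSemidef_add_of_mul_mul_eq (by rwa [neg_mul_neg]) (by rw [conjTranspose_neg, hJH]) hC
    (by rw [Matrix.mul_neg, Matrix.neg_mul, h])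

end Signature

section Eigenspace

variable {m₁ m₂ : ℕ} {ν : Type*} {C C' : Matrix (Fin m₁ ⊕ Fin m₂) (Fin m₁ ⊕ Fin m₂) ℂ}

lemma conj_sig (Φ : Matrix (Fin m₁ ⊕ Fin m₂) ν ℂ) :
    Φᴴ * sig m₁ m₂ * Φ = Φ.toRows₁ᴴ * Φ.toRows₁ - Φ.toRows₂ᴴ * Φ.toRows₂ := by
  conv_lhs => rw [← fromRows_toRows Φ]
  rw [Matrix.mul_assoc, sig, fromBlocks_mul_fromRows,
    conjTranspose_fromRows_eq_fromCols_conjTranspose, fromCols_mul_fromRows]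
  simp [sub_eq_add_neg]

lemma conj_eq_of_mul_eq {Φ : Matrix (Fin m₁ ⊕ Fin m₂) ν ℂ} (h : C * Φ = -(sig m₁ m₂ * Φ)) :
    Φᴴ * C * Φ = Φ.toRows₂ᴴ * Φ.toRows₂ - Φ.toRows₁ᴴ * Φ.toRows₁ := by
  rw [Matrix.mul_assoc, h, Matrix.mul_neg, ← Matrix.mul_assoc, conj_sig, neg_sub]

variable [Finite ν]

lemma eq_zero_of_toRows₂_eq_zero (hC : C.PosDef) {Ψ : Matrix (Fin m₁ ⊕ Fin m₂) ν ℂ}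
    (h : C * Ψ = -(sig m₁ m₂ * Ψ)) (h₂ : Ψ.toRows₂ = 0) : Ψ = 0 := by
  have hconj := conj_eq_of_mul_eq h
  rw [h₂, Matrix.mul_zero, zero_sub] at hconj
  have hzero : Ψᴴ * C * Ψ = 0 :=
    eq_zero_of_posSemidef_neg (hC.posSemidef.conjTranspose_mul_mul_same Ψ) <| by
      rw [hconj, neg_neg]
      exact posSemidef_conjTranspose_mul_self _
  rw [← nonsing_inv_mul_cancel_left C Ψ (isUnit_det_of_posDef hC),
    mul_eq_zero_of_conj_eq_zero hC.posSemidef hzero, Matrix.mul_zero]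

variable {Φ : Matrix (Fin m₁ ⊕ Fin m₂) (Fin m₂) ℂ}

lemma isUnit_det_toRows₂ (hC : C.PosDef) (hΦ : Function.Injective Φ.mulVec)
    (h : C * Φ = -(sig m₁ m₂ * Φ)) : IsUnit Φ.toRows₂.det := by
  have hpos : (Φ.toRows₂ᴴ * Φ.toRows₂).PosDef := by
    rw [← sub_add_cancel (Φ.toRows₂ᴴ * Φ.toRows₂) (Φ.toRows₁ᴴ * Φ.toRows₁), ← conj_eq_of_mul_eq h]
    exact (hC.conjTranspose_mul_mul_same hΦ).add_posSemidef (posSemidef_conjTranspose_mul_self _)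
  have hdet := isUnit_det_of_posDef hpos
  rw [det_mul] at hdet
  exact isUnit_of_mul_isUnit_right hdet

lemma eq_mul_of_mul_eq (hC : C.PosDef) (hΦ : Function.Injective Φ.mulVec)
    (h : C * Φ = -(sig m₁ m₂ * Φ)) {U : Matrix (Fin m₁ ⊕ Fin m₂) ν ℂ}
    (hU : C * U = -(sig m₁ m₂ * U)) : U = Φ * (Φ.toRows₂⁻¹ * U.toRows₂) := by
  refine sub_eq_zero.1 (eq_zero_of_toRows₂_eq_zero hC ?_ ?_)
  · rw [Matrix.mul_sub, Matrix.mul_sub, hU, ← Matrix.mul_assoc, h, ← Matrix.mul_assoc (sig m₁ m₂),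
      Matrix.neg_mul]
    abel
  · change U.toRows₂ - Φ.toRows₂ * (Φ.toRows₂⁻¹ * U.toRows₂) = 0
    rw [mul_nonsing_inv_cancel_left _ _ (isUnit_det_toRows₂ hC hΦ h), sub_self]

lemma mul_sig_mul_eq (hC' : C'.PosDef) (hCJ' : C' * sig m₁ m₂ * C' = sig m₁ m₂)
    (hΦ : Function.Injective Φ.mulVec) (h : C * Φ = -(sig m₁ m₂ * Φ))
    (h' : C' * Φ = -(sig m₁ m₂ * Φ)) : C * sig m₁ m₂ * C' = C + sig m₁ m₂ - C' := by
  have hsig : sig m₁ m₂ * (1 - sig m₁ m₂ * C') = sig m₁ m₂ - C' := by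
    rw [Matrix.mul_sub, Matrix.mul_one, ← Matrix.mul_assoc, sig_mul_sig, Matrix.one_mul]
  have hmul' : C' * (1 - sig m₁ m₂ * C') = -(sig m₁ m₂ * (1 - sig m₁ m₂ * C')) := by
    rw [hsig, Matrix.mul_sub, Matrix.mul_one, ← Matrix.mul_assoc, hCJ', neg_sub]
  have hmul : C * (1 - sig m₁ m₂ * C') = -(sig m₁ m₂ * (1 - sig m₁ m₂ * C')) := by
    rw [eq_mul_of_mul_eq hC' hΦ h' hmul', ← Matrix.mul_assoc, h, ← Matrix.mul_assoc (sig m₁ m₂),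
      Matrix.neg_mul]
  rw [hsig, Matrix.mul_sub, Matrix.mul_one, ← Matrix.mul_assoc] at hmul
  rw [← sub_eq_zero, ← neg_eq_zero, ← sub_eq_zero.2 hmul]
  abel

/- `C j C' = C + j - C'` and, exchanging the roles of `C` and `C'` and taking adjoints,
`C j C' = C' + j - C`. -/
lemma eq_of_mul_eq_neg_sig_mul (hC : C.PosDef) (hCJ : C * sig m₁ m₂ * C = sig m₁ m₂)
    (hC' : C'.PosDef) (hCJ' : C' * sig m₁ m₂ * C' = sig m₁ m₂) (hΦ : Function.Injective Φ.mulVec)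
    (h : C * Φ = -(sig m₁ m₂ * Φ)) (h' : C' * Φ = -(sig m₁ m₂ * Φ)) : C = C' := by
  have hprod := mul_sig_mul_eq hC' hCJ' hΦ h h'
  have hprod' := congrArg conjTranspose (mul_sig_mul_eq hC hCJ hΦ h' h)
  rw [conjTranspose_mul, conjTranspose_mul, conjTranspose_sub, conjTranspose_add, conjTranspose_sig,
    hC.1.eq, hC'.1.eq, ← Matrix.mul_assoc, hprod] at hprod'
  linear_combination (norm := module) (1 / 2 : ℂ) • hprod'

end Eigenspace

section Uniqueness

variable {m₁ m₂ : ℕ} {C : ℕ → Matrix (Fin m₁ ⊕ Fin m₂) (Fin m₁ ⊕ Fin m₂) ℂ}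

section Shift

variable {ν : Type*} {z : ℂ} {Φ : Matrix (Fin m₁ ⊕ Fin m₂) ν ℂ}

lemma fundSol_succ_eq (C : ℕ → Matrix (Fin m₁ ⊕ Fin m₂) (Fin m₁ ⊕ Fin m₂) ℂ) (k : ℕ) (z : ℂ) :
    fundSol C (k + 1) z =
      fundSol (fun r => C (r + 1)) k z * (1 + (Complex.I * z) • (sig m₁ m₂ * C 0)) := by
  induction k with
  | zero => simp [fundSol]
  | succ k ih => rw [fundSol, ih, ← Matrix.mul_assoc]; rfl

lemma weightedForm_shift (c : ℂ) (k : ℕ) (M : Matrix (Fin m₁ ⊕ Fin m₂) (Fin m₁ ⊕ Fin m₂) ℂ) :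
    weightedForm (fun r => C (r + 1)) z (c • ((1 + (Complex.I * z) • (sig m₁ m₂ * C 0)) * Φ)) k M =
      (star c * c * ((1 + ‖z‖ ^ 2 : ℝ) : ℂ)) • weightedForm C z Φ (k + 1) M := by
  have hq : (1 + ‖z‖ ^ 2) * (1 + ‖z‖ ^ 2)⁻¹ ^ (k + 1) = (1 + ‖z‖ ^ 2)⁻¹ ^ k := by
    rw [pow_succ' _ k, ← mul_assoc, mul_inv_cancel₀ (by positivity), one_mul]
  rw [weightedForm, weightedForm, fundSol_succ_eq, smul_smul, mul_assoc, ← Complex.ofReal_mul, hq,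
    Matrix.mul_smul, conjTranspose_smul, Matrix.smul_mul, Matrix.smul_mul, Matrix.mul_smul,
    ← Matrix.mul_assoc (fundSol _ k z)]
  module

variable [Fintype ν] [DecidableEq ν]

lemma WeylSummable.shift (h : WeylSummable C z Φ) (c : ℂ) :
    WeylSummable (fun k => C (k + 1)) z
      (c • ((1 + (Complex.I * z) • (sig m₁ m₂ * C 0)) * Φ)) :=
  (((summable_nat_add_iff 1).2 h).const_smul _).congr fun k => (weightedForm_shift c k _).symm

lemma IsDiracPotential.posSemidef_of_weylSummable (hC : IsDiracPotential C) (hz : z.im < 0)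
    (hΦ : WeylSummable C z Φ) :
    (-(Φᴴ * (((1 + ‖z‖ ^ 2 : ℝ) : ℂ) • sig m₁ m₂ + ((-2 * z.im : ℝ) : ℂ) • C 0) *
      Φ)).PosSemidef := by
  set e : ℕ → Matrix ν ν ℂ := fun k => weightedForm C z Φ k (sig m₁ m₂) with he
  set t : ℕ → Matrix ν ν ℂ := fun k => weightedForm C z Φ k (C k) with ht
  have hq : (0 : ℝ) < 1 + ‖z‖ ^ 2 := by positivity
  have ha : 0 < -2 * z.im := by linarith
  have hstep (k : ℕ) : e (k + 1) = e k + ((-2 * z.im * (1 + ‖z‖ ^ 2)⁻¹ : ℝ) : ℂ) • t k :=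
    hC.weightedForm_succ_sig k
  have hmono (k : ℕ) : (e (k + 1) - e 1).PosSemidef := by
    induction k with
    | zero => rw [sub_self]; exact .zero
    | succ k ih =>
      rw [hstep (k + 1), add_sub_right_comm]
      exact ih.add ((posSemidef_weightedForm (hC _).1.posSemidef _).smul
        (Complex.zero_le_real.2 (by positivity)))
  have hle (k : ℕ) : (t k - e k).PosSemidef := by
    rw [ht, he, ← weightedForm_sub]
    exact posSemidef_weightedForm (posSemidef_sub_of_mul_mul_eq sig_mul_sig conjTranspose_sig
      (hC k).1.posSemidef (hC k).2) k
  have hlim : Tendsto (fun k => t (k + 1) - e 1) atTop (𝓝 (0 - e 1)) :=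
    ((tendsto_add_atTop_iff_nat 1).2 hΦ.tendsto_atTop_zero).sub tendsto_const_nhds
  have hpos (k : ℕ) : (t (k + 1) - e 1).PosSemidef := by
    simpa only [sub_add_sub_cancel] using (hle (k + 1)).add (hmono k)
  have hneg : (0 - e 1).PosSemidef :=
    isClosed_setOf_posSemidef.mem_of_tendsto hlim (Eventually.of_forall hpos)
  have hcancel : (1 + ‖z‖ ^ 2) * (-2 * z.im * (1 + ‖z‖ ^ 2)⁻¹) = -2 * z.im := by field_simp
  convert hneg.smul (Complex.zero_le_real.2 hq.le) using 1
  rw [zero_sub, hstep 0, smul_neg, smul_add, smul_smul, ← Complex.ofReal_mul, hcancel]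
  simp only [he, ht]
  rw [weightedForm_zero, weightedForm_zero, Matrix.mul_add, Matrix.add_mul, Matrix.mul_smul,
    Matrix.mul_smul, Matrix.smul_mul, Matrix.smul_mul]

end Shift

/-- A potential together with a holomorphic family of initial values of full rank at `-i` whose
Weyl series converge away from `-i`. The first matrix `C 0` can be read off at `-i`, and
`IsWeylFamily.next` passes to the potential shifted by one. -/
structure IsWeylFamily (C : ℕ → Matrix (Fin m₁ ⊕ Fin m₂) (Fin m₁ ⊕ Fin m₂) ℂ)
    (Φ : ℂ → Matrix (Fin m₁ ⊕ Fin m₂) (Fin m₂) ℂ) : Prop where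
  potential : IsDiracPotential C
  differentiableOn : DifferentiableOn ℂ Φ {z | z.im < 0}
  injective : Function.Injective (Φ (-Complex.I)).mulVec
  summable : ∀ z : ℂ, z.im < 0 → z ≠ -Complex.I → WeylSummable C z (Φ z)

lemma isOpen_lowerHalfPlane : IsOpen {z : ℂ | z.im < 0} :=
  isOpen_lt Complex.continuous_im continuous_const

lemma lowerHalfPlane_mem_nhds : {z : ℂ | z.im < 0} ∈ 𝓝 (-Complex.I) :=
  isOpen_lowerHalfPlane.mem_nhds (by simp)

namespace IsWeylFamily

variable {Φ : ℂ → Matrix (Fin m₁ ⊕ Fin m₂) (Fin m₂) ℂ}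

lemma posSemidef_neg_conj (h : IsWeylFamily C Φ) :
    (-((Φ (-Complex.I))ᴴ * (C 0 + sig m₁ m₂) * Φ (-Complex.I))).PosSemidef := by
  have hΦ : ContinuousAt Φ (-Complex.I) :=
    (h.differentiableOn.differentiableAt lowerHalfPlane_mem_nhds).continuousAt
  have hcont : ContinuousAt (fun z => -((Φ z)ᴴ * (((1 + ‖z‖ ^ 2 : ℝ) : ℂ) • sig m₁ m₂ +
      ((-2 * z.im : ℝ) : ℂ) • C 0) * Φ z)) (-Complex.I) := by
    fun_prop
  have hlim := hcont.tendsto.mono_left (nhdsWithin_le_nhds (s := {-Complex.I}ᶜ))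
  have hpos : Matrix.PosSemidef _ := isClosed_setOf_posSemidef.mem_of_tendsto hlim <| by
    filter_upwards [self_mem_nhdsWithin, mem_nhdsWithin_of_mem_nhds lowerHalfPlane_mem_nhds]
      with z hne hz
    exact h.potential.posSemidef_of_weylSummable hz (h.summable z hz hne)
  convert hpos.smul (Complex.zero_le_real.2 (by norm_num : (0 : ℝ) ≤ 1 / 2)) using 1
  simp only [norm_neg, Complex.norm_I, Complex.neg_im, Complex.I_im, Matrix.mul_add,
    Matrix.add_mul, Matrix.mul_smul, Matrix.smul_mul]
  push_cast
  module

lemma mul_eq (h : IsWeylFamily C Φ) :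
    C 0 * Φ (-Complex.I) = -(sig m₁ m₂ * Φ (-Complex.I)) := by
  have hpos := posSemidef_add_of_mul_mul_eq sig_mul_sig conjTranspose_sig
    (h.potential 0).1.posSemidef (h.potential 0).2
  have hzero := mul_eq_zero_of_conj_eq_zero hpos <| eq_zero_of_posSemidef_neg
    (hpos.conjTranspose_mul_mul_same (Φ (-Complex.I))) h.posSemidef_neg_conj
  rw [Matrix.add_mul] at hzero
  exact eq_neg_of_add_eq_zero_left hzero

lemma sig_mul_mul_eq (h : IsWeylFamily C Φ) :
    sig m₁ m₂ * C 0 * Φ (-Complex.I) = -Φ (-Complex.I) := by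
  rw [Matrix.mul_assoc, h.mul_eq, Matrix.mul_neg, ← Matrix.mul_assoc, sig_mul_sig, Matrix.one_mul]

lemma hasDerivAt_one_add_smul_mul (M : Matrix (Fin m₁ ⊕ Fin m₂) (Fin m₁ ⊕ Fin m₂) ℂ)
    {Φ' : Matrix (Fin m₁ ⊕ Fin m₂) (Fin m₂) ℂ} {z : ℂ} (h : HasDerivAt Φ Φ' z) :
    HasDerivAt (fun w => (1 + (Complex.I * w) • M) * Φ w)
      (Φ' + ((Complex.I * z) • (M * Φ') + Complex.I • (M * Φ z))) z := by
  have hmul : HasDerivAt (fun w => M * Φ w) (M * Φ') z :=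
    (mulLeftLinearMap (Fin m₂) ℂ M).toContinuousLinearMap.hasFDerivAt.comp_hasDerivAt z h
  have hlin : HasDerivAt (fun w : ℂ => Complex.I * w) Complex.I z := by
    simpa using (hasDerivAt_id z).const_mul Complex.I
  simpa only [Matrix.add_mul, Matrix.one_mul, Matrix.smul_mul] using! h.add (hlin.smul hmul)

/- With `F z = (1 + i z j C₀) Φ z` and `(j C₀)² = 1`, the derivative of `F` at `-i` satisfies
`(1 - j C₀) F' = -2 i Φ`. -/
lemma injective_deriv_mulVec (h : IsWeylFamily C Φ) :
    Function.Injective (deriv (fun w => (1 + (Complex.I * w) • (sig m₁ m₂ * C 0)) * Φ w)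
      (-Complex.I)).mulVec := by
  have hF := (hasDerivAt_one_add_smul_mul (sig m₁ m₂ * C 0)
    (h.differentiableOn.differentiableAt lowerHalfPlane_mem_nhds).hasDerivAt).deriv
  have hI : Complex.I * -Complex.I = 1 := by rw [mul_neg, Complex.I_mul_I, neg_neg]
  have hsq (M : Matrix (Fin m₁ ⊕ Fin m₂) (Fin m₂) ℂ) :
      sig m₁ m₂ * C 0 * (sig m₁ m₂ * C 0 * M) = M := by
    rw [← Matrix.mul_assoc, Matrix.mul_assoc (sig m₁ m₂), ← Matrix.mul_assoc (C 0),
      (h.potential 0).2, sig_mul_sig, Matrix.one_mul]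
  set F := fun w => (1 + (Complex.I * w) • (sig m₁ m₂ * C 0)) * Φ w
  have hmul : (1 - sig m₁ m₂ * C 0) * deriv F (-Complex.I) =
      (-2 * Complex.I) • Φ (-Complex.I) := by
    rw [hF, h.sig_mul_mul_eq, hI, one_smul, Matrix.sub_mul, Matrix.one_mul, Matrix.mul_add,
      Matrix.mul_add, hsq, Matrix.mul_smul, Matrix.mul_neg, h.sig_mul_mul_eq]
    module
  refine Function.Injective.of_comp (f := (1 - sig m₁ m₂ * C 0).mulVec) fun x y hxy => ?_
  simp only [Function.comp_apply, mulVec_mulVec, hmul, smul_mulVec] at hxy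
  exact h.injective (smul_right_injective _ (by simp) hxy)

lemma next (h : IsWeylFamily C Φ) :
    IsWeylFamily (fun k => C (k + 1))
      (dslope (fun w => (1 + (Complex.I * w) • (sig m₁ m₂ * C 0)) * Φ w) (-Complex.I)) where
  potential k := h.potential (k + 1)
  differentiableOn := by
    rw [Complex.differentiableOn_dslope lowerHalfPlane_mem_nhds]
    intro z hz
    exact (hasDerivAt_one_add_smul_mul _ (h.differentiableOn.differentiableAt
      (isOpen_lowerHalfPlane.mem_nhds hz)).hasDerivAt).differentiableAt.differentiableWithinAt
  injective := by
    rw [dslope_same]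
    exact h.injective_deriv_mulVec
  summable z hz hne := by
    have hzero : (1 + (Complex.I * -Complex.I) • (sig m₁ m₂ * C 0)) * Φ (-Complex.I) = 0 := by
      rw [mul_neg, Complex.I_mul_I, neg_neg, one_smul, Matrix.add_mul, Matrix.one_mul,
        h.sig_mul_mul_eq, add_neg_cancel]
    rw [dslope_of_ne _ hne, slope, hzero, vsub_eq_sub, sub_zero]
    exact (h.summable z hz hne).shift _

lemma apply_zero_eq {C' : ℕ → Matrix (Fin m₁ ⊕ Fin m₂) (Fin m₁ ⊕ Fin m₂) ℂ}
    (h : IsWeylFamily C Φ) (h' : IsWeylFamily C' Φ) : C 0 = C' 0 :=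
  eq_of_mul_eq_neg_sig_mul (h.potential 0).1 (h.potential 0).2 (h'.potential 0).1
    (h'.potential 0).2 h.injective h.mul_eq h'.mul_eq

lemma potential_unique {C' : ℕ → Matrix (Fin m₁ ⊕ Fin m₂) (Fin m₁ ⊕ Fin m₂) ℂ}
    (h : IsWeylFamily C Φ) (h' : IsWeylFamily C' Φ) (k : ℕ) : C k = C' k := by
  induction k generalizing C C' Φ with
  | zero => exact h.apply_zero_eq h'
  | succ _ ih =>
    have hnext' := h'.next
    rw [← h.apply_zero_eq h'] at hnext'
    exact ih h.next hnext'

end IsWeylFamily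

namespace Realization

variable {n : ℕ}

lemma differentiableOn_fromRows_transfer {T : Realization m₁ m₂ n} (hT : T ∈ classG m₁ m₂ n) :
    DifferentiableOn ℂ (fun z => fromRows (T.transfer (-1 / z)) (1 : Matrix (Fin m₂) (Fin m₂) ℂ))
      {z | z.im < 0} := by
  intro z (hz : z.im < 0)
  have hz0 : z ≠ 0 := by rintro rfl; simp at hz
  have hcomp : DifferentiableAt ℂ (fun z : ℂ => T.transfer (-1 / z)) z :=
    DifferentiableAt.comp (f := fun z : ℂ => -1 / z) z
      (T.differentiableAt_transfer (notMem_spectrum_of_im_nonpos hT (im_neg_one_div_neg hz).le))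
      ((differentiableAt_const _).div differentiableAt_id hz0)
  have hrows (M : Matrix (Fin m₁) (Fin m₂) ℂ) :
      fromRows M 1 =
        posColumns m₁ m₂ * M * (1 : Matrix (Fin m₂) (Fin m₂) ℂ) + negColumns m₁ m₂ := by
    ext (i | i) j <;> simp [posColumns, negColumns, fromRows_mul]
  simp only [hrows]
  have hmul := (differentiable_mul_mul (posColumns m₁ m₂)
    (1 : Matrix (Fin m₂) (Fin m₂) ℂ)).differentiableAt.comp z hcomp
  exact (hmul.add_const _).differentiableWithinAt

lemma isWeylFamily_of_isWeylFunction {T : Realization m₁ m₂ n} (hT : T ∈ classG m₁ m₂ n)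
    (hC : IsDiracPotential C) (hW : IsWeylFunction C (fun z => T.transfer (-1 / z))) :
    IsWeylFamily C (fun z => fromRows (T.transfer (-1 / z)) 1) where
  potential := hC
  differentiableOn := differentiableOn_fromRows_transfer hT
  injective := by
    refine Function.Injective.of_comp (f := fun v => v ∘ Sum.inr) fun x y hxy => ?_
    simpa [fromRows_mulVec] using hxy
  summable z hz _ := isWeylFunction_iff.1 hW z hz

theorem potential_unique_of_isWeylFunction {T : Realization m₁ m₂ n} (hT : T ∈ classG m₁ m₂ n)
    {C C' : ℕ → Matrix (Fin m₁ ⊕ Fin m₂) (Fin m₁ ⊕ Fin m₂) ℂ}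
    (hC : IsDiracPotential C) (hC' : IsDiracPotential C')
    (hW : IsWeylFunction C (fun z => T.transfer (-1 / z)))
    (hW' : IsWeylFunction C' (fun z => T.transfer (-1 / z))) : C = C' :=
  funext fun k => (isWeylFamily_of_isWeylFunction hT hC hW).potential_unique
    (isWeylFamily_of_isWeylFunction hT hC' hW') k

end Realization

end Uniqueness

/-! ### Stability -/

section Estimates

variable {ι κ : Type*} [Fintype ι] [DecidableEq ι] [Fintype κ] [DecidableEq κ]

open scoped MatrixOrder in
lemma norm_le_norm_of_posSemidef {M N : Matrix ι ι ℂ} (hM : M.PosSemidef)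
    (h : (N - M).PosSemidef) : ‖M‖ ≤ ‖N‖ :=
  CStarAlgebra.norm_le_norm_of_nonneg_of_le (Matrix.nonneg_iff_posSemidef.2 hM)
    (Matrix.le_iff.2 h)

lemma posSemidef_inv_sub_conj {S : Matrix ι ι ℂ} {S' : Matrix κ κ ℂ} (U : Matrix κ ι ℂ)
    (hS : S.PosDef) (hS' : S'.PosDef) (h : (S' - U * S * Uᴴ).PosSemidef) :
    (S⁻¹ - Uᴴ * S'⁻¹ * U).PosSemidef := by
  have := hS'.isUnit.invertible
  have := hS.inv.isUnit.invertible
  refine (PosDef.fromBlocks₁₁ U S⁻¹ hS').1 ((PosDef.fromBlocks₂₂ S' U hS.inv).2 ?_)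
  rwa [nonsing_inv_nonsing_inv _ (isUnit_det_of_posDef hS)]

lemma inv_smul_one {c : ℂ} (hc : c ≠ 0) : (c • (1 : Matrix ι ι ℂ))⁻¹ = c⁻¹ • 1 :=
  inv_eq_right_inv (by
    rw [Matrix.smul_mul, Matrix.one_mul, smul_smul, mul_inv_cancel₀ hc, one_smul])

lemma norm_conj_inv_le {S U : Matrix ι ι ℂ} (hS : S.PosDef) (hU : IsUnit U.det) {c : ℝ}
    (hc : 0 < c) (h : (U⁻¹ * S * (Uᴴ)⁻¹ - (c : ℂ) • 1).PosSemidef) (F : Matrix ι κ ℂ) :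
    ‖(U * F)ᴴ * S⁻¹ * (U * F)‖ ≤ c⁻¹ * ‖Fᴴ * F‖ := by
  have hUH : IsUnit (Uᴴ).det := by rw [det_conjTranspose]; exact hU.star
  have hsub : (S - U * ((c : ℂ) • 1) * Uᴴ).PosSemidef := by
    convert h.mul_mul_conjTranspose_same U using 1
    rw [Matrix.mul_sub, Matrix.sub_mul, Matrix.mul_assoc U⁻¹, ← Matrix.mul_assoc U U⁻¹,
      mul_nonsing_inv _ hU, Matrix.one_mul, Matrix.mul_assoc _ (Uᴴ)⁻¹ Uᴴ, nonsing_inv_mul _ hUH,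
      Matrix.mul_one]
  have hinv := (posSemidef_inv_sub_conj U (PosDef.one.smul (Complex.zero_lt_real.2 hc)) hS
    hsub).conjTranspose_mul_mul_same F
  rw [inv_smul_one (Complex.ofReal_ne_zero.2 hc.ne'), Matrix.mul_sub, Matrix.sub_mul,
    Matrix.mul_smul, Matrix.mul_one, Matrix.smul_mul] at hinv
  have hnorm := norm_le_norm_of_posSemidef (hS.inv.posSemidef.conjTranspose_mul_mul_same (U * F))
    (by simpa only [conjTranspose_mul, Matrix.mul_assoc] using hinv)
  rwa [norm_smul, norm_inv, Complex.norm_real, Real.norm_of_nonneg hc.le] at hnorm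

lemma norm_sub_one_le_norm_mul_self_sub_one {M : Matrix ι ι ℂ} (hM : M.PosSemidef) :
    ‖M - 1‖ ≤ ‖M * M - 1‖ := by
  have hsq : ((M * M - 1)ᴴ * (M * M - 1) - (M - 1)ᴴ * (M - 1)).PosSemidef := by
    convert ((hM.add hM).add (posSemidef_conjTranspose_mul_self M)).conjTranspose_mul_mul_same
      (M - 1) using 1
    simp only [conjTranspose_sub, conjTranspose_mul, conjTranspose_one, hM.1.eq]
    noncomm_ring
  have hnorm := norm_le_norm_of_posSemidef (posSemidef_conjTranspose_mul_self (M - 1)) hsq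
  rw [l2_opNorm_conjTranspose_mul_self, l2_opNorm_conjTranspose_mul_self] at hnorm
  exact (mul_self_le_mul_self_iff (norm_nonneg _) (norm_nonneg _)).2 hnorm

lemma norm_mul_self_sub_one_le (M : Matrix ι ι ℂ) :
    ‖M * M - 1‖ ≤ ‖M - 1‖ * ‖M - 1‖ + 2 * ‖M - 1‖ := by
  have hsq : M * M - 1 = (M - 1) * (M - 1) + ((M - 1) + (M - 1)) := by noncomm_ring
  rw [hsq, two_mul]
  exact (norm_add_le _ _).trans (add_le_add (norm_mul_le _ _) (norm_add_le _ _))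

lemma exists_forall_norm_blocks_lt {ρ : ℝ} (hρ : 0 < ρ) :
    ∃ η > 0, ∀ (a : Matrix ι ι ℂ) (b : Matrix ι κ ℂ) (d : Matrix κ κ ℂ), d.PosSemidef →
      a * a = 1 + b * bᴴ → d * d = 1 + bᴴ * b → ‖a - 1‖ < η →
      ‖a - 1‖ < ρ ∧ ‖b‖ < ρ ∧ ‖d - 1‖ < ρ := by
  obtain ⟨r, hr, hr1, hrρ⟩ : ∃ r : ℝ, 0 < r ∧ r ≤ 1 ∧ r ≤ ρ :=
    ⟨min 1 ρ, lt_min one_pos hρ, min_le_left _ _, min_le_right _ _⟩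
  refine ⟨r ^ 2 / 4, by positivity, fun a b d hd haa hdd ha => ?_⟩
  have ha0 := norm_nonneg (a - 1)
  have ha1 : ‖a - 1‖ ≤ 1 := by nlinarith
  have hb : ‖b‖ * ‖b‖ ≤ 3 * ‖a - 1‖ := by
    have hbb : ‖b‖ * ‖b‖ = ‖a * a - 1‖ := by
      rw [haa, add_sub_cancel_left, ← l2_opNorm_conjTranspose b,
        ← l2_opNorm_conjTranspose_mul_self, conjTranspose_conjTranspose]
    nlinarith [norm_mul_self_sub_one_le a]
  have hd1 : ‖d - 1‖ ≤ ‖b‖ * ‖b‖ := by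
    rw [← l2_opNorm_conjTranspose_mul_self b, ← add_sub_cancel_left 1 (bᴴ * b), ← hdd]
    exact norm_sub_one_le_norm_mul_self_sub_one hd
  have hbr : ‖b‖ < r := lt_of_pow_lt_pow_left₀ 2 hr.le (by nlinarith)
  exact ⟨by nlinarith, hbr.trans_le hrρ, by nlinarith⟩

end Estimates

section Compression

variable {m₁ m₂ : ℕ}

lemma exists_forall_norm_fromBlocks_sub_one_lt {ε : ℝ} (hε : 0 < ε) :
    ∃ ρ > 0, ∀ (a : Matrix (Fin m₁) (Fin m₁) ℂ) (b : Matrix (Fin m₁) (Fin m₂) ℂ)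
      (d : Matrix (Fin m₂) (Fin m₂) ℂ), ‖a - 1‖ < ρ → ‖b‖ < ρ → ‖d - 1‖ < ρ →
      ‖fromBlocks a b bᴴ d - 1‖ < ε := by
  have hcont : Continuous fun p : Matrix (Fin m₁) (Fin m₁) ℂ × Matrix (Fin m₁) (Fin m₂) ℂ ×
      Matrix (Fin m₂) (Fin m₂) ℂ => fromBlocks p.1 p.2.1 p.2.1ᴴ p.2.2 :=
    Continuous.matrix_fromBlocks continuous_fst (by fun_prop) (by fun_prop) (by fun_prop)
  obtain ⟨ρ, hρ, h⟩ := Metric.continuous_iff.1 hcont (1, 0, 1) ε hε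
  refine ⟨ρ, hρ, fun a b d ha hb hd => ?_⟩
  have hlt := h (a, b, d) (by
    rw [Prod.dist_eq, Prod.dist_eq, dist_eq_norm, dist_eq_norm, dist_eq_norm, sub_zero]
    exact max_lt ha (max_lt hb hd))
  rwa [dist_eq_norm, conjTranspose_zero, fromBlocks_one] at hlt

lemma exists_eq_fromBlocks {C : Matrix (Fin m₁ ⊕ Fin m₂) (Fin m₁ ⊕ Fin m₂) ℂ} (hC : C.PosDef)
    (hJ : C * sig m₁ m₂ * C = sig m₁ m₂) :
    ∃ a b d, C = fromBlocks a b bᴴ d ∧ a.PosSemidef ∧ d.PosSemidef ∧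
      a * a = 1 + b * bᴴ ∧ d * d = 1 + bᴴ * b := by
  obtain ⟨a, b, c, d, rfl⟩ : ∃ a b c d, C = fromBlocks a b c d :=
    ⟨_, _, _, _, (fromBlocks_toBlocks C).symm⟩
  obtain ⟨-, hcb, -, -⟩ := isHermitian_fromBlocks_iff.1 hC.1
  obtain rfl : c = bᴴ := hcb.symm
  rw [sig, fromBlocks_multiply, fromBlocks_multiply, fromBlocks_inj] at hJ
  simp only [Matrix.mul_one, Matrix.mul_zero, add_zero, zero_add, Matrix.mul_neg,
    Matrix.neg_mul] at hJ
  refine ⟨a, b, d, rfl, hC.posSemidef.submatrix Sum.inl, hC.posSemidef.submatrix Sum.inr, ?_, ?_⟩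
  · rw [← hJ.1]; abel
  · rw [← neg_neg (1 : Matrix (Fin m₂) (Fin m₂) ℂ), ← hJ.2.2.2]; abel

/-- A `j`-unitary positive definite matrix whose compression to the columns of `E` is close to that
of the identity is itself close to the identity. -/
def DetectsIdentity {ν : Type*} [Fintype ν] [DecidableEq ν] (E : Matrix (Fin m₁ ⊕ Fin m₂) ν ℂ) :
    Prop :=
  ∀ ε > 0, ∃ η > 0, ∀ C : Matrix (Fin m₁ ⊕ Fin m₂) (Fin m₁ ⊕ Fin m₂) ℂ, C.PosDef →
    C * sig m₁ m₂ * C = sig m₁ m₂ → ‖Eᴴ * (C - 1) * E‖ < η → ‖C - 1‖ < ε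

lemma detectsIdentity_posColumns : DetectsIdentity (posColumns m₁ m₂) := by
  intro ε hε
  obtain ⟨ρ, hρ, hblocks⟩ := exists_forall_norm_fromBlocks_sub_one_lt (m₁ := m₁) (m₂ := m₂) hε
  obtain ⟨η, hη, h⟩ := exists_forall_norm_blocks_lt (ι := Fin m₁) (κ := Fin m₂) hρ
  refine ⟨η, hη, fun C hC hJ hlt => ?_⟩
  obtain ⟨a, b, d, rfl, -, hd, haa, hdd⟩ := exists_eq_fromBlocks hC hJ
  have hcompress : (posColumns m₁ m₂)ᴴ * (fromBlocks a b bᴴ d - 1) * posColumns m₁ m₂ = a - 1 := by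
    simp [posColumns, conjTranspose_fromRows_eq_fromCols_conjTranspose, Matrix.mul_sub,
      Matrix.sub_mul, fromCols_mul_fromBlocks, fromCols_mul_fromRows]
  obtain ⟨ha1, hb, hd1⟩ := h a b d hd haa hdd (hcompress ▸ hlt)
  exact hblocks a b d ha1 hb hd1

lemma detectsIdentity_negColumns : DetectsIdentity (negColumns m₁ m₂) := by
  intro ε hε
  obtain ⟨ρ, hρ, hblocks⟩ := exists_forall_norm_fromBlocks_sub_one_lt (m₁ := m₁) (m₂ := m₂) hε
  obtain ⟨η, hη, h⟩ := exists_forall_norm_blocks_lt (ι := Fin m₂) (κ := Fin m₁) hρ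
  refine ⟨η, hη, fun C hC hJ hlt => ?_⟩
  obtain ⟨a, b, d, rfl, ha, -, haa, hdd⟩ := exists_eq_fromBlocks hC hJ
  have hcompress : (negColumns m₁ m₂)ᴴ * (fromBlocks a b bᴴ d - 1) * negColumns m₁ m₂ = d - 1 := by
    simp [negColumns, conjTranspose_fromRows_eq_fromCols_conjTranspose, Matrix.mul_sub,
      Matrix.sub_mul, fromCols_mul_fromBlocks, fromCols_mul_fromRows]
  obtain ⟨hd1, hb, ha1⟩ := h d bᴴ a ha (by rw [conjTranspose_conjTranspose, hdd])
    (by rw [conjTranspose_conjTranspose, haa]) (hcompress ▸ hlt)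
  exact hblocks a b d ha1 (l2_opNorm_conjTranspose b ▸ hb) hd1

end Compression

section Gram

variable {m₁ m₂ n : ℕ} {A S₀ : Matrix (Fin n) (Fin n) ℂ} {P₀ : Matrix (Fin n) (Fin m₁ ⊕ Fin m₂) ℂ}

/-- The matrices `Π_k* S_k⁻¹ Π_k`, whose consecutive differences are the `C_k - I`. -/
noncomputable def seqGram (A S₀ : Matrix (Fin n) (Fin n) ℂ)
    (P₀ : Matrix (Fin n) (Fin m₁ ⊕ Fin m₂) ℂ) (k : ℕ) :
    Matrix (Fin m₁ ⊕ Fin m₂) (Fin m₁ ⊕ Fin m₂) ℂ :=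
  (seqP A P₀ k)ᴴ * (seqS A S₀ P₀ k)⁻¹ * seqP A P₀ k

lemma seqC_eq_seqGram (k : ℕ) :
    seqC A S₀ P₀ k = 1 + (seqGram A S₀ P₀ k - seqGram A S₀ P₀ (k + 1)) :=
  add_sub_assoc _ _ _

variable {ν : Type*} {σ : ℝ} {E : Matrix (Fin m₁ ⊕ Fin m₂) ν ℂ}

lemma conj_seqGram (E : Matrix (Fin m₁ ⊕ Fin m₂) ν ℂ) (k : ℕ) :
    Eᴴ * seqGram A S₀ P₀ k * E =
      (seqP A P₀ k * E)ᴴ * (seqS A S₀ P₀ k)⁻¹ * (seqP A P₀ k * E) := by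
  simp only [seqGram, conjTranspose_mul, Matrix.mul_assoc]

lemma seqP_succ_mul (hE : sig m₁ m₂ * E = (σ : ℂ) • E) (k : ℕ) :
    seqP A P₀ (k + 1) * E = (1 + (Complex.I * σ) • A⁻¹) * (seqP A P₀ k * E) := by
  rw [seqP, Matrix.add_mul, Matrix.smul_mul, Matrix.mul_assoc, hE, Matrix.mul_smul,
    Matrix.mul_assoc, smul_smul, Matrix.add_mul, Matrix.one_mul, Matrix.smul_mul]

lemma seqP_mul (hE : sig m₁ m₂ * E = (σ : ℂ) • E) (k : ℕ) :
    seqP A P₀ k * E = (1 + (Complex.I * σ) • A⁻¹) ^ k * (P₀ * E) := by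
  induction k with
  | zero => rw [pow_zero, Matrix.one_mul, seqP]
  | succ k ih => rw [seqP_succ_mul hE, ih, pow_succ', Matrix.mul_assoc]

namespace IsAdmissible

variable (h : IsAdmissible A S₀ P₀)

include h

lemma posSemidef_seqGram (k : ℕ) : (seqGram A S₀ P₀ k).PosSemidef :=
  (h.isSNode k).posDef.inv.posSemidef.conjTranspose_mul_mul_same _

lemma posSemidef_conj_seqGram_sub [Finite ν] (hσ : σ ^ 2 = 1)
    (hE : sig m₁ m₂ * E = (σ : ℂ) • E) (k : ℕ) :
    (Eᴴ * (seqGram A S₀ P₀ k - seqGram A S₀ P₀ (k + 1)) * E).PosSemidef := by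
  have hinv := (posSemidef_inv_sub_conj _ (h.isSNode k).posDef (h.isSNode (k + 1)).posDef
    ((h.isSNode k).posSemidef_stepS_sub hσ)).conjTranspose_mul_mul_same (seqP A P₀ k * E)
  convert hinv using 1
  rw [Matrix.mul_sub, Matrix.sub_mul, conj_seqGram, conj_seqGram, seqP_succ_mul hE,
    Matrix.mul_sub, Matrix.sub_mul, conjTranspose_mul _ (seqP A P₀ k * E)]
  simp only [Matrix.mul_assoc]

variable [Fintype ν] [DecidableEq ν]

/- The compressions of `Π_k* S_k⁻¹ Π_k` decrease, so one of them bounds the whole tail. -/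
lemma norm_conj_seqC_sub_one_le (hσ : σ ^ 2 = 1) (hE : sig m₁ m₂ * E = (σ : ℂ) • E) {N k : ℕ}
    (hk : N ≤ k) : ‖Eᴴ * (seqC A S₀ P₀ k - 1) * E‖ ≤ ‖Eᴴ * seqGram A S₀ P₀ N * E‖ := by
  have hpos (j : ℕ) := (h.posSemidef_seqGram j).conjTranspose_mul_mul_same E
  have hanti : Antitone fun j => ‖Eᴴ * seqGram A S₀ P₀ j * E‖ :=
    antitone_nat_of_succ_le fun j => norm_le_norm_of_posSemidef (hpos (j + 1)) <| by
      simpa only [Matrix.mul_sub, Matrix.sub_mul] using h.posSemidef_conj_seqGram_sub hσ hE j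
  refine le_trans ?_ (hanti hk)
  rw [seqC_eq_seqGram, add_sub_cancel_left]
  refine norm_le_norm_of_posSemidef (h.posSemidef_conj_seqGram_sub hσ hE k) ?_
  rw [← Matrix.sub_mul, ← Matrix.mul_sub, sub_sub_cancel]
  exact hpos (k + 1)

lemma exists_norm_conj_seqGram_lt (hE : sig m₁ m₂ * E = (σ : ℂ) • E)
    (hU : IsUnit (1 + (Complex.I * σ) • A⁻¹).det)
    (hlim : TendsToPosInfinity fun r => ((1 + (Complex.I * σ) • A⁻¹) ^ r)⁻¹ * seqS A S₀ P₀ r *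
      (((1 + (Complex.I * σ) • A⁻¹) ^ r)ᴴ)⁻¹) {η : ℝ} (hη : 0 < η) :
    ∃ N, ‖Eᴴ * seqGram A S₀ P₀ N * E‖ < η := by
  have hsmall : Tendsto (fun c : ℝ => c⁻¹ * ‖(P₀ * E)ᴴ * (P₀ * E)‖) atTop (𝓝 0) := by
    simpa only [zero_mul] using tendsto_inv_atTop_zero.mul_const ‖(P₀ * E)ᴴ * (P₀ * E)‖
  obtain ⟨c, hc, hcη⟩ :=
    ((eventually_gt_atTop (0 : ℝ)).and (hsmall.eventually_lt_const hη)).exists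
  obtain ⟨N, hN⟩ := (hlim c).exists
  refine ⟨N, lt_of_le_of_lt ?_ hcη⟩
  rw [conj_seqGram, seqP_mul hE]
  exact norm_conj_inv_le (h.isSNode N).posDef (by rw [det_pow]; exact hU.pow N) hc hN _

end IsAdmissible

end Gram

section Continuity

variable {α : Type*} [TopologicalSpace α] {x : α} {m₁ m₂ n : ℕ}
  {A S : α → Matrix (Fin n) (Fin n) ℂ} {P : α → Matrix (Fin n) (Fin m₁ ⊕ Fin m₂) ℂ}

lemma continuousAt_matrix_inv (hA : ContinuousAt A x) (hdet : IsUnit (A x).det) :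
    ContinuousAt (fun y => (A y)⁻¹) x :=
  (continuousAt_inv_of_isUnit_det hdet).comp hA

lemma continuousAt_seqP (hdet : IsUnit (A x).det) (hA : ContinuousAt A x) (hP : ContinuousAt P x)
    (k : ℕ) : ContinuousAt (fun y => seqP (A y) (P y) k) x := by
  induction k with
  | zero => exact hP
  | succ k ih =>
    have hinv := continuousAt_matrix_inv hA hdet
    simp only [seqP]
    fun_prop

lemma continuousAt_seqS (hdet : IsUnit (A x).det) (hA : ContinuousAt A x) (hS : ContinuousAt S x)
    (hP : ContinuousAt P x) (k : ℕ) :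
    ContinuousAt (fun y => seqS (A y) (S y) (P y) k) x := by
  induction k with
  | zero => exact hS
  | succ k ih =>
    have hinv := continuousAt_matrix_inv hA hdet
    have hseqP := continuousAt_seqP hdet hA hP k
    simp only [seqS, ← conjTranspose_nonsing_inv]
    fun_prop

namespace IsAdmissible

variable (h : IsAdmissible (A x) (S x) (P x)) (hA : ContinuousAt A x) (hS : ContinuousAt S x)
  (hP : ContinuousAt P x)

include h hA hS hP

lemma continuousAt_seqGram (k : ℕ) :
    ContinuousAt (fun y => seqGram (A y) (S y) (P y) k) x := by
  have hdet := h.det_ne_zero.isUnit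
  have hseqP := continuousAt_seqP hdet hA hP k
  have hinv := continuousAt_matrix_inv (continuousAt_seqS hdet hA hS hP k)
    (isUnit_det_of_posDef (h.isSNode k).posDef)
  simp only [seqGram]
  fun_prop

lemma continuousAt_seqC (k : ℕ) : ContinuousAt (fun y => seqC (A y) (S y) (P y) k) x := by
  simp only [seqC_eq_seqGram]
  exact continuousAt_const.add
    ((h.continuousAt_seqGram hA hS hP k).sub (h.continuousAt_seqGram hA hS hP (k + 1)))

/- Continuity handles finitely many `k`; on the tail both potentials are close to `I`, since
`Π_N* S_N⁻¹ Π_N` controls them and depends continuously on the triple. -/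
lemma eventually_norm_seqC_sub_lt {ν : Type*} [Fintype ν] [DecidableEq ν] {σ : ℝ}
    {E : Matrix (Fin m₁ ⊕ Fin m₂) ν ℂ} (hσ : σ ^ 2 = 1) (hE : sig m₁ m₂ * E = (σ : ℂ) • E)
    (hdetects : DetectsIdentity E)
    (hgram : ∀ η > 0, ∃ N, ‖Eᴴ * seqGram (A x) (S x) (P x) N * E‖ < η) {ε : ℝ} (hε : 0 < ε) :
    ∀ᶠ y in 𝓝 x, IsAdmissible (A y) (S y) (P y) →
      ∀ k, ‖seqC (A x) (S x) (P x) k - seqC (A y) (S y) (P y) k‖ < ε := by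
  obtain ⟨η, hη, hC⟩ := hdetects (ε / 2) (by positivity)
  obtain ⟨N, hN⟩ := hgram η hη
  have htail {y : α} (hadm : IsAdmissible (A y) (S y) (P y))
      (hlt : ‖Eᴴ * seqGram (A y) (S y) (P y) N * E‖ < η) {k : ℕ} (hk : N ≤ k) :
      ‖seqC (A y) (S y) (P y) k - 1‖ < ε / 2 :=
    hC _ (hadm.isDiracPotential k).1 (hadm.isDiracPotential k).2
      ((hadm.norm_conj_seqC_sub_one_le hσ hE hk).trans_lt hlt)
  have hgramN : ∀ᶠ y in 𝓝 x, ‖Eᴴ * seqGram (A y) (S y) (P y) N * E‖ < η := by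
    have hcont := h.continuousAt_seqGram hA hS hP N
    exact ContinuousAt.eventually_lt (by fun_prop) continuousAt_const hN
  have hhead : ∀ᶠ y in 𝓝 x, ∀ k ∈ Finset.range N,
      ‖seqC (A x) (S x) (P x) k - seqC (A y) (S y) (P y) k‖ < ε := by
    rw [Filter.eventually_all_finset]
    intro k _
    have hcont := h.continuousAt_seqC hA hS hP k
    exact ContinuousAt.eventually_lt (by fun_prop) continuousAt_const (by simpa using hε)
  filter_upwards [hgramN, hhead] with y hyN hyhead hadm k
  rcases lt_or_ge k N with hk | hk
  · exact hyhead k (Finset.mem_range.2 hk)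
  · calc ‖seqC (A x) (S x) (P x) k - seqC (A y) (S y) (P y) k‖
        = ‖(seqC (A x) (S x) (P x) k - 1) - (seqC (A y) (S y) (P y) k - 1)‖ := by
          rw [sub_sub_sub_cancel_right]
      _ ≤ ‖seqC (A x) (S x) (P x) k - 1‖ + ‖seqC (A y) (S y) (P y) k - 1‖ := norm_sub_le _ _
      _ < ε := by linarith [htail h hN hk, htail hadm hyN hk]

end IsAdmissible

end Continuity

lemma sig_mul_posColumns {m₁ m₂ : ℕ} : sig m₁ m₂ * posColumns m₁ m₂ = posColumns m₁ m₂ := by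
  ext (i | i) j <;> simp [sig, posColumns, fromBlocks_mul_fromRows]

lemma isUnit_det_one_add_smul_inv {ι : Type*} [Fintype ι] [DecidableEq ι] {A : Matrix ι ι ℂ}
    (hA : IsUnit A.det) {s : ℂ} (hs : -s ∉ spectrum ℂ A) : IsUnit (1 + s • A⁻¹).det := by
  have hmul : 1 + s • A⁻¹ = A⁻¹ * (A - (-s) • 1) := by
    rw [Matrix.mul_sub, nonsing_inv_mul _ hA, Matrix.mul_smul, Matrix.mul_one, neg_smul,
      sub_neg_eq_add]
  rw [hmul, det_mul]
  exact (isUnit_nonsing_inv_det _ hA).mul (isUnit_det_sub_of_notMem_spectrum hs)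

namespace Realization

variable {m₁ m₂ n : ℕ} {T : Realization m₁ m₂ n} {X : Matrix (Fin n) (Fin n) ℂ}

lemma continuousAt_recP (hX : IsUnit X.det) :
    ContinuousAt (fun p : Realization m₁ m₂ n × Matrix (Fin n) (Fin n) ℂ => p.1.recP p.2)
      (T, X) := by
  have hinv : ContinuousAt (fun p : Realization m₁ m₂ n × Matrix (Fin n) (Fin n) ℂ => p.2⁻¹)
      (T, X) := continuousAt_matrix_inv continuousAt_snd hX
  have hcols (M : Matrix (Fin n) (Fin m₁) ℂ) (N : Matrix (Fin n) (Fin m₂) ℂ) :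
      fromCols M N = M * (posColumns m₁ m₂)ᴴ + N * (negColumns m₁ m₂)ᴴ := by
    ext i (j | j) <;> simp [posColumns, negColumns,
      conjTranspose_fromRows_eq_fromCols_conjTranspose, mul_fromCols]
  simp only [recP, hcols]
  fun_prop

lemma eventually_recAdmissible (hdet : (T.recA X).det ≠ 0) :
    ∀ᶠ p : Realization m₁ m₂ n × Matrix (Fin n) (Fin n) ℂ in 𝓝 (T, X),
      p.1 ∈ classG m₁ m₂ n → p.2.IsHermitian → p.1.Riccati p.2 → p.1.RecAdmissible p.2 := by
  filter_upwards [continuous_recA.matrix_det.continuousAt.eventually_ne hdet]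
    with p hp hmem hherm hric
  exact recAdmissible (posDef_of_riccati hmem hherm hric) hric hp

lemma eventually_norm_recC_sub_lt_of_tendsToPosInfinity (hX : X.PosDef) (h : T.RecAdmissible X)
    {ν : Type*} [Fintype ν] [DecidableEq ν] {σ : ℝ} {E : Matrix (Fin m₁ ⊕ Fin m₂) ν ℂ}
    (hσ : σ ^ 2 = 1) (hE : sig m₁ m₂ * E = (σ : ℂ) • E) (hdetects : DetectsIdentity E)
    (hspec : -(Complex.I * σ) ∉ spectrum ℂ (T.recA X))
    (hlim : TendsToPosInfinity fun r => ((1 + (Complex.I * σ) • (T.recA X)⁻¹) ^ r)⁻¹ *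
      seqS (T.recA X) X⁻¹ (T.recP X) r * (((1 + (Complex.I * σ) • (T.recA X)⁻¹) ^ r)ᴴ)⁻¹)
    {ε : ℝ} (hε : 0 < ε) :
    ∀ᶠ p : Realization m₁ m₂ n × Matrix (Fin n) (Fin n) ℂ in 𝓝 (T, X),
      p.1.RecAdmissible p.2 → ∀ k, ‖T.recC X k - p.1.recC p.2 k‖ < ε :=
  IsAdmissible.eventually_norm_seqC_sub_lt (x := (T, X))
    (A := fun p : Realization m₁ m₂ n × Matrix (Fin n) (Fin n) ℂ => p.1.recA p.2)
    (S := fun p => p.2⁻¹) (P := fun p => p.1.recP p.2) h continuous_recA.continuousAt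
    (continuousAt_matrix_inv continuousAt_snd (isUnit_det_of_posDef hX))
    (continuousAt_recP (isUnit_det_of_posDef hX)) hσ hE hdetects
    (fun _ => h.exists_norm_conj_seqGram_lt hE
      (isUnit_det_one_add_smul_inv h.det_ne_zero.isUnit hspec) hlim) hε

lemma eventually_norm_recC_sub_lt (hX : T.IsSpectralSolution X) (h : T.RecAdmissible X)
    (hlim : TendsToPosInfinity (T.recR X) ∨
      (Complex.I ∉ spectrum ℂ (T.recA X) ∧ TendsToPosInfinity (T.recQ X))) {ε : ℝ} (hε : 0 < ε) :
    ∀ᶠ p : Realization m₁ m₂ n × Matrix (Fin n) (Fin n) ℂ in 𝓝 (T, X),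
      p.1.RecAdmissible p.2 → ∀ k, ‖T.recC X k - p.1.recC p.2 k‖ < ε := by
  rcases hlim with hR | ⟨hI, hQ⟩
  · refine eventually_norm_recC_sub_lt_of_tendsToPosInfinity hX.posDef h (one_pow 2)
      (by simpa using sig_mul_posColumns) detectsIdentity_posColumns (fun hmem => ?_) ?_ hε
    · have him : 0 ≤ (-(Complex.I * ((1 : ℝ) : ℂ))).im := hX.spectrum_subset hmem
      norm_num at him
    · convert hR using 2 with r
      simp [recR, seqR, conjTranspose_pow, conjTranspose_nonsing_inv, sub_eq_add_neg]
  · refine eventually_norm_recC_sub_lt_of_tendsToPosInfinity (σ := -1) hX.posDef h (by norm_num)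
      (by simpa using sig_mul_negColumns) detectsIdentity_negColumns (by simpa using hI) ?_ hε
    convert hQ using 2 with r
    simp [recQ, seqQ, conjTranspose_pow, conjTranspose_nonsing_inv, sub_eq_add_neg]

theorem stableRecovery (hT : T ∈ classG m₁ m₂ n) (hX : T.IsSpectralSolution X)
    (hdet : (T.recA X).det ≠ 0)
    (hlim : TendsToPosInfinity (T.recR X) ∨
      (Complex.I ∉ spectrum ℂ (T.recA X) ∧ TendsToPosInfinity (T.recQ X))) :
    T.StableRecovery X := by
  intro ε hε
  have hadm := recAdmissible hX.posDef hX.riccati hdet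
  obtain ⟨δ₁, hδ₁, hnear⟩ := Metric.eventually_nhds_iff.1
    ((eventually_recAdmissible hdet).and (eventually_norm_recC_sub_lt hX hadm hlim hε))
  have hstable : ∀ U ∈ classG m₁ m₂ n, T.distance U < δ₁ → ∀ Y : Matrix (Fin n) (Fin n) ℂ,
      Y.IsHermitian → U.Riccati Y → ‖X - Y‖ < δ₁ →
      U.RecAdmissible Y ∧ ∀ k, ‖T.recC X k - U.recC Y k‖ < ε := by
    intro U hU hTU Y hY hric hXY
    obtain ⟨hadmU, hC⟩ := hnear (y := (U, Y)) <| by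
      rw [dist_comm, Prod.dist_eq, dist_eq_norm]
      exact max_lt hTU hXY
    exact ⟨hadmU hU hY hric, hC (hadmU hU hY hric)⟩
  obtain ⟨δ₂, hδ₂, hclose⟩ := Metric.eventually_nhds_iff.1
    (hX.eventually_norm_sub_lt hT.1.isControllable (lt_min hε hδ₁))
  refine ⟨min δ₁ δ₂, lt_min hδ₁ hδ₂, fun U hU hTU =>
    ⟨existsUnique_isSpectralSolution hU, fun Y hY => ?_, fun Y hY hric hXY => ?_⟩⟩
  · have hXY := hclose (dist_comm T U ▸ hTU.trans_le (min_le_right _ _)) Y hY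
    exact ⟨hXY.trans_le (min_le_left _ _), hstable U hU (hTU.trans_le (min_le_left _ _)) Y
      hY.posDef.1 hY.riccati (hXY.trans_le (min_le_right _ _))⟩
  · exact hstable U hU (hTU.trans_le (min_le_left _ _)) Y hY hric
      (hXY.trans_le (min_le_left _ _))

end Realization

end DiscreteDirac

theorem theorem4p4 {m₁ m₂ n : ℕ} (T : DiscreteDirac.Realization m₁ m₂ n)
    (hT : T ∈ DiscreteDirac.Realization.classG m₁ m₂ n) :
    -- the choice of `X` by the spectral condition is always possible, in a unique way
    (∃! X : Matrix (Fin n) (Fin n) ℂ, T.IsSpectralSolution X) ∧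
    ∀ X : Matrix (Fin n) (Fin n) ℂ, T.IsSpectralSolution X → (T.recA X).det ≠ 0 →
      -- the procedure recovers the one and only system whose Weyl function is `φ(z) = ψ(-1/z)`
      (T.RecAdmissible X ∧ DiscreteDirac.IsDiracPotential (T.recC X) ∧
        DiscreteDirac.IsWeylFunction (T.recC X) (fun z => T.transfer (-1 / z)) ∧
        ∀ C : ℕ → Matrix (Fin m₁ ⊕ Fin m₂) (Fin m₁ ⊕ Fin m₂) ℂ,
          DiscreteDirac.IsDiracPotential C →
          DiscreteDirac.IsWeylFunction C (fun z => T.transfer (-1 / z)) → C = T.recC X) ∧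
      -- and it is stable when `R_k → +∞`, or when `i ∉ σ(A)` and `Q_k → +∞`
      ((DiscreteDirac.TendsToPosInfinity (T.recR X) ∨
          (Complex.I ∉ spectrum ℂ (T.recA X) ∧ DiscreteDirac.TendsToPosInfinity (T.recQ X))) →
        T.StableRecovery X) := by
  have hex := DiscreteDirac.Realization.existsUnique_isSpectralSolution hT
  refine ⟨hex, fun X hX hdet => ?_⟩
  have hadm := DiscreteDirac.Realization.recAdmissible hX.posDef hX.riccati hdet
  have hpot : DiscreteDirac.IsDiracPotential (T.recC X) := hadm.isDiracPotential
  have hweyl := DiscreteDirac.Realization.isWeylFunction_recC hT hX hadm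
  exact ⟨⟨hadm, hpot, hweyl, fun C hC hW =>
    DiscreteDirac.Realization.potential_unique_of_isWeylFunction hT hC hpot hW hweyl⟩,
    DiscreteDirac.Realization.stableRecovery hT hX hdet⟩
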